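/- Let $n\ge 2$, let $\Omega\subset\mathbb{R}^n$ be a domain (a nonempty connected open set) with Lebesgue measure $|\Omega|=1$, and let $X(\Omega)$, $Y(\Omega)$ be two rearrangement invariant Banach function spaces (in the sense of Bennett and Sharpley, so with the Fatou property) over $\Omega$ with Lebesgue measure. Let $\hat X$, $\hat Y$ be their representations as function spaces on $(0,1)$, that is, $\|h\|_{\hat X}=\|f\|_{X(\Omega)}$ whenever the function $h$ on $(0,1)$ and the function $f$ on $\Omega$ are equimeasurable, and likewise for $Y$. For measurable $f$ on $(0,1)$ let $f^{*}(t)=\inf\{\lambda\ge 0: |\{|f|>\lambda\}|\le t\}$ be its decreasing rearrangement and $f^{**}(t)=\frac1t\int_0^t f^{*}(s)\,ds$. Write $f_\Omega=\frac{1}{|\Omega|}\int_\Omega f$, and let $\nabla f$ be the weak gradient. Assume that there is a constant $C_0$ with \[ \left(\int_\Omega |f(x)-f_\Omega|^{n/(n-1)}\,dx\right)^{\frac{n-1}{n}}\le C_0\int_\Omega|\nabla f(x)|\,dx\qquad\text{for all } f\in W^{1,1}(\Omega). \] Then the following statements are equivalent. (i) There is a constant $C$ such that for all measurable $f:(0,1)\to\mathbb{R}$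 \[ \|f\|_{\hat Y}\le C\left(\left\|s^{-1/n}\,[f^{**}(s)-f^{*}(s)]\right\|_{\hat X}+\|f\|_{L^1(0,1)}\right) \] (where the right-hand side is understood as $+\infty$ if $f\notin L^1(0,1)$). (ii) There is a constant $C$ such that \[ \left\|\int_t^1 s^{1/n}f(s)\,\frac{ds}{s}\right\|_{\hat Y}\le C\,\|f\|_{\hat X}\qquad\text{for all } f\in\hat X,\ f\ge 0. \] (iii) There is a constant $C$ such that \[ \|f-f_\Omega\|_{Y(\Omega)}\le C\,\|\nabla f\|_{X(\Omega)}\qquad\text{for all } f\in W^1_X(\Omega)=\{f\in X(\Omega):\ |\nabla f|\in X(\Omega)\}. \] In all three statements a norm of a function outside the space is $+\infty$, so a finite right-hand side asserts membership in $\hat Y$ or $Y(\Omega)$. -/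

import Mathlib

open MeasureTheory Set
open scoped ENNReal NNReal

/-- Two functions (on possibly different measure spaces) are equimeasurable if they have the same
distribution function. -/
def Equimeasurable {α β : Type*} [MeasurableSpace α] [MeasurableSpace β]
    (μ : Measure α) (ν : Measure β) (f : α → ℝ≥0∞) (g : β → ℝ≥0∞) : Prop :=
  ∀ t : ℝ≥0∞, μ {x | t < f x} = ν {y | t < g y}

/-- A rearrangement invariant Banach function norm (in the sense of Bennett and Sharpley) on the
nonnegative measurable functions of a measure space. It determines the r.i. space of the
measurable functions `f` with `norm |f| < ∞`. -/
structure RINorm {α : Type*} [MeasurableSpace α] (μ : Measure α) where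
  norm : (α → ℝ≥0∞) → ℝ≥0∞
  norm_eq_zero_iff : ∀ f, AEMeasurable f μ → (norm f = 0 ↔ f =ᵐ[μ] 0)
  norm_smul : ∀ (c : ℝ≥0) (f), AEMeasurable f μ → norm (fun x => c * f x) = c * norm f
  norm_add_le : ∀ f g, AEMeasurable f μ → AEMeasurable g μ →
    norm (fun x => f x + g x) ≤ norm f + norm g
  norm_mono : ∀ f g, AEMeasurable f μ → AEMeasurable g μ → f ≤ᵐ[μ] g → norm f ≤ norm g
  /-- The Fatou property. -/
  norm_iSup : ∀ f : ℕ → α → ℝ≥0∞, (∀ k, AEMeasurable (f k) μ) →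
    (∀ᵐ x ∂μ, Monotone fun k => f k x) → norm (fun x => ⨆ k, f k x) = ⨆ k, norm (f k)
  norm_indicator_lt_top : ∀ E : Set α, MeasurableSet E → μ E < ∞ → norm (E.indicator 1) < ∞
  exists_setLIntegral_le : ∀ E : Set α, MeasurableSet E → μ E < ∞ →
    ∃ C : ℝ≥0, ∀ f, AEMeasurable f μ → ∫⁻ x in E, f x ∂μ ≤ C * norm f
  norm_eq_of_equimeasurable : ∀ f g, AEMeasurable f μ → AEMeasurable g μ →
    Equimeasurable μ μ f g → norm f = norm g

/-- Membership of a scalar or vector valued function in the r.i. space given by `X`. -/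
def RINorm.Mem {α : Type*} [MeasurableSpace α] {μ : Measure α} (X : RINorm μ)
    {F : Type*} [NormedAddCommGroup F] (f : α → F) : Prop :=
  AEStronglyMeasurable f μ ∧ X.norm (fun x => ‖f x‖ₑ) < ∞

/-- Lebesgue measure on the interval `(0, 1)`. -/
noncomputable def unitMeasure : Measure ℝ := volume.restrict (Ioo 0 1)

/-- The norm of the representation on `(0, 1)` of an r.i. space over a nonatomic probability
space: the norm of `h` is the common value of the original norm on all the functions that are
equimeasurable with `h`. -/
noncomputable def RINorm.hat {α : Type*} [MeasurableSpace α] {μ : Measure α} (X : RINorm μ)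
    (h : ℝ → ℝ≥0∞) : ℝ≥0∞ :=
  ⨆ (f : α → ℝ≥0∞) (_ : AEMeasurable f μ) (_ : Equimeasurable μ unitMeasure f h), X.norm f

theorem RINorm.hat_eq {α : Type*} [MeasurableSpace α] {μ : Measure α} (X : RINorm μ)
    {h : ℝ → ℝ≥0∞} {f : α → ℝ≥0∞} (hf : AEMeasurable f μ)
    (hfh : Equimeasurable μ unitMeasure f h) : X.hat h = X.norm f := by
  refine le_antisymm (iSup_le fun g => iSup_le fun hg => iSup_le fun hgh => ?_) ?_
  · exact (X.norm_eq_of_equimeasurable g f hg hf fun t => (hgh t).trans (hfh t).symm).le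
  · exact le_iSup_of_le f (le_iSup_of_le hf (le_iSup_of_le hfh le_rfl))

/-- The decreasing rearrangement `f^*` of a nonnegative function. -/
noncomputable def rearr {α : Type*} [MeasurableSpace α] (μ : Measure α) (f : α → ℝ≥0∞)
    (t : ℝ) : ℝ≥0∞ :=
  sInf {l : ℝ≥0∞ | μ {x | l < f x} ≤ ENNReal.ofReal t}

/-- The maximal average `f^{**}(t) = (1/t) ∫₀ᵗ f^*(s) ds`, for `t > 0`. -/
noncomputable def rearrAvg {α : Type*} [MeasurableSpace α] (μ : Measure α) (f : α → ℝ≥0∞)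
    (t : ℝ) : ℝ≥0∞ :=
  (ENNReal.ofReal t)⁻¹ * ∫⁻ s in Ioo 0 t, rearr μ f s

/-- The function `s ↦ s^{-1/n} (f^{**}(s) - f^*(s))` of a function `f` on `(0, 1)`. -/
noncomputable def weightedOscillation (n : ℕ) (f : ℝ → ℝ) (s : ℝ) : ℝ≥0∞ :=
  ENNReal.ofReal (s ^ (-(1 / n : ℝ))) *
    (rearrAvg unitMeasure (fun r => ‖f r‖ₑ) s - rearr unitMeasure (fun r => ‖f r‖ₑ) s)

/-- The Hardy type operator `f ↦ ∫ₜ¹ s^{1/n} f(s) ds/s` on nonnegative functions on `(0, 1)`. -/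
noncomputable def hardyOp (n : ℕ) (f : ℝ → ℝ) (t : ℝ) : ℝ≥0∞ :=
  ∫⁻ s in Ioo t 1, ENNReal.ofReal (s ^ (1 / n : ℝ) * f s / s)

/-- `g` is the weak gradient of `f` on the open set `Ω`. -/
def HasWeakGradient {n : ℕ} (Ω : Set (EuclideanSpace ℝ (Fin n)))
    (f : EuclideanSpace ℝ (Fin n) → ℝ)
    (g : EuclideanSpace ℝ (Fin n) → EuclideanSpace ℝ (Fin n)) : Prop :=
  LocallyIntegrableOn f Ω ∧ LocallyIntegrableOn g Ω ∧
    ∀ φ : EuclideanSpace ℝ (Fin n) → ℝ, ContDiff ℝ (⊤ : ℕ∞) φ → HasCompactSupport φ → tsupport φ ⊆ Ω →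
      ∀ i : Fin n, ∫ x in Ω, f x * fderiv ℝ φ x (EuclideanSpace.single i 1) =
        -∫ x in Ω, g x i * φ x

/-- The Sobolev-Poincaré inequality from `W^{1,1}(Ω)` into `L^{n/(n-1)}(Ω)`. -/
def SobolevPoincare {n : ℕ} (Ω : Set (EuclideanSpace ℝ (Fin n))) : Prop :=
  ∃ C : ℝ≥0, ∀ f g, HasWeakGradient Ω f g → IntegrableOn f Ω → IntegrableOn g Ω →
    (∫⁻ x in Ω, ‖f x - ⨍ y in Ω, f y‖ₑ ^ (n / (n - 1) : ℝ)) ^ ((n - 1) / n : ℝ) ≤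
      C * ∫⁻ x in Ω, ‖g x‖ₑ

/-! The Hardy inequality (ii) is the hub: it is shown equivalent to (i) and to (iii). Everything is
compared on `(0, 1)` through a measure preserving map `σ : Ω → (0, 1)`, along which an r.i. norm
pulls back to an r.i. norm on `(0, 1)`. Write `Hf` for `hardyOp n f`.

(ii) to (i): `f**` has derivative `-(f** - f*)/s`, so `f*(t) ≤ f**(t) = ∫ₜ¹ (f** - f*) ds/s + ‖f‖₁`,
and the integral is `H` applied to the weighted oscillation (`rearr_le_hardyOp_oscillation`).

(i) to (ii): test (i) with `Hf`. It is nonincreasing and right-continuous, hence its own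
rearrangement, and its weighted oscillation is at most `t^{-1-1/n} ∫₀ᵗ s^{1/n} f`. Cut into dyadic
blocks, this is dominated by a geometric series of shifted dyadic averages of `f`. Averaging over
disjoint sets does not increase an r.i. norm (`RINorm.norm_dyadicAverage_le`); the proof dominates
an average by means of cyclic translates, each with distribution function at most that of the
original.

(ii) to (iii): applying Sobolev-Poincaré to smooth truncations of `f` gives a capacity estimate: `(b
- a) |{f ≥ b}|^{(n-1)/n}` is controlled by the integral of `|∇f|` over the strip `{a < f < b}`
alone. Taking for levels the values of the rearrangement at `2^{-j}` and telescoping bounds the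
rearrangement by `H` of a step function whose values are `2^{k+1}` times integrals of `|∇f|` over
disjoint strips. The averaging lemma bounds its norm by that of `∇f`. This treats the part of `f`
above a median (`exists_norm_posPart_le`); `-f` treats the part below, and the median is then
exchanged for the mean.

(iii) to (ii): choose `σ` radial on a ball in `Ω`. For bounded `f` the radial Lipschitz function
with slope `f ∘ σ` reproduces `Hf ∘ σ` on the ball, up to constant factors and an additive tail
controlled by `‖f‖₁`. The Fatou property removes the boundedness. -/

/-! ### Decreasing rearrangements and distribution functions. -/

section Rearrangement

variable {α β : Type*} [MeasurableSpace α] [MeasurableSpace β]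

instance : IsProbabilityMeasure unitMeasure := ⟨by simp [unitMeasure]⟩

/-- The distribution function is right-continuous, because `{l < f}` is the increasing union of the
sets `{u k < f}` with `u k` decreasing to `l`. So the infimum defining `rearr` is attained. No
measurability of `f` is required. -/
theorem lt_rearr_iff (μ : Measure α) (f : α → ℝ≥0∞) (t : ℝ) (l : ℝ≥0∞) :
    l < rearr μ f t ↔ ENNReal.ofReal t < μ {x | l < f x} := by
  constructor
  · intro h
    by_contra! hc
    exact absurd (sInf_le (s := {l : ℝ≥0∞ | μ {x | l < f x} ≤ ENNReal.ofReal t}) hc) (not_le.2 h)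
  · intro h
    have hl : l ≠ ∞ := by rintro rfl; simp at h
    obtain ⟨u, hu, hul, hut⟩ := exists_seq_strictAnti_tendsto' (lt_top_iff_ne_top.2 hl)
    have hU : {x | l < f x} = ⋃ k, {x | u k < f x} := by
      ext x
      simp only [mem_ofPred_eq, mem_iUnion]
      refine ⟨fun hx => (hut.eventually_lt_const hx).exists, fun ⟨k, hk⟩ => (hul k).1.trans hk⟩
    have hm : Monotone fun k => {x | u k < f x} :=
      fun i j hij x hx => lt_of_le_of_lt (hu.antitone hij) hx
    rw [hU, hm.measure_iUnion] at h
    obtain ⟨k, hk⟩ := lt_iSup_iff.1 h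
    refine (hul k).1.trans_le (le_sInf fun m hm => ?_)
    by_contra! hc
    have : μ {x | u k < f x} ≤ μ {x | m < f x} := measure_mono fun x hx => hc.trans hx
    exact absurd (hk.trans_le this) (not_lt.2 hm)

theorem rearr_le_iff (μ : Measure α) (f : α → ℝ≥0∞) (t : ℝ) (l : ℝ≥0∞) :
    rearr μ f t ≤ l ↔ μ {x | l < f x} ≤ ENNReal.ofReal t := by
  rw [← not_lt, lt_rearr_iff, not_lt]

theorem rearr_antitone (μ : Measure α) (f : α → ℝ≥0∞) : Antitone (rearr μ f) := fun s t hst => by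
  rw [rearr_le_iff]
  exact ((rearr_le_iff μ f s _).1 le_rfl).trans (ENNReal.ofReal_le_ofReal hst)

theorem measurable_rearr (μ : Measure α) (f : α → ℝ≥0∞) : Measurable (rearr μ f) :=
  (rearr_antitone μ f).measurable

theorem measure_lt_rearr_le (μ : Measure α) (f : α → ℝ≥0∞) (t : ℝ) :
    μ {x | rearr μ f t < f x} ≤ ENNReal.ofReal t :=
  (rearr_le_iff μ f t _).1 le_rfl

/-- Continuity from above along levels increasing to `rearr μ f t`; this is where finiteness of the
measure enters. -/
theorem le_measure_rearr_le (μ : Measure α) [IsProbabilityMeasure μ] {f : α → ℝ≥0∞}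
    (hf : AEMeasurable f μ) {t : ℝ} (ht : t ≤ 1) :
    ENNReal.ofReal t ≤ μ {x | rearr μ f t ≤ f x} := by
  rcases eq_or_ne (rearr μ f t) 0 with h0 | h0
  · simp [h0, ht]
  obtain ⟨u, hu, hul, hut⟩ := exists_seq_strictMono_tendsto' (pos_iff_ne_zero.2 h0)
  have hI : {x | rearr μ f t ≤ f x} = ⋂ k, {x | u k < f x} := by
    ext x
    simp only [mem_ofPred_eq, mem_iInter]
    exact ⟨fun hx k => (hul k).2.trans_le hx,
      fun hx => le_of_tendsto' hut fun k => (hx k).le⟩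
  have ha : Antitone fun k => {x | u k < f x} :=
    fun i j hij x hx => lt_of_le_of_lt (hu.monotone hij) hx
  rw [hI, ha.measure_iInter (fun k => nullMeasurableSet_lt aemeasurable_const hf)
    ⟨0, measure_ne_top _ _⟩]
  exact le_iInf fun k => ((lt_rearr_iff μ f t _).1 (hul k).2).le

theorem rearr_lt_top (μ : Measure α) [IsFiniteMeasure μ] {f : α → ℝ≥0∞}
    (hf : AEMeasurable f μ) (hfin : ∀ᵐ x ∂μ, f x < ∞) {t : ℝ} (ht : 0 < t) :
    rearr μ f t < ∞ := by
  have ha : Antitone fun k : ℕ => {x | (k : ℝ≥0∞) < f x} :=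
    fun i j hij x hx => lt_of_le_of_lt (Nat.cast_le.2 hij : (i : ℝ≥0∞) ≤ j) hx
  have h := tendsto_measure_iInter_atTop (μ := μ)
    (fun k => nullMeasurableSet_lt aemeasurable_const hf) ha ⟨0, measure_ne_top _ _⟩
  have h0 : μ (⋂ k : ℕ, {x | (k : ℝ≥0∞) < f x}) = 0 := by
    refine measure_mono_null ?_ hfin
    intro x hx
    simp only [mem_iInter, mem_ofPred_eq] at hx
    simp only [mem_compl_iff, mem_ofPred_eq, not_lt, top_le_iff]
    by_contra hc
    obtain ⟨k, hk⟩ := ENNReal.exists_nat_gt hc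
    exact absurd (hx k) (not_lt.2 hk.le)
  rw [h0] at h
  obtain ⟨k, hk⟩ := (h.eventually_lt_const (ENNReal.ofReal_pos.2 ht)).exists
  exact ((rearr_le_iff μ f t _).2 hk.le).trans_lt (ENNReal.natCast_lt_top k)

theorem Equimeasurable.symm {μ : Measure α} {ν : Measure β} {f : α → ℝ≥0∞} {g : β → ℝ≥0∞}
    (h : Equimeasurable μ ν f g) : Equimeasurable ν μ g f := fun t => (h t).symm

theorem unitMeasure_lt_eq (d : ℝ≥0∞) (hd : d ≤ 1) :
    unitMeasure {t : ℝ | ENNReal.ofReal t < d} = d := by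
  have hdt : d ≠ ∞ := (hd.trans_lt ENNReal.one_lt_top).ne
  have hset : {t : ℝ | ENNReal.ofReal t < d} ∩ Ioo 0 1 = Ioo 0 d.toReal := by
    ext t
    simp only [mem_inter_iff, mem_ofPred_eq, mem_Ioo]
    have h1 : d.toReal ≤ 1 := ENNReal.toReal_le_of_le_ofReal zero_le_one (by simpa using hd)
    constructor
    · rintro ⟨h, h0, _⟩
      exact ⟨h0, (ENNReal.ofReal_lt_iff_lt_toReal h0.le hdt).1 h⟩
    · rintro ⟨h0, h⟩
      exact ⟨(ENNReal.ofReal_lt_iff_lt_toReal h0.le hdt).2 h, h0, h.trans_le h1⟩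
  rw [unitMeasure, Measure.restrict_apply (measurableSet_lt (by fun_prop) measurable_const), hset,
    Real.volume_Ioo, sub_zero, ENNReal.ofReal_toReal hdt]

theorem equimeasurable_rearr (μ : Measure α) [IsProbabilityMeasure μ] (f : α → ℝ≥0∞) :
    Equimeasurable unitMeasure μ (rearr μ f) f := fun l => by
  simp_rw [lt_rearr_iff]
  exact unitMeasure_lt_eq _ prob_le_one

theorem Equimeasurable.map_eq {μ : Measure α} {ν : Measure β} [IsProbabilityMeasure μ]
    [IsProbabilityMeasure ν] {f : α → ℝ≥0∞} {g : β → ℝ≥0∞} (hf : AEMeasurable f μ)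
    (hg : AEMeasurable g ν) (h : Equimeasurable μ ν f g) : μ.map f = ν.map g := by
  have := Measure.isProbabilityMeasure_map hf
  have := Measure.isProbabilityMeasure_map hg
  refine Measure.ext_of_Iic _ _ fun t => ?_
  rw [← compl_Ioi, prob_compl_eq_one_sub measurableSet_Ioi,
    prob_compl_eq_one_sub measurableSet_Ioi, Measure.map_apply_of_aemeasurable hf measurableSet_Ioi,
    Measure.map_apply_of_aemeasurable hg measurableSet_Ioi]
  exact congrArg _ (h t)

theorem Equimeasurable.lintegral_eq {μ : Measure α} {ν : Measure β} [IsProbabilityMeasure μ]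
    [IsProbabilityMeasure ν] {f : α → ℝ≥0∞} {g : β → ℝ≥0∞} (hf : AEMeasurable f μ)
    (hg : AEMeasurable g ν) (h : Equimeasurable μ ν f g) : ∫⁻ x, f x ∂μ = ∫⁻ y, g y ∂ν := by
  have h1 := lintegral_map' (μ := μ) (f := id) (g := f) measurable_id.aemeasurable hf
  have h2 := lintegral_map' (μ := ν) (f := id) (g := g) measurable_id.aemeasurable hg
  simp only [id] at h1 h2
  rw [← h1, ← h2, h.map_eq hf hg]

theorem lintegral_rearr (μ : Measure α) [IsProbabilityMeasure μ] {f : α → ℝ≥0∞}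
    (hf : AEMeasurable f μ) : ∫⁻ t in Ioo 0 1, rearr μ f t = ∫⁻ x, f x ∂μ :=
  Equimeasurable.lintegral_eq (μ := unitMeasure) (measurable_rearr μ f).aemeasurable hf
    (equimeasurable_rearr μ f)

/-- Right-continuous nonincreasing functions agree with their rearrangement. -/
theorem rearr_unitMeasure_eq {F : ℝ → ℝ≥0∞} (hF : Antitone F) {t : ℝ} (ht : t ∈ Ioo (0 : ℝ) 1)
    (hc : ∀ l < F t, ∃ s ∈ Ioo t 1, l < F s) : rearr unitMeasure F t = F t := by
  have hm : ∀ l, MeasurableSet {x | l < F x} := fun l => measurableSet_lt measurable_const hF.measurable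
  refine eq_of_forall_lt_iff fun l => ?_
  rw [lt_rearr_iff, unitMeasure, Measure.restrict_apply (hm l)]
  constructor
  · intro h
    by_contra! hl
    have hsub : {x | l < F x} ∩ Ioo 0 1 ⊆ Ioo 0 t := fun x hx =>
      ⟨hx.2.1, lt_of_not_ge fun hc => absurd (hx.1.trans_le (hF hc)) (not_lt.2 hl)⟩
    refine absurd (h.trans_le (measure_mono hsub)) ?_
    simp
  · intro hl
    obtain ⟨s, hs, hls⟩ := hc l hl
    have hsub : Ioo 0 s ⊆ {x | l < F x} ∩ Ioo 0 1 := fun x hx =>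
      ⟨hls.trans_le (hF hx.2.le), hx.1, hx.2.trans hs.2⟩
    refine lt_of_lt_of_le ?_ (measure_mono hsub)
    simp only [Real.volume_Ioo, sub_zero]
    exact (ENNReal.ofReal_lt_ofReal_iff (ht.1.trans hs.1)).2 hs.1

end Rearrangement

/-! ### Transfer of an r.i. norm to the unit interval. -/

section Representation

variable {α : Type*} [MeasurableSpace α] {μ : Measure α}

theorem RINorm.norm_congr_ae (X : RINorm μ) {f g : α → ℝ≥0∞} (hf : AEMeasurable f μ)
    (h : f =ᵐ[μ] g) : X.norm f = X.norm g :=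
  le_antisymm (X.norm_mono f g hf (hf.congr h) h.le) (X.norm_mono g f (hf.congr h) hf h.symm.le)

theorem RINorm.norm_finset_sum_le (X : RINorm μ) {ι : Type*} (s : Finset ι) {f : ι → α → ℝ≥0∞}
    (hf : ∀ i, AEMeasurable (f i) μ) :
    X.norm (fun x => ∑ i ∈ s, f i x) ≤ ∑ i ∈ s, X.norm (f i) := by
  classical
  induction s using Finset.induction_on with
  | empty =>
    simp only [Finset.sum_empty, nonpos_iff_eq_zero]
    exact (X.norm_eq_zero_iff _ aemeasurable_const).2 (by rfl)
  | insert a s ha ih =>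
    simp only [Finset.sum_insert ha]
    exact (X.norm_add_le _ _ (hf a) (Finset.aemeasurable_fun_sum s fun i _ => hf i)).trans
      (add_le_add le_rfl ih)

theorem RINorm.norm_tsum_le (X : RINorm μ) {f : ℕ → α → ℝ≥0∞} (hf : ∀ i, AEMeasurable (f i) μ) :
    X.norm (fun x => ∑' i, f i x) ≤ ∑' i, X.norm (f i) := by
  simp_rw [ENNReal.tsum_eq_iSup_nat]
  rw [X.norm_iSup _ (fun k => Finset.aemeasurable_fun_sum _ fun i _ => hf i)
    (Filter.Eventually.of_forall fun x i j hij =>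
      Finset.sum_le_sum_of_subset (Finset.range_subset_range.2 hij))]
  exact iSup_mono fun k => X.norm_finset_sum_le _ hf

theorem equimeasurable_comp {σ : α → ℝ} (hσ : MeasurePreserving σ μ unitMeasure) {h : ℝ → ℝ≥0∞}
    (hh : AEMeasurable h unitMeasure) : Equimeasurable μ unitMeasure (h ∘ σ) h := fun _ =>
  hσ.measure_preimage (nullMeasurableSet_lt aemeasurable_const hh)

theorem AEMeasurable.comp_measurePreserving {σ : α → ℝ} {h : ℝ → ℝ≥0∞}
    (hh : AEMeasurable h unitMeasure) (hσ : MeasurePreserving σ μ unitMeasure) :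
    AEMeasurable (h ∘ σ) μ := hh.comp_quasiMeasurePreserving hσ.quasiMeasurePreserving

/-- The representation of a rearrangement invariant norm along a measure preserving map. -/
noncomputable def RINorm.toUnit (X : RINorm μ) {σ : α → ℝ}
    (hσ : MeasurePreserving σ μ unitMeasure) : RINorm unitMeasure where
  norm h := X.norm (h ∘ σ)
  norm_eq_zero_iff h hh := by
    rw [X.norm_eq_zero_iff _ (hh.comp_measurePreserving hσ)]
    have h0 : unitMeasure {t | ¬ h t = 0} = μ (σ ⁻¹' {t | ¬ h t = 0}) := by
      rw [hσ.measure_preimage]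
      have : {t | ¬ h t = 0} = {t | 0 < h t} := by ext; simp [pos_iff_ne_zero]
      rw [this]
      exact nullMeasurableSet_lt aemeasurable_const hh
    change μ _ = 0 ↔ unitMeasure _ = 0
    exact Eq.congr_left h0.symm
  norm_smul c h hh := X.norm_smul c _ (hh.comp_measurePreserving hσ)
  norm_add_le f g hf hg := X.norm_add_le _ _ (hf.comp_measurePreserving hσ)
    (hg.comp_measurePreserving hσ)
  norm_mono f g hf hg h := X.norm_mono _ _ (hf.comp_measurePreserving hσ)
    (hg.comp_measurePreserving hσ) (hσ.quasiMeasurePreserving.ae h)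
  norm_iSup f hf hm := X.norm_iSup (fun k => f k ∘ σ) (fun k => (hf k).comp_measurePreserving hσ)
    (hσ.quasiMeasurePreserving.ae hm)
  norm_indicator_lt_top E hE _ := by
    have := X.norm_indicator_lt_top (σ ⁻¹' E) (hσ.measurable hE)
      (by rw [hσ.measure_preimage hE.nullMeasurableSet]; exact measure_lt_top _ _)
    exact this
  exists_setLIntegral_le E hE _ := by
    obtain ⟨C, hC⟩ := X.exists_setLIntegral_le (σ ⁻¹' E) (hσ.measurable hE)
      (by rw [hσ.measure_preimage hE.nullMeasurableSet]; exact measure_lt_top _ _)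
    refine ⟨C, fun f hf => ?_⟩
    have h := hC (f ∘ σ) (hf.comp_measurePreserving hσ)
    rw [← lintegral_indicator hE]
    rw [← lintegral_indicator (hσ.measurable hE)] at h
    rw [← hσ.map_eq, lintegral_map' (by rw [hσ.map_eq]; exact hf.indicator hE)
      hσ.measurable.aemeasurable]
    exact h
  norm_eq_of_equimeasurable f g hf hg h :=
    X.norm_eq_of_equimeasurable _ _ (hf.comp_measurePreserving hσ) (hg.comp_measurePreserving hσ)
      fun t => ((equimeasurable_comp hσ hf t).trans (h t)).trans (equimeasurable_comp hσ hg t).symm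

/-- Turns the supremum `hat` into an honest r.i. norm on `(0, 1)`, so that the triangle inequality,
monotonicity and the Fatou property become available for it. -/
theorem RINorm.hat_eq_toUnit (X : RINorm μ) {σ : α → ℝ} (hσ : MeasurePreserving σ μ unitMeasure)
    {h : ℝ → ℝ≥0∞} (hh : AEMeasurable h unitMeasure) : X.hat h = (X.toUnit hσ).norm h :=
  X.hat_eq (hh.comp_measurePreserving hσ) (equimeasurable_comp hσ hh)

theorem RINorm.toUnit_norm_rearr [IsProbabilityMeasure μ] (X : RINorm μ) {σ : α → ℝ}
    (hσ : MeasurePreserving σ μ unitMeasure) {f : α → ℝ≥0∞} (hf : AEMeasurable f μ) :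
    (X.toUnit hσ).norm (rearr μ f) = X.norm f :=
  X.norm_eq_of_equimeasurable _ _
    ((measurable_rearr μ f).aemeasurable.comp_measurePreserving hσ) hf fun t =>
      (equimeasurable_comp hσ (measurable_rearr μ f).aemeasurable t).trans
        (equimeasurable_rearr μ f t)

theorem RINorm.toUnit_norm_comp (X : RINorm μ) {σ : α → ℝ}
    (hσ : MeasurePreserving σ μ unitMeasure) (h : ℝ → ℝ≥0∞) :
    (X.toUnit hσ).norm h = X.norm (fun x => h (σ x)) := rfl

/-- An r.i. norm is monotone with respect to distribution functions. -/
theorem RINorm.norm_le_norm_rearr [IsProbabilityMeasure μ] (Z : RINorm unitMeasure)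
    {h : ℝ → ℝ≥0∞} (hh : AEMeasurable h unitMeasure) {f : α → ℝ≥0∞}
    (hle : ∀ l, unitMeasure {t | l < h t} ≤ μ {x | l < f x}) :
    Z.norm h ≤ Z.norm (rearr μ f) := by
  rw [Z.norm_eq_of_equimeasurable h (rearr unitMeasure h) hh
    (measurable_rearr _ _).aemeasurable (equimeasurable_rearr _ _).symm]
  refine Z.norm_mono _ _ (measurable_rearr _ _).aemeasurable (measurable_rearr _ _).aemeasurable
    (Filter.Eventually.of_forall fun t => ?_)
  rw [rearr_le_iff]
  exact (hle _).trans (measure_lt_rearr_le μ f t)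

theorem RINorm.exists_lintegral_le [IsFiniteMeasure μ] (X : RINorm μ) :
    ∃ C : ℝ≥0, ∀ f, AEMeasurable f μ → ∫⁻ x, f x ∂μ ≤ C * X.norm f := by
  simpa using X.exists_setLIntegral_le univ MeasurableSet.univ (measure_lt_top _ _)

theorem RINorm.norm_const_eq [IsFiniteMeasure μ] (X : RINorm μ) {c : ℝ≥0∞} (hc : c ≠ ∞) :
    X.norm (fun _ => c) = c * X.norm 1 := by
  lift c to ℝ≥0 using hc
  simpa using X.norm_smul c 1 aemeasurable_const

theorem RINorm.norm_one_lt_top [IsFiniteMeasure μ] (X : RINorm μ) : X.norm 1 < ∞ := by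
  simpa using X.norm_indicator_lt_top univ MeasurableSet.univ (measure_lt_top _ _)

end Representation

/-! ### Averages over disjoint sets, via cyclic translations. -/

section Averaging

/-- The `k` with `2⁻¹ ^ (k + 1) < t ≤ 2⁻¹ ^ k`, for `0 < t ≤ 1`. -/
noncomputable def dyadicIndex (t : ℝ) : ℕ := Nat.log 2 ⌊t⁻¹⌋₊

theorem measurable_dyadicIndex : Measurable dyadicIndex :=
  (measurable_from_top (f := Nat.log 2)).comp (Nat.measurable_floor.comp measurable_inv)

theorem dyadicIndex_eq_iff {t : ℝ} (ht : t ∈ Ioc (0 : ℝ) 1) (k : ℕ) :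
    dyadicIndex t = k ↔ t ∈ Ioc ((2⁻¹ : ℝ) ^ (k + 1)) (2⁻¹ ^ k) := by
  have h1 : 1 ≤ ⌊t⁻¹⌋₊ := Nat.le_floor (by simpa using (one_le_inv₀ ht.1).2 ht.2)
  rw [dyadicIndex, Nat.log_eq_iff (Or.inr ⟨one_lt_two, by omega⟩),
    Nat.le_floor_iff (inv_pos.2 ht.1).le, Nat.floor_lt (inv_pos.2 ht.1).le, mem_Ioc, and_comm]
  simp only [inv_pow, Nat.cast_pow, Nat.cast_ofNat]
  rw [inv_lt_comm₀ ht.1 (by positivity), le_inv_comm₀ (by positivity) ht.1]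

/-- Cyclic translation of `(0, L]` by `c`. -/
noncomputable def cyclicShift (L c s : ℝ) : ℝ := if s + c ≤ L then s + c else s + c - L

theorem measurable_cyclicShift (L c : ℝ) : Measurable (cyclicShift L c) :=
  Measurable.ite (measurableSet_le (by fun_prop) (by fun_prop)) (by fun_prop) (by fun_prop)

/-- The two branches of the shift are translations, onto the part of `S ∩ (0, L]` above `c` and the
part up to `c`. These are disjoint, so their measures add up. -/
theorem volume_cyclicShift_le {S : Set ℝ} {a L c : ℝ} (hc0 : 0 ≤ c)
    (hcL : c ≤ L) :
    volume {t | t ∈ Ioc a (a + L) ∧ cyclicShift L c (t - a) ∈ S} ≤ volume (S ∩ Ioc 0 L) := by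
  set S' := S ∩ Ioc 0 L
  have hsub : {t | t ∈ Ioc a (a + L) ∧ cyclicShift L c (t - a) ∈ S} ⊆
      (fun t => t + (c - a)) ⁻¹' (S' \ Iic c) ∪ (fun t => t + (c - a - L)) ⁻¹' (S' ∩ Iic c) := by
    rintro t ⟨⟨hta, htL⟩, hS⟩
    unfold cyclicShift at hS
    split_ifs at hS with h
    · left
      have : t + (c - a) = t - a + c := by ring
      simp only [mem_preimage, this]
      exact ⟨⟨hS, by linarith, h⟩, by simp; linarith⟩
    · right
      have : t + (c - a - L) = t - a + c - L := by ring
      simp only [mem_preimage, this]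
      exact ⟨⟨hS, by linarith, by linarith⟩, by simp; linarith⟩
  calc _ ≤ _ := measure_mono hsub
    _ ≤ _ := measure_union_le _ _
    _ = volume (S' \ Iic c) + volume (S' ∩ Iic c) := by
      rw [measure_preimage_add_right, measure_preimage_add_right]
    _ = _ := measure_sdiff_add_inter S' measurableSet_Iic

/-- The `N` shifts of `s` form a grid of mesh `L / N` in `(0, L]`, so every `r` in `(L / N, L)` lies
less than one mesh to the right of a grid point, where `G` is at least `G r`. The first cell is left
out because there may be no grid point to the left of `r`. -/
theorem setLIntegral_le_sum_cyclicShift {G : ℝ → ℝ≥0∞} (hG : Antitone G) {L s : ℝ} (hL : 0 < L)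
    (hs : s ∈ Ioc 0 L) (N : ℕ) (hN : 0 < N) :
    ∫⁻ r in Ioo (L / N) L, G r ≤
      ∑ i ∈ Finset.range N, ENNReal.ofReal (L / N) * G (cyclicShift L (i * (L / N)) s) := by
  have hN' : (0 : ℝ) < N := by exact_mod_cast hN
  set δ := L / N with hδ
  have hδ0 : 0 < δ := by positivity
  have hNδ : N * δ = L := by rw [hδ]; field_simp
  have hcov : Ioo δ L ⊆ ⋃ i ∈ Finset.range N,
      Ico (cyclicShift L (i * δ) s) (cyclicShift L (i * δ) s + δ) := by
    intro r hr
    simp only [mem_iUnion, Finset.mem_range, exists_prop]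
    have key : ∀ y : ℝ, 0 ≤ y → y < L → ∃ i : ℕ, i < N ∧ i * δ ≤ y ∧ y < i * δ + δ := by
      intro y hy0 hyL
      refine ⟨⌊y / δ⌋₊, ?_, ?_, ?_⟩
      · rw [Nat.floor_lt (by positivity), div_lt_iff₀ hδ0, hNδ]; exact hyL
      · rw [← le_div_iff₀ hδ0]; exact Nat.floor_le (by positivity)
      · have := Nat.lt_floor_add_one (y / δ)
        rw [div_lt_iff₀ hδ0] at this
        linarith
    rcases le_or_gt s r with h | h
    · obtain ⟨i, hi, h1, h2⟩ := key (r - s) (by linarith) (by linarith [hs.1, hr.2])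
      refine ⟨i, hi, ?_⟩
      rw [cyclicShift, if_pos (by linarith [hr.2])]
      exact ⟨by linarith, by linarith⟩
    · obtain ⟨i, hi, h1, h2⟩ := key (r - s + L) (by linarith [hs.2, hr.1]) (by linarith)
      refine ⟨i, hi, ?_⟩
      rw [cyclicShift, if_neg (by linarith [hr.1])]
      exact ⟨by linarith, by linarith⟩
  calc ∫⁻ r in Ioo δ L, G r
      ≤ ∫⁻ r in ⋃ i ∈ Finset.range N,
          Ico (cyclicShift L (i * δ) s) (cyclicShift L (i * δ) s + δ), G r :=
        lintegral_mono_set hcov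
    _ ≤ ∑ i ∈ Finset.range N,
          ∫⁻ r in Ico (cyclicShift L (i * δ) s) (cyclicShift L (i * δ) s + δ), G r := by
        have h := lintegral_iUnion_le (μ := volume) (fun i : Finset.range N =>
          Ico (cyclicShift L (i * δ) s) (cyclicShift L (i * δ) s + δ)) G
        rwa [iUnion_subtype, Finset.tsum_subtype (Finset.range N) (fun i : ℕ =>
          ∫⁻ r in Ico (cyclicShift L (i * δ) s) (cyclicShift L (i * δ) s + δ), G r)] at h
    _ ≤ _ := by
        refine Finset.sum_le_sum fun i _ => ?_
        calc _ ≤ ∫⁻ r in Ico (cyclicShift L (i * δ) s) (cyclicShift L (i * δ) s + δ),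
              G (cyclicShift L (i * δ) s) :=
              setLIntegral_mono measurable_const fun r hr => hG hr.1
          _ = _ := by simp [mul_comm]

theorem measurable_comp_dyadicIndex {G : ℕ → ℝ → ℝ≥0∞} (hG : ∀ k, Measurable (G k)) :
    Measurable fun t => G (dyadicIndex t) t :=
  (measurable_from_prod_countable_right (f := fun p : ℕ × ℝ => G p.1 p.2) hG).comp
    (measurable_dyadicIndex.prodMk measurable_id)

theorem dyadic_mem_Ioc {t : ℝ} (ht : t ∈ Ioc (0 : ℝ) 1) :
    t ∈ Ioc ((2⁻¹ : ℝ) ^ (dyadicIndex t + 1)) (2⁻¹ ^ dyadicIndex t) :=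
  (dyadicIndex_eq_iff ht _).1 rfl

theorem half_pow_add_half_pow (k : ℕ) : (2⁻¹ : ℝ) ^ (k + 1) + 2⁻¹ ^ (k + 1) = 2⁻¹ ^ k := by
  rw [pow_succ]; ring

variable {α : Type*} [MeasurableSpace α] {μ : Measure α} [IsProbabilityMeasure μ]

/-- On the `k`-th dyadic interval the function is a cyclic translate of the rearrangement of `g`
restricted to `B k`. Its superlevel set there is thus no larger than that of `g` inside `B k`, and
the `B k` are disjoint. -/
theorem unitMeasure_lt_rearrangedShift_le {g : α → ℝ≥0∞} {B : ℕ → Set α}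
    (hB : ∀ k, MeasurableSet (B k)) (hdisj : Pairwise (Function.onFun Disjoint B))
    (hg : AEMeasurable g μ) {c : ℕ → ℝ} (hc0 : ∀ k, 0 ≤ c k) (hc : ∀ k, c k ≤ 2⁻¹ ^ (k + 1))
    (l : ℝ≥0∞) :
    unitMeasure {t | l < rearr μ ((B (dyadicIndex t)).indicator g)
      (cyclicShift (2⁻¹ ^ (dyadicIndex t + 1)) (c (dyadicIndex t))
        (t - 2⁻¹ ^ (dyadicIndex t + 1)))} ≤ μ {x | l < g x} := by
  set S : ℕ → Set ℝ := fun k => {r | l < rearr μ ((B k).indicator g) r}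
  have hSm : ∀ k, MeasurableSet (S k) := fun k =>
    measurableSet_lt measurable_const (measurable_rearr _ _)
  have hsub : {t | l < rearr μ ((B (dyadicIndex t)).indicator g)
      (cyclicShift (2⁻¹ ^ (dyadicIndex t + 1)) (c (dyadicIndex t))
        (t - 2⁻¹ ^ (dyadicIndex t + 1)))} ∩ Ioo 0 1 ⊆ ⋃ k, {t | t ∈ Ioc ((2⁻¹ : ℝ) ^ (k + 1))
          (2⁻¹ ^ (k + 1) + 2⁻¹ ^ (k + 1)) ∧
          cyclicShift (2⁻¹ ^ (k + 1)) (c k) (t - 2⁻¹ ^ (k + 1)) ∈ S k} := by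
    rintro t ⟨ht, ht1⟩
    refine mem_iUnion.2 ⟨dyadicIndex t, ?_, ht⟩
    rw [half_pow_add_half_pow]
    exact dyadic_mem_Ioc ⟨ht1.1, ht1.2.le⟩
  have hmeas : MeasurableSet {t | l < rearr μ ((B (dyadicIndex t)).indicator g)
      (cyclicShift (2⁻¹ ^ (dyadicIndex t + 1)) (c (dyadicIndex t))
        (t - 2⁻¹ ^ (dyadicIndex t + 1)))} :=
    measurableSet_lt measurable_const (measurable_comp_dyadicIndex
      (G := fun k t => rearr μ ((B k).indicator g)
        (cyclicShift (2⁻¹ ^ (k + 1)) (c k) (t - 2⁻¹ ^ (k + 1)))) fun k =>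
        (measurable_rearr _ _).comp ((measurable_cyclicShift _ _).comp (by fun_prop)))
  rw [unitMeasure, Measure.restrict_apply hmeas]
  calc _ ≤ _ := measure_mono hsub
    _ ≤ _ := measure_iUnion_le _
    _ ≤ ∑' k, μ ({x | l < g x} ∩ B k) := by
      refine ENNReal.tsum_le_tsum fun k => (volume_cyclicShift_le (hc0 k) (hc k)).trans ?_
      have h1 : volume (S k ∩ Ioc 0 (2⁻¹ ^ (k + 1))) ≤ unitMeasure (S k) := by
        rw [unitMeasure, Measure.restrict_apply (hSm k)]
        exact measure_mono (inter_subset_inter_right _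
          (Ioc_subset_Ioo_right (pow_lt_one₀ (by norm_num) (by norm_num) (by simp))))
      refine h1.trans (((equimeasurable_rearr μ ((B k).indicator g)) l).trans_le
        (measure_mono fun x hx => ?_))
      by_cases hxB : x ∈ B k
      · exact ⟨by simpa [hxB] using hx, hxB⟩
      · simp [hxB] at hx
    _ = μ (⋃ k, ({x | l < g x} ∩ B k)) := by
      rw [measure_iUnion₀ (fun i j hij => ((hdisj hij).mono inter_subset_right
        inter_subset_right).aedisjoint)]
      exact fun k => (nullMeasurableSet_lt aemeasurable_const hg).inter (hB k).nullMeasurableSet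
    _ ≤ _ := measure_mono (iUnion_subset fun k => inter_subset_left)

/-- The rearrangement of a function supported in `B` vanishes from `μ B` on, so all its mass sits in
`(0, L)`. -/
theorem setLIntegral_rearr_indicator {g : α → ℝ≥0∞} (hg : AEMeasurable g μ) {B : Set α}
    (hB : MeasurableSet B) {L : ℝ} (hL1 : L ≤ 1) (hBL : μ B ≤ ENNReal.ofReal L) :
    ∫⁻ r in Ioo 0 L, rearr μ (B.indicator g) r = ∫⁻ x in B, g x ∂μ := by
  rw [← lintegral_indicator hB, ← lintegral_rearr μ (hg.indicator hB)]
  rw [← lintegral_inter_add_sdiff _ (Ioo 0 1) (measurableSet_Ioo (a := (0 : ℝ)) (b := L)),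
    inter_eq_self_of_subset_right (Ioo_subset_Ioo_right hL1),
    setLIntegral_eq_zero (measurableSet_Ioo.diff measurableSet_Ioo) (fun r hr => ?_), add_zero]
  have hrL : L ≤ r := not_lt.1 fun h => hr.2 ⟨hr.1.1, h⟩
  rw [Pi.zero_apply, ← nonpos_iff_eq_zero, rearr_le_iff]
  refine (measure_mono fun x hx => ?_).trans (hBL.trans (ENNReal.ofReal_le_ofReal hrL))
  by_contra hxB
  simp [hxB] at hx

/-- Averaging over disjoint sets does not increase rearrangement invariant norms. -/
theorem RINorm.norm_dyadicAverage_le (Z : RINorm unitMeasure) {g : α → ℝ≥0∞}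
    (hg : AEMeasurable g μ) {B : ℕ → Set α} (hB : ∀ k, MeasurableSet (B k))
    (hdisj : Pairwise (Function.onFun Disjoint B))
    (hBL : ∀ k, μ (B k) ≤ ENNReal.ofReal (2⁻¹ ^ (k + 1))) :
    Z.norm (fun t => 2 ^ (dyadicIndex t + 1) * ∫⁻ x in B (dyadicIndex t), g x ∂μ) ≤
      Z.norm (rearr μ g) := by
  set G : ℕ → ℝ → ℝ≥0∞ := fun k => rearr μ ((B k).indicator g)
  set L : ℕ → ℝ := fun k => 2⁻¹ ^ (k + 1)
  have hL0 : ∀ k, 0 < L k := fun k => by positivity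
  have hL1 : ∀ k, L k ≤ 1 := fun k => pow_le_one₀ (by norm_num) (by norm_num)
  have hLinv : ∀ k, ENNReal.ofReal (L k)⁻¹ = 2 ^ (k + 1) := fun k => by
    simp only [L, inv_pow, inv_inv]
    rw [ENNReal.ofReal_pow (by norm_num)]; simp
  -- The average over `(0, L)` is the increasing limit of these cut-off averages, so by the Fatou
  -- property it suffices to bound each of them. The cut-off is the cell missing from
  -- `setLIntegral_le_sum_cyclicShift`.
  set Φ : ℕ → ℝ → ℝ≥0∞ := fun m t => ENNReal.ofReal (L (dyadicIndex t))⁻¹ *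
    ∫⁻ r in Ioo (L (dyadicIndex t) / (m + 1 : ℕ)) (L (dyadicIndex t)), G (dyadicIndex t) r
  have hΦm : ∀ m, Measurable (Φ m) := fun m => measurable_comp_dyadicIndex
    (G := fun k _ => ENNReal.ofReal (L k)⁻¹ * ∫⁻ r in Ioo (L k / (m + 1 : ℕ)) (L k), G k r)
    fun k => measurable_const
  have hmono : ∀ k, Monotone fun m : ℕ => Ioo (L k / (m + 1 : ℕ)) (L k) := fun k i j hij =>
    Ioo_subset_Ioo_left (by
      have := hL0 k
      gcongr)
  have hΦ : (fun t => 2 ^ (dyadicIndex t + 1) * ∫⁻ x in B (dyadicIndex t), g x ∂μ) =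
      fun t => ⨆ m, Φ m t := by
    funext t
    set k := dyadicIndex t
    have hU : (⋃ m : ℕ, Ioo (L k / (m + 1 : ℕ)) (L k)) = Ioo 0 (L k) := by
      ext r
      simp only [mem_iUnion, mem_Ioo]
      constructor
      · rintro ⟨m, h1, h2⟩
        exact ⟨lt_trans (by have := hL0 k; positivity) h1, h2⟩
      · rintro ⟨h1, h2⟩
        obtain ⟨m, hm⟩ := exists_nat_gt (L k / r)
        refine ⟨m, ?_, h2⟩
        rw [div_lt_iff₀ h1] at hm
        rw [div_lt_iff₀ (by positivity)]
        push_cast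
        nlinarith
    rw [← ENNReal.mul_iSup, ← setLIntegral_iUnion_of_directed _ (hmono k).directed_le, hU,
      setLIntegral_rearr_indicator hg (hB k) (hL1 k) (hBL k), hLinv]
  rw [hΦ, Z.norm_iSup _ (fun m => (hΦm m).aemeasurable) (Filter.Eventually.of_forall fun t i j hij =>
    mul_le_mul_right (lintegral_mono_set (hmono _ hij)) _)]
  refine iSup_le fun m => ?_
  set N : ℕ := m + 1
  -- Each translate `s i` has a distribution function at most that of `g`, and `Φ m` is at most the
  -- arithmetic mean of the `N` translates; the triangle inequality then gives constant one.
  set s : ℕ → ℝ → ℝ≥0∞ := fun i t => G (dyadicIndex t) (cyclicShift (L (dyadicIndex t))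
    (i * (L (dyadicIndex t) / N)) (t - L (dyadicIndex t)))
  have hsm : ∀ i, Measurable (s i) := fun i => measurable_comp_dyadicIndex
    (G := fun k t => G k (cyclicShift (L k) (i * (L k / N)) (t - L k))) fun k =>
      (measurable_rearr _ _).comp ((measurable_cyclicShift _ _).comp (by fun_prop))
  have hs : ∀ i ∈ Finset.range N, Z.norm (s i) ≤ Z.norm (rearr μ g) := fun i hi => by
    refine Z.norm_le_norm_rearr (hsm i).aemeasurable fun l => ?_
    refine unitMeasure_lt_rearrangedShift_le (c := fun k => i * (L k / N)) hB hdisj hg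
      (fun k => by have := hL0 k; positivity) (fun k => ?_) l
    have hi' : (i : ℝ) ≤ N := by exact_mod_cast (Finset.mem_range.1 hi).le
    have hN : (0 : ℝ) < N := by positivity
    calc (i : ℝ) * (L k / N) ≤ N * (L k / N) := by have := hL0 k; gcongr
      _ = L k := by field_simp
  have hle : Φ m ≤ᵐ[unitMeasure] fun t => ((N : ℝ≥0)⁻¹ : ℝ≥0) * ∑ i ∈ Finset.range N, s i t := by
    refine (ae_restrict_iff' measurableSet_Ioo).2 (Filter.Eventually.of_forall fun t ht => ?_)
    set k := dyadicIndex t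
    have htk := dyadic_mem_Ioc ⟨ht.1, ht.2.le⟩
    have hk2 := half_pow_add_half_pow k
    have h1 := setLIntegral_le_sum_cyclicShift (G := G k) (rearr_antitone _ _) (hL0 k)
      (s := t - L k) ⟨sub_pos.2 htk.1, sub_le_iff_le_add.2 (htk.2.trans_eq hk2.symm)⟩ N (Nat.succ_pos m)
    refine (mul_le_mul_right h1 _).trans_eq ?_
    rw [← Finset.mul_sum, ← mul_assoc, ← ENNReal.ofReal_mul (by have := hL0 k; positivity)]
    congr 1
    have : (L k)⁻¹ * (L k / N) = (N : ℝ)⁻¹ := by have := (hL0 k).ne'; field_simp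
    rw [this, ENNReal.ofReal_inv_of_pos (by positivity), ENNReal.ofReal_natCast,
      ENNReal.coe_inv (by positivity)]
    simp
  calc Z.norm (Φ m)
      ≤ Z.norm fun t => ((N : ℝ≥0)⁻¹ : ℝ≥0) * ∑ i ∈ Finset.range N, s i t :=
        Z.norm_mono _ _ (hΦm m).aemeasurable ((Finset.measurable_sum _ fun i _ => hsm i).const_mul
          _).aemeasurable hle
    _ = ((N : ℝ≥0)⁻¹ : ℝ≥0) * Z.norm fun t => ∑ i ∈ Finset.range N, s i t :=
        Z.norm_smul _ _ (Finset.measurable_sum _ fun i _ => hsm i).aemeasurable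
    _ ≤ ((N : ℝ≥0)⁻¹ : ℝ≥0) * ∑ i ∈ Finset.range N, Z.norm (rearr μ g) := by
        gcongr
        exact (Z.norm_finset_sum_le _ fun i => (hsm i).aemeasurable).trans (Finset.sum_le_sum hs)
    _ = Z.norm (rearr μ g) := by
        rw [Finset.sum_const, Finset.card_range, nsmul_eq_mul, ← mul_assoc,
          ENNReal.coe_inv (by positivity), ENNReal.coe_natCast,
          ENNReal.inv_mul_cancel (by positivity) (ENNReal.natCast_ne_top N), one_mul]

end Averaging

/-! ### The Hardy inequality implies the oscillation inequality. -/

section Hardy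

theorem lintegral_mul_lintegral_Ioo {w F : ℝ → ℝ≥0∞} {a b : ℝ}
    (hw : AEMeasurable w (volume.restrict (Ioo a b)))
    (hF : AEMeasurable F (volume.restrict (Ioo a b))) :
    ∫⁻ s in Ioo a b, w s * ∫⁻ r in Ioo a s, F r =
      ∫⁻ r in Ioo a b, F r * ∫⁻ s in Ioo r b, w s := by
  set ν := volume.restrict (Ioo a b)
  have h1 : ∀ s ∈ Ioo a b, w s * ∫⁻ r in Ioo a s, F r =
      ∫⁻ r, {p : ℝ × ℝ | p.2 < p.1}.indicator (fun p => w p.1 * F p.2) (s, r) ∂ν := by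
    intro s hs
    have hr : (volume.restrict (Ioo a s)) = ν.restrict (Iio s) := by
      rw [Measure.restrict_restrict measurableSet_Iio, inter_comm, Ioo_inter_Iio, min_eq_right hs.2.le]
    rw [← lintegral_const_mul'' _ (hF.mono_measure
      (Measure.restrict_mono (Ioo_subset_Ioo_right hs.2.le) le_rfl)), hr,
      ← lintegral_indicator measurableSet_Iio]
    refine lintegral_congr fun r => ?_
    simp [indicator]
  have h2 : ∀ r ∈ Ioo a b, F r * ∫⁻ s in Ioo r b, w s =
      ∫⁻ s, {p : ℝ × ℝ | p.2 < p.1}.indicator (fun p => w p.1 * F p.2) (s, r) ∂ν := by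
    intro r hr
    have hr' : (volume.restrict (Ioo r b)) = ν.restrict (Ioi r) := by
      rw [Measure.restrict_restrict measurableSet_Ioi, inter_comm, Ioo_inter_Ioi, max_eq_right hr.1.le]
    rw [← lintegral_const_mul'' _ (hw.mono_measure
      (Measure.restrict_mono (Ioo_subset_Ioo_left hr.1.le) le_rfl)), hr',
      ← lintegral_indicator measurableSet_Ioi]
    refine lintegral_congr fun s => ?_
    simp [indicator, mul_comm]
  rw [setLIntegral_congr_fun measurableSet_Ioo h1, setLIntegral_congr_fun measurableSet_Ioo h2]
  refine lintegral_lintegral_swap ?_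
  exact ((hw.comp_fst (ν := ν)).mul (hF.comp_snd (μ := ν))).indicator
    (measurableSet_lt measurable_snd measurable_fst)

theorem lintegral_inv_sq {r : ℝ} (hr : 0 < r) (hr1 : r ≤ 1) :
    ∫⁻ s in Ioo r 1, ENNReal.ofReal (s⁻¹ * s⁻¹) = ENNReal.ofReal (r⁻¹ - 1) := by
  have h0 : (0 : ℝ) ∉ uIcc r 1 := by
    rw [uIcc_of_le hr1]; exact fun h => absurd h.1 (not_le.2 hr)
  have hI : ∫ s in r..1, s⁻¹ * s⁻¹ = r⁻¹ - 1 := by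
    have := integral_zpow (a := r) (b := 1) (n := -2) (Or.inr ⟨by norm_num, h0⟩)
    have e : ∀ s : ℝ, s⁻¹ * s⁻¹ = s ^ (-2 : ℤ) := fun s => by
      rw [zpow_neg, ← mul_inv]; norm_cast; rw [pow_two]
    simp_rw [e]
    rw [this]
    norm_num [zpow_neg_one]
    ring
  rw [← hI, intervalIntegral.integral_of_le hr1, restrict_Ioo_eq_restrict_Ioc,
    ofReal_integral_eq_lintegral_ofReal]
  · refine (intervalIntegrable_iff_integrableOn_Ioc_of_le hr1).1 (ContinuousOn.intervalIntegrable ?_)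
    have : ContinuousOn (fun s : ℝ => s⁻¹) (uIcc r 1) :=
      continuousOn_id.inv₀ fun x hx h => h0 (h ▸ hx)
    exact this.mul this
  · exact Filter.Eventually.of_forall fun s => mul_self_nonneg _

theorem setLIntegral_Ioo_split (F : ℝ → ℝ≥0∞) {a b c : ℝ} (hab : a ≤ b) (hbc : b ≤ c) :
    ∫⁻ r in Ioo a c, F r = (∫⁻ r in Ioo a b, F r) + ∫⁻ r in Ioo b c, F r := by
  rcases hbc.eq_or_lt with rfl | hbc
  · simp
  rw [← Ioc_union_Ioo_eq_Ioo hab hbc, lintegral_union measurableSet_Ioo,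
    ← restrict_Ioo_eq_restrict_Ioc (a := a)]
  exact disjoint_left.2 fun x hx hx' => absurd hx.2 (not_le.2 hx'.1)

/-- A nonincreasing function is controlled by the oscillation of its averages. -/
theorem Antitone.le_lintegral_oscillation {F : ℝ → ℝ≥0∞} (hF : Antitone F)
    (hfin : ∫⁻ r in Ioo 0 1, F r ≠ ∞) {t : ℝ} (ht : t ∈ Ioo (0 : ℝ) 1) :
    F t ≤ (∫⁻ s in Ioo t 1, ENNReal.ofReal s⁻¹ *
      ((ENNReal.ofReal s)⁻¹ * (∫⁻ r in Ioo 0 s, F r) - F s)) + ∫⁻ r in Ioo 0 1, F r := by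
  have hFm := hF.measurable
  have ht0 : 0 < t := ht.1
  have hinv : ∀ s : ℝ, 0 < s → (ENNReal.ofReal s)⁻¹ = ENNReal.ofReal s⁻¹ := fun s hs =>
    (ENNReal.ofReal_inv_of_pos hs).symm
  set A := ∫⁻ s in Ioo t 1, ENNReal.ofReal s⁻¹ *
      ((ENNReal.ofReal s)⁻¹ * (∫⁻ r in Ioo 0 s, F r) - F s)
  set B := ∫⁻ s in Ioo t 1, ENNReal.ofReal s⁻¹ * F s
  set J := ∫⁻ r in Ioo 0 t, F r
  -- `B` occurs on both sides of `h3` and can be cancelled only if it is finite.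
  have hBfin : B ≠ ∞ := by
    have : B ≤ ENNReal.ofReal t⁻¹ * ∫⁻ r in Ioo 0 1, F r := by
      rw [← lintegral_const_mul _ hFm]
      calc B ≤ ∫⁻ s in Ioo t 1, ENNReal.ofReal t⁻¹ * F s := by
            refine setLIntegral_mono (by fun_prop) fun s hs => ?_
            gcongr
            exact hs.1.le
        _ ≤ _ := lintegral_mono_set (Ioo_subset_Ioo_left ht0.le)
    exact (this.trans_lt (ENNReal.mul_lt_top ENNReal.ofReal_lt_top hfin.lt_top)).ne
  have h1 : ∫⁻ s in Ioo t 1, ENNReal.ofReal s⁻¹ * ((ENNReal.ofReal s)⁻¹ * ∫⁻ r in Ioo 0 s, F r)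
      ≤ A + B := by
    rw [← lintegral_add_right _ (by fun_prop)]
    refine lintegral_mono fun s => ?_
    rw [← mul_add]
    gcongr
    exact le_tsub_add
  -- Tonelli takes the place of integrating `(F**)' = -(F** - F)/s`: split `(0, s)` at `t` and
  -- integrate `s^{-2}` first.
  have h2 : ∫⁻ s in Ioo t 1, ENNReal.ofReal s⁻¹ * ((ENNReal.ofReal s)⁻¹ * ∫⁻ r in Ioo 0 s, F r) =
      J * ENNReal.ofReal (t⁻¹ - 1) + ∫⁻ r in Ioo t 1, F r * ENNReal.ofReal (r⁻¹ - 1) := by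
    have e1 : ∀ s ∈ Ioo t 1, ENNReal.ofReal s⁻¹ * ((ENNReal.ofReal s)⁻¹ * ∫⁻ r in Ioo 0 s, F r) =
        J * ENNReal.ofReal (s⁻¹ * s⁻¹) + ENNReal.ofReal (s⁻¹ * s⁻¹) * ∫⁻ r in Ioo t s, F r := by
      intro s hs
      have hs0 := ht0.trans hs.1
      rw [hinv s hs0, setLIntegral_Ioo_split F ht0.le hs.1.le, ENNReal.ofReal_mul (by positivity)]
      ring
    rw [setLIntegral_congr_fun measurableSet_Ioo e1, lintegral_add_left (by fun_prop),
      lintegral_const_mul _ (by fun_prop), lintegral_inv_sq ht0 ht.2.le,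
      lintegral_mul_lintegral_Ioo (by fun_prop) (by fun_prop)]
    congr 1
    refine setLIntegral_congr_fun measurableSet_Ioo fun r hr => ?_
    rw [lintegral_inv_sq (ht0.trans hr.1) hr.2.le]
  have h3 : J * ENNReal.ofReal t⁻¹ + B ≤ A + B + ∫⁻ r in Ioo 0 1, F r := by
    calc J * ENNReal.ofReal t⁻¹ + B
        = (J * ENNReal.ofReal (t⁻¹ - 1) + ∫⁻ r in Ioo t 1, F r * ENNReal.ofReal (r⁻¹ - 1)) +
          ∫⁻ r in Ioo 0 1, F r := by
          rw [setLIntegral_Ioo_split F ht0.le ht.2.le, add_add_add_comm,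
            ← lintegral_add_right _ hFm]
          have hone : ∀ r : ℝ, 0 < r → r < 1 →
              ENNReal.ofReal (r⁻¹ - 1) + 1 = ENNReal.ofReal r⁻¹ := by
            intro r h0 h1
            rw [← ENNReal.ofReal_one, ← ENNReal.ofReal_add (sub_nonneg.2 ((one_le_inv₀ h0).2 h1.le))
              zero_le_one, sub_add_cancel]
          congr 1
          · rw [← hone t ht0 ht.2, mul_add, mul_one]
          · refine setLIntegral_congr_fun measurableSet_Ioo fun r hr => ?_
            rw [← hone r (ht0.trans hr.1) hr.2, mul_comm, mul_add, mul_one]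
      _ ≤ _ := by rw [← h2]; gcongr
  have h4 : J * ENNReal.ofReal t⁻¹ ≤ A + ∫⁻ r in Ioo 0 1, F r := by
    rw [add_right_comm] at h3
    exact (ENNReal.add_le_add_iff_right hBfin).1 h3
  refine le_trans ?_ h4
  calc F t = (∫⁻ r in Ioo 0 t, F t) * ENNReal.ofReal t⁻¹ := by
        simp only [lintegral_const, Measure.restrict_apply MeasurableSet.univ, univ_inter,
          Real.volume_Ioo, sub_zero]
        rw [mul_assoc, ← ENNReal.ofReal_mul ht0.le, mul_inv_cancel₀ ht0.ne', ENNReal.ofReal_one,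
          mul_one]
    _ ≤ _ := by
        gcongr
        exact setLIntegral_mono hFm fun r hr => hF hr.2.le

theorem hardyOp_antitone (n : ℕ) (f : ℝ → ℝ) : Antitone (hardyOp n f) := fun _ _ h =>
  lintegral_mono_set (Ioo_subset_Ioo_left h)

theorem measurable_rearrAvg {α : Type*} [MeasurableSpace α] (μ : Measure α) (f : α → ℝ≥0∞) :
    Measurable (rearrAvg μ f) := by
  have : Monotone fun t : ℝ => ∫⁻ s in Ioo 0 t, rearr μ f s := fun _ _ h =>
    lintegral_mono_set (Ioo_subset_Ioo_right h)
  have := this.measurable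
  unfold rearrAvg
  fun_prop

theorem measurable_weightedOscillation (n : ℕ) (f : ℝ → ℝ) :
    Measurable (weightedOscillation n f) := by
  have h1 := measurable_rearrAvg unitMeasure fun r => ‖f r‖ₑ
  have h2 := measurable_rearr unitMeasure fun r => ‖f r‖ₑ
  unfold weightedOscillation
  fun_prop

theorem weightedOscillation_lt_top {n : ℕ} {f : ℝ → ℝ} (hf : AEMeasurable f unitMeasure)
    (hfin : ∫⁻ s, ‖f s‖ₑ ∂unitMeasure ≠ ∞) {s : ℝ} (hs : s ∈ Ioo (0 : ℝ) 1) :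
    weightedOscillation n f s < ∞ := by
  refine ENNReal.mul_lt_top ENNReal.ofReal_lt_top (tsub_le_self.trans_lt ?_)
  refine ENNReal.mul_lt_top (by simpa using hs.1) ?_
  refine (lintegral_mono_set (Ioo_subset_Ioo_right hs.2.le)).trans_lt ?_
  rw [lintegral_rearr unitMeasure hf.enorm]
  exact hfin.lt_top

/-- The weight `s^{-1/n}` in the oscillation cancels the `s^{1/n}` of the Hardy operator, leaving
`∫ₜ¹ (f** - f*) ds/s`. -/
theorem rearr_le_hardyOp_oscillation {n : ℕ} {f : ℝ → ℝ} (hf : AEMeasurable f unitMeasure)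
    (hfin : ∫⁻ s, ‖f s‖ₑ ∂unitMeasure ≠ ∞) {t : ℝ} (ht : t ∈ Ioo (0 : ℝ) 1) :
    rearr unitMeasure (fun r => ‖f r‖ₑ) t ≤
      hardyOp n (fun s => (weightedOscillation n f s).toReal) t + ∫⁻ s, ‖f s‖ₑ ∂unitMeasure := by
  have hfin' : ∫⁻ r in Ioo 0 1, rearr unitMeasure (fun r => ‖f r‖ₑ) r ≠ ∞ := by
    rwa [lintegral_rearr unitMeasure hf.enorm]
  refine ((rearr_antitone unitMeasure fun r => ‖f r‖ₑ).le_lintegral_oscillation hfin' ht).trans_eq ?_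
  rw [lintegral_rearr unitMeasure hf.enorm]
  congr 1
  refine setLIntegral_congr_fun (measurableSet_Ioo (a := t) (b := 1)) fun s hs => ?_
  have hs0 : 0 < s := ht.1.trans hs.1
  simp only
  rw [mul_div_right_comm, ENNReal.ofReal_mul (by positivity),
    ENNReal.ofReal_toReal (weightedOscillation_lt_top hf hfin ⟨hs0, hs.2⟩).ne, weightedOscillation,
    ← mul_assoc, ← ENNReal.ofReal_mul (by positivity)]
  congr 2
  rw [div_mul_eq_mul_div, ← Real.rpow_add hs0]
  simp

variable {α : Type*} [MeasurableSpace α] {μ : Measure α}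

theorem oscillation_bound_of_hardy_bound {n : ℕ} (X Y : RINorm μ) {σ : α → ℝ}
    (hσ : MeasurePreserving σ μ unitMeasure)
    (h : ∃ C : ℝ≥0, ∀ f : ℝ → ℝ, AEMeasurable f unitMeasure → (∀ s, 0 ≤ f s) →
        X.hat (fun s => ‖f s‖ₑ) < ∞ → Y.hat (hardyOp n f) ≤ C * X.hat (fun s => ‖f s‖ₑ)) :
    ∃ C : ℝ≥0, ∀ f : ℝ → ℝ, AEMeasurable f unitMeasure →
        Y.hat (fun s => ‖f s‖ₑ) ≤
          C * (X.hat (weightedOscillation n f) + ∫⁻ s, ‖f s‖ₑ ∂unitMeasure) := by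
  obtain ⟨C, hC⟩ := h
  have hY1 := (Y.toUnit hσ).norm_one_lt_top
  set K := ((Y.toUnit hσ).norm 1).toNNReal
  have hK : (K : ℝ≥0∞) = (Y.toUnit hσ).norm 1 := ENNReal.coe_toNNReal hY1.ne
  -- The summand `1` keeps the constant nonzero: in `ℝ≥0∞` one has `0 * ∞ = 0`, and the right-hand
  -- side must be infinite when either of its terms is.
  refine ⟨C + K + 1, fun f hf => ?_⟩
  set φ := weightedOscillation n f
  have hφm : Measurable φ := measurable_weightedOscillation n f
  have htop : ∀ a b : ℝ≥0∞, a = ∞ ∨ b = ∞ → ((C + K + 1 : ℝ≥0) : ℝ≥0∞) * (a + b) = ∞ := by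
    intro a b hab
    rw [show a + b = ∞ by rcases hab with h | h <;> simp [h]]
    exact ENNReal.mul_top (by positivity)
  by_cases hfin : ∫⁻ s, ‖f s‖ₑ ∂unitMeasure = ∞
  · rw [htop _ _ (Or.inr hfin)]; exact le_top
  by_cases hX : X.hat φ = ∞
  · rw [htop _ _ (Or.inl hX)]; exact le_top
  have hae : (fun s => ‖(φ s).toReal‖ₑ) =ᵐ[unitMeasure] φ := by
    refine (ae_restrict_iff' measurableSet_Ioo).2 (Filter.Eventually.of_forall fun s hs => ?_)
    simp only [Real.enorm_of_nonneg ENNReal.toReal_nonneg]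
    exact ENNReal.ofReal_toReal (weightedOscillation_lt_top hf hfin hs).ne
  have hXe : X.hat (fun s => ‖(φ s).toReal‖ₑ) = X.hat φ := by
    rw [X.hat_eq_toUnit hσ hφm.ennreal_toReal.enorm.aemeasurable,
      X.hat_eq_toUnit hσ hφm.aemeasurable]
    exact (X.toUnit hσ).norm_congr_ae hφm.ennreal_toReal.enorm.aemeasurable hae
  have h1 := hC (fun s => (φ s).toReal) hφm.ennreal_toReal.aemeasurable
    (fun s => ENNReal.toReal_nonneg) (by rw [hXe]; exact Ne.lt_top hX)
  rw [hXe, Y.hat_eq_toUnit hσ (hardyOp_antitone _ _).measurable.aemeasurable] at h1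
  have hm := (hardyOp_antitone n fun s => (φ s).toReal).measurable.aemeasurable (μ := unitMeasure)
  calc Y.hat (fun s => ‖f s‖ₑ)
      = (Y.toUnit hσ).norm (rearr unitMeasure fun s => ‖f s‖ₑ) := by
        rw [Y.hat_eq_toUnit hσ hf.enorm]
        exact (Y.toUnit hσ).norm_eq_of_equimeasurable _ _ hf.enorm
          (measurable_rearr _ _).aemeasurable (equimeasurable_rearr _ _).symm
    _ ≤ (Y.toUnit hσ).norm fun t => hardyOp n (fun s => (φ s).toReal) t +
          ∫⁻ s, ‖f s‖ₑ ∂unitMeasure :=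
        (Y.toUnit hσ).norm_mono _ _ (measurable_rearr _ _).aemeasurable
          (hm.add aemeasurable_const) ((ae_restrict_iff' measurableSet_Ioo).2
            (Filter.Eventually.of_forall fun t ht => rearr_le_hardyOp_oscillation hf hfin ht))
    _ ≤ (Y.toUnit hσ).norm (hardyOp n fun s => (φ s).toReal) +
          (Y.toUnit hσ).norm fun _ => ∫⁻ s, ‖f s‖ₑ ∂unitMeasure :=
        (Y.toUnit hσ).norm_add_le _ _ hm aemeasurable_const
    _ ≤ C * X.hat φ + K * ∫⁻ s, ‖f s‖ₑ ∂unitMeasure := by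
        rw [(Y.toUnit hσ).norm_const_eq hfin, hK, mul_comm (∫⁻ s, ‖f s‖ₑ ∂unitMeasure)]
        gcongr
    _ ≤ (C + K + 1 : ℝ≥0) * X.hat φ + (C + K + 1 : ℝ≥0) * ∫⁻ s, ‖f s‖ₑ ∂unitMeasure := by
        gcongr
        · rw [add_assoc]; exact le_self_add
        · rw [add_right_comm]; exact le_add_self
    _ = _ := (mul_add _ _ _).symm

end Hardy

/-! ### The oscillation inequality implies the Hardy inequality. -/

section HardyConverse

theorem rearr_congr_ae {α : Type*} [MeasurableSpace α] {μ : Measure α} {f g : α → ℝ≥0∞}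
    (h : f =ᵐ[μ] g) : rearr μ f = rearr μ g := by
  funext t
  refine eq_of_forall_lt_iff fun l => ?_
  rw [lt_rearr_iff, lt_rearr_iff]
  have : μ {x | l < f x} = μ {x | l < g x} :=
    measure_congr (h.mono fun x hx => by
      change (l < f x) = (l < g x)
      rw [hx])
  rw [this]

/-- Right-continuity of the Hardy transform, by monotone convergence, in the form demanded by
`rearr_unitMeasure_eq`. -/
theorem exists_lt_hardyOp (n : ℕ) (f : ℝ → ℝ) {t : ℝ} (ht : t < 1) {l : ℝ≥0∞}
    (hl : l < hardyOp n f t) : ∃ s ∈ Ioo t 1, l < hardyOp n f s := by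
  obtain ⟨u, hu, hul, hut⟩ := exists_seq_strictAnti_tendsto' ht
  have hU : Ioo t 1 = ⋃ k, Ioo (u k) 1 := by
    ext x
    simp only [mem_iUnion, mem_Ioo]
    exact ⟨fun hx => (hut.eventually_lt_const hx.1).exists.imp fun k hk => ⟨hk, hx.2⟩,
      fun ⟨k, hk⟩ => ⟨(hul k).1.trans hk.1, hk.2⟩⟩
  have hm : Monotone fun k => Ioo (u k) 1 := fun i j hij => Ioo_subset_Ioo_left (hu.antitone hij)
  rw [hardyOp, hU, setLIntegral_iUnion_of_directed _ hm.directed_le] at hl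
  obtain ⟨k, hk⟩ := lt_iSup_iff.1 hl
  exact ⟨u k, hul k, hk⟩

theorem rearr_hardyOp (n : ℕ) (f : ℝ → ℝ) {t : ℝ} (ht : t ∈ Ioo (0 : ℝ) 1) :
    rearr unitMeasure (hardyOp n f) t = hardyOp n f t :=
  rearr_unitMeasure_eq (hardyOp_antitone n f) ht fun _ hl => exists_lt_hardyOp n f ht.2 hl

/-- Tonelli on the triangle `r < s < t`. Divided by `t`, this makes the oscillation of `Hf`
explicit: it is the average over `(0, t)` of `s^{1/n} f(s)`. -/
theorem setLIntegral_hardyOp {n : ℕ} {f : ℝ → ℝ} (hf : AEMeasurable f unitMeasure) {t : ℝ}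
    (ht1 : t ≤ 1) :
    ∫⁻ r in Ioo 0 t, hardyOp n f r =
      (∫⁻ s in Ioo 0 t, ENNReal.ofReal (s ^ (1 / n : ℝ) * f s)) +
        ENNReal.ofReal t * hardyOp n f t := by
  have hfm : AEMeasurable f (volume.restrict (Ioo 0 t)) :=
    hf.mono_measure (Measure.restrict_mono (Ioo_subset_Ioo_right ht1) le_rfl)
  have h1 : ∀ r ∈ Ioo 0 t, hardyOp n f r =
      1 * (∫⁻ s in Ioo r t, ENNReal.ofReal (s ^ (1 / n : ℝ) * f s / s)) + hardyOp n f t :=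
    fun r hr => by rw [one_mul]; exact setLIntegral_Ioo_split _ hr.2.le ht1
  rw [setLIntegral_congr_fun measurableSet_Ioo h1, lintegral_add_right _ measurable_const,
    ← lintegral_mul_lintegral_Ioo (F := fun _ => 1) (by fun_prop) (by fun_prop)]
  congr 1
  · refine setLIntegral_congr_fun measurableSet_Ioo fun s hs => ?_
    simp only [lintegral_const, Measure.restrict_apply MeasurableSet.univ, univ_inter,
      Real.volume_Ioo, sub_zero, one_mul]
    rw [mul_comm, ← ENNReal.ofReal_mul hs.1.le, mul_div_cancel₀ _ hs.1.ne']
  · simp [mul_comm]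

theorem lintegral_hardyOp_le {n : ℕ} {f : ℝ → ℝ} (hf : AEMeasurable f unitMeasure)
    (hf0 : ∀ s, 0 ≤ f s) :
    ∫⁻ t, hardyOp n f t ∂unitMeasure ≤ ∫⁻ s, ‖f s‖ₑ ∂unitMeasure := by
  change ∫⁻ r in Ioo 0 1, hardyOp n f r ≤ _
  rw [setLIntegral_hardyOp hf le_rfl]
  have : hardyOp n f 1 = 0 := by simp [hardyOp]
  rw [this, mul_zero, add_zero]
  refine lintegral_mono_ae ((ae_restrict_iff' measurableSet_Ioo).2
    (Filter.Eventually.of_forall fun s hs => ?_))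
  rw [Real.enorm_of_nonneg (hf0 s)]
  exact ENNReal.ofReal_le_ofReal (mul_le_of_le_one_left (hf0 s)
    (Real.rpow_le_one hs.1.le hs.2.le (by positivity)))

theorem hardyOp_le_lintegral (n : ℕ) (f : ℝ → ℝ) {t : ℝ} (ht : 0 < t) :
    hardyOp n f t ≤ ENNReal.ofReal t⁻¹ * ∫⁻ s, ‖f s‖ₑ ∂unitMeasure := by
  calc hardyOp n f t ≤ ∫⁻ s in Ioo t 1, ENNReal.ofReal t⁻¹ * ‖f s‖ₑ := by
        refine lintegral_mono_ae ((ae_restrict_iff' measurableSet_Ioo).2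
          (Filter.Eventually.of_forall fun s hs => ?_))
        have hs0 : 0 < s := ht.trans hs.1
        rw [Real.enorm_eq_ofReal_abs, ← ENNReal.ofReal_mul (by positivity)]
        refine ENNReal.ofReal_le_ofReal ?_
        calc s ^ (1 / n : ℝ) * f s / s ≤ 1 * |f s| / t := by
              have h1 : s ^ (1 / n : ℝ) ≤ 1 := Real.rpow_le_one hs0.le hs.2.le (by positivity)
              have h2 : s ^ (1 / n : ℝ) * f s ≤ 1 * |f s| :=
                (mul_le_mul_of_nonneg_left (le_abs_self _) (by positivity)).trans
                  (mul_le_mul_of_nonneg_right h1 (abs_nonneg _))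
              exact div_le_div₀ (by positivity) h2 ht hs.1.le
          _ = t⁻¹ * |f s| := by ring
    _ ≤ ∫⁻ s in Ioo 0 1, ENNReal.ofReal t⁻¹ * ‖f s‖ₑ :=
        lintegral_mono_set (Ioo_subset_Ioo_left ht.le)
    _ = ENNReal.ofReal t⁻¹ * ∫⁻ s in Ioo 0 1, ‖f s‖ₑ :=
        lintegral_const_mul' _ _ ENNReal.ofReal_ne_top

theorem hardyOp_lt_top {n : ℕ} {f : ℝ → ℝ}
    (hfin : ∫⁻ s, ‖f s‖ₑ ∂unitMeasure ≠ ∞) {t : ℝ} (ht : 0 < t) : hardyOp n f t < ∞ :=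
  (hardyOp_le_lintegral n f ht).trans_lt (ENNReal.mul_lt_top ENNReal.ofReal_lt_top hfin.lt_top)

theorem enorm_toReal_hardyOp_ae {n : ℕ} {f : ℝ → ℝ}
    (hfin : ∫⁻ s, ‖f s‖ₑ ∂unitMeasure ≠ ∞) :
    (fun t => ‖(hardyOp n f t).toReal‖ₑ) =ᵐ[unitMeasure] hardyOp n f := by
  refine (ae_restrict_iff' measurableSet_Ioo).2 (Filter.Eventually.of_forall fun t ht => ?_)
  simp only [Real.enorm_of_nonneg ENNReal.toReal_nonneg]
  exact ENNReal.ofReal_toReal (hardyOp_lt_top hfin ht.1).ne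

theorem weightedOscillation_hardyOp_le {n : ℕ} {f : ℝ → ℝ}
    (hf : AEMeasurable f unitMeasure)
    (hfin : ∫⁻ s, ‖f s‖ₑ ∂unitMeasure ≠ ∞) {t : ℝ} (ht : t ∈ Ioo (0 : ℝ) 1) :
    weightedOscillation n (fun t => (hardyOp n f t).toReal) t ≤
      ENNReal.ofReal (t ^ (-(1 / n : ℝ))) * (ENNReal.ofReal t⁻¹ *
        ∫⁻ s in Ioo 0 t, ENNReal.ofReal (s ^ (1 / n : ℝ) * f s)) := by
  unfold weightedOscillation rearrAvg
  rw [rearr_congr_ae (enorm_toReal_hardyOp_ae hfin), rearr_hardyOp n f ht]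
  have h1 : ∫⁻ s in Ioo 0 t, rearr unitMeasure (hardyOp n f) s = ∫⁻ s in Ioo 0 t, hardyOp n f s :=
    setLIntegral_congr_fun measurableSet_Ioo fun s hs =>
      rearr_hardyOp n f ⟨hs.1, hs.2.trans ht.2⟩
  rw [h1, setLIntegral_hardyOp hf ht.2.le, ← ENNReal.ofReal_inv_of_pos ht.1, mul_add,
    ← mul_assoc (ENNReal.ofReal t⁻¹) (ENNReal.ofReal t), ← ENNReal.ofReal_mul (inv_pos.2 ht.1).le,
    inv_mul_cancel₀ ht.1.ne', ENNReal.ofReal_one, one_mul]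
  gcongr
  exact tsub_le_iff_right.2 le_rfl

theorem rpow_pow_half_comm (k : ℕ) (r : ℝ) : ((2⁻¹ : ℝ) ^ k) ^ r = (2⁻¹ ^ r) ^ k := by
  rw [← Real.rpow_natCast, ← Real.rpow_natCast, ← Real.rpow_mul (by norm_num),
    ← Real.rpow_mul (by norm_num), mul_comm]

/-- Put `q = 2^{-1/n}`. On the block with index `k + m` the weight `s^{1/n}` is at most `q^{k+m}`,
while `t^{-1/n} ≤ q^{-(k+1)}` and `t⁻¹ ≤ 2^{k+1}`. The powers of `q` combine to `q⁻¹ q^m`,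
independent of `k`, which leaves dyadic averages of the kind treated by
`RINorm.norm_dyadicAverage_le`. -/
theorem weighted_average_le_tsum {n : ℕ} {f : ℝ → ℝ} (hf0 : ∀ s, 0 ≤ f s)
    {t : ℝ} (ht : t ∈ Ioo (0 : ℝ) 1) :
    ENNReal.ofReal (t ^ (-(1 / n : ℝ))) * (ENNReal.ofReal t⁻¹ *
        ∫⁻ s in Ioo 0 t, ENNReal.ofReal (s ^ (1 / n : ℝ) * f s)) ≤
      ∑' m : ℕ, ENNReal.ofReal (((2⁻¹ : ℝ) ^ (1 / n : ℝ))⁻¹ * ((2⁻¹ : ℝ) ^ (1 / n : ℝ)) ^ m) *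
        (2 ^ (dyadicIndex t + 1) *
          ∫⁻ s in dyadicIndex ⁻¹' {dyadicIndex t + m}, ‖f s‖ₑ ∂unitMeasure) := by
  set k := dyadicIndex t with hk
  set q := (2⁻¹ : ℝ) ^ (1 / n : ℝ) with hq
  have hq0 : 0 < q := by positivity
  have htk := dyadic_mem_Ioc ⟨ht.1, ht.2.le⟩
  rw [← hk] at htk
  have e1 : t ^ (-(1 / n : ℝ)) ≤ (q ^ (k + 1))⁻¹ := by
    rw [Real.rpow_neg ht.1.le, hq, ← rpow_pow_half_comm]
    have := htk.1.le
    gcongr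
  have e2 : t⁻¹ ≤ 2 ^ (k + 1) := by
    rw [inv_le_comm₀ ht.1 (by positivity), ← inv_pow]; exact htk.1.le
  have hsub : Ioo 0 t ⊆ ⋃ m : ℕ, (dyadicIndex ⁻¹' {k + m} ∩ Ioo 0 1) := by
    intro s hs
    have hs1 : s ∈ Ioc (0 : ℝ) 1 := ⟨hs.1, (hs.2.trans ht.2).le⟩
    have hsk := dyadic_mem_Ioc hs1
    have hlt : (2⁻¹ : ℝ) ^ (dyadicIndex s + 1) < 2⁻¹ ^ k := hsk.1.trans (hs.2.trans_le htk.2)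
    have hle : k < dyadicIndex s + 1 :=
      (pow_lt_pow_iff_right_of_lt_one₀ (by norm_num) (by norm_num)).1 hlt
    exact mem_iUnion.2 ⟨dyadicIndex s - k, by simp; omega, hs.1, hs.2.trans ht.2⟩
  have hmeas : ∀ m : ℕ, MeasurableSet (dyadicIndex ⁻¹' {k + m}) := fun m =>
    measurable_dyadicIndex (measurableSet_singleton _)
  have e3 : ∫⁻ s in Ioo 0 t, ENNReal.ofReal (s ^ (1 / n : ℝ) * f s) ≤
      ∑' m : ℕ, ENNReal.ofReal (q ^ (k + m)) *
        ∫⁻ s in dyadicIndex ⁻¹' {k + m}, ‖f s‖ₑ ∂unitMeasure := by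
    refine (lintegral_mono_set hsub).trans ((lintegral_iUnion_le _ _).trans
      (ENNReal.tsum_le_tsum fun m => ?_))
    rw [unitMeasure, Measure.restrict_restrict (hmeas m),
      ← lintegral_const_mul' _ _ ENNReal.ofReal_ne_top]
    refine lintegral_mono_ae ((ae_restrict_iff' ((hmeas m).inter measurableSet_Ioo)).2
      (Filter.Eventually.of_forall fun s hs => ?_))
    have hsk := (dyadicIndex_eq_iff ⟨hs.2.1, hs.2.2.le⟩ (k + m)).1 hs.1
    rw [Real.enorm_of_nonneg (hf0 s), ← ENNReal.ofReal_mul (by positivity)]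
    refine ENNReal.ofReal_le_ofReal (mul_le_mul_of_nonneg_right ?_ (hf0 s))
    rw [hq, ← rpow_pow_half_comm]
    exact Real.rpow_le_rpow hs.2.1.le hsk.2 (by positivity)
  calc _ ≤ ENNReal.ofReal (q ^ (k + 1))⁻¹ * (2 ^ (k + 1) * ∑' m : ℕ, ENNReal.ofReal (q ^ (k + m)) *
        ∫⁻ s in dyadicIndex ⁻¹' {k + m}, ‖f s‖ₑ ∂unitMeasure) := by
        gcongr
        refine (ENNReal.ofReal_le_ofReal e2).trans_eq ?_
        rw [ENNReal.ofReal_pow (by norm_num)]; simp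
    _ = _ := by
        rw [← ENNReal.tsum_mul_left, ← ENNReal.tsum_mul_left]
        refine tsum_congr fun m => ?_
        have : q⁻¹ * q ^ m = (q ^ (k + 1))⁻¹ * q ^ (k + m) := by field_simp; ring
        rw [this, ENNReal.ofReal_mul (by positivity)]
        ring

theorem unitMeasure_dyadicIndex_le (k m : ℕ) :
    unitMeasure (dyadicIndex ⁻¹' {k + m}) ≤ ENNReal.ofReal (2⁻¹ ^ (k + 1)) := by
  rw [unitMeasure, Measure.restrict_apply (measurable_dyadicIndex (measurableSet_singleton _))]
  have hsub : dyadicIndex ⁻¹' {k + m} ∩ Ioo 0 1 ⊆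
      Ioc ((2⁻¹ : ℝ) ^ (k + m + 1)) (2⁻¹ ^ (k + m)) := fun s hs =>
    (dyadicIndex_eq_iff ⟨hs.2.1, hs.2.2.le⟩ (k + m)).1 hs.1
  refine (measure_mono hsub).trans ?_
  rw [Real.volume_Ioc, ← half_pow_add_half_pow (k + m), add_sub_cancel_right]
  exact ENNReal.ofReal_le_ofReal
    (pow_le_pow_of_le_one (by norm_num) (by norm_num) (by omega))

variable {α : Type*} [MeasurableSpace α] {μ : Measure α}

theorem hardy_bound_of_oscillation_bound {n : ℕ} (hn : 1 ≤ n) (X Y : RINorm μ) {σ : α → ℝ}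
    (hσ : MeasurePreserving σ μ unitMeasure)
    (h : ∃ C : ℝ≥0, ∀ f : ℝ → ℝ, AEMeasurable f unitMeasure →
        Y.hat (fun s => ‖f s‖ₑ) ≤
          C * (X.hat (weightedOscillation n f) + ∫⁻ s, ‖f s‖ₑ ∂unitMeasure)) :
    ∃ C : ℝ≥0, ∀ f : ℝ → ℝ, AEMeasurable f unitMeasure → (∀ s, 0 ≤ f s) →
        X.hat (fun s => ‖f s‖ₑ) < ∞ → Y.hat (hardyOp n f) ≤ C * X.hat (fun s => ‖f s‖ₑ) := by
  obtain ⟨C, hC⟩ := h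
  set Z := X.toUnit hσ
  obtain ⟨K, hK⟩ := Z.exists_lintegral_le
  set q := (2⁻¹ : ℝ) ^ (1 / n : ℝ) with hq
  have hq0 : 0 < q := by positivity
  have hn0 : (0 : ℝ) < n := by exact_mod_cast hn
  have hq1 : q < 1 := Real.rpow_lt_one (by norm_num) (by norm_num) (by positivity)
  set S : ℝ≥0∞ := ∑' m : ℕ, ENNReal.ofReal (q⁻¹ * q ^ m) with hS
  have hSfin : S ≠ ∞ := by
    have : S = ENNReal.ofReal q⁻¹ * (1 - ENNReal.ofReal q)⁻¹ := by
      simp_rw [hS, ENNReal.ofReal_mul (inv_nonneg.2 hq0.le), ENNReal.ofReal_pow hq0.le]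
      rw [ENNReal.tsum_mul_left, ENNReal.tsum_geometric]
    rw [this]
    refine ENNReal.mul_ne_top ENNReal.ofReal_ne_top (ENNReal.inv_ne_top.2 ?_)
    exact (tsub_pos_of_lt (by simpa using hq1)).ne'
  lift S to ℝ≥0 using hSfin with S' hS'
  refine ⟨C * (S' + K), fun f hf hf0 hXf => ?_⟩
  rw [X.hat_eq_toUnit hσ hf.enorm] at hXf ⊢
  have hint := hK _ hf.enorm
  have hfin : ∫⁻ s, ‖f s‖ₑ ∂unitMeasure ≠ ∞ :=
    (hint.trans_lt (ENNReal.mul_lt_top ENNReal.coe_lt_top hXf)).ne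
  have hHm := (hardyOp_antitone n f).measurable
  have hFm : AEMeasurable (fun t => (hardyOp n f t).toReal) unitMeasure :=
    hHm.ennreal_toReal.aemeasurable
  -- The hypothesis is tested with the Hardy transform of `f`; its real version agrees with it
  -- almost everywhere because `f` is integrable.
  have h1 := hC _ hFm
  rw [lintegral_congr_ae (enorm_toReal_hardyOp_ae hfin), Y.hat_eq_toUnit hσ hFm.enorm,
    (Y.toUnit hσ).norm_congr_ae hFm.enorm (enorm_toReal_hardyOp_ae hfin),
    ← Y.hat_eq_toUnit hσ hHm.aemeasurable,
    X.hat_eq_toUnit hσ (measurable_weightedOscillation _ _).aemeasurable] at h1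
  refine h1.trans ?_
  rw [ENNReal.coe_mul, mul_assoc, ENNReal.coe_add, add_mul]
  gcongr
  · set a : ℕ → ℝ → ℝ≥0∞ := fun m t => 2 ^ (dyadicIndex t + 1) *
      ∫⁻ s in dyadicIndex ⁻¹' {dyadicIndex t + m}, ‖f s‖ₑ ∂unitMeasure
    have ham : ∀ m, Measurable (a m) := fun m => measurable_comp_dyadicIndex
      (G := fun k _ => 2 ^ (k + 1) * ∫⁻ s in dyadicIndex ⁻¹' {k + m}, ‖f s‖ₑ ∂unitMeasure)
      fun k => measurable_const
    have ha : ∀ m, Z.norm (a m) ≤ Z.norm fun s => ‖f s‖ₑ := fun m => by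
      refine (Z.norm_dyadicAverage_le (B := fun k => dyadicIndex ⁻¹' {k + m}) hf.enorm
        (fun k => measurable_dyadicIndex (measurableSet_singleton _))
        (fun i j hij => Disjoint.preimage _ (by simpa using hij))
        (fun k => unitMeasure_dyadicIndex_le k m)).trans_eq ?_
      exact Z.norm_eq_of_equimeasurable _ _ (measurable_rearr _ _).aemeasurable hf.enorm
        (equimeasurable_rearr _ _)
    calc Z.norm (weightedOscillation n fun t => (hardyOp n f t).toReal)
        ≤ Z.norm fun t => ∑' m, ENNReal.ofReal (q⁻¹ * q ^ m) * a m t := by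
          refine Z.norm_mono _ _ (measurable_weightedOscillation _ _).aemeasurable
            (Measurable.tsum fun m => (ham m).const_mul _).aemeasurable
            ((ae_restrict_iff' measurableSet_Ioo).2 (Filter.Eventually.of_forall fun t ht => ?_))
          exact (weightedOscillation_hardyOp_le hf hfin ht).trans
            (weighted_average_le_tsum hf0 ht)
      _ ≤ ∑' m, Z.norm fun t => ENNReal.ofReal (q⁻¹ * q ^ m) * a m t :=
          Z.norm_tsum_le fun m => ((ham m).const_mul _).aemeasurable
      _ ≤ ∑' m, ENNReal.ofReal (q⁻¹ * q ^ m) * Z.norm fun s => ‖f s‖ₑ := by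
          refine ENNReal.tsum_le_tsum fun m => ?_
          rw [ENNReal.ofReal, Z.norm_smul _ _ (ham m).aemeasurable]
          gcongr
          exact ha m
      _ = S' * Z.norm fun s => ‖f s‖ₑ := by rw [ENNReal.tsum_mul_right, ← hS]
  · exact (lintegral_hardyOp_le hf hf0).trans hint

end HardyConverse

/-! ### A measure preserving map from `Ω` to the unit interval. -/

section Transport

open ProbabilityTheory Filter Topology

theorem continuous_cdf (ν : Measure ℝ) [IsProbabilityMeasure ν] [NullSingletonClass ν] :
    Continuous (cdf ν) := by
  refine continuous_iff_continuousAt.2 fun a => ?_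
  rw [(monotone_cdf ν).continuousAt_iff_leftLim_eq_rightLim, (cdf ν).rightLim_eq]
  have h := (cdf ν).measure_singleton a
  rw [measure_cdf, measure_singleton] at h
  have := ENNReal.ofReal_eq_zero.1 h.symm
  exact le_antisymm ((monotone_cdf ν).leftLim_le le_rfl) (by linarith)

/-- The probability integral transform. -/
theorem measurePreserving_cdf (ν : Measure ℝ) [IsProbabilityMeasure ν] [NullSingletonClass ν] :
    MeasurePreserving (cdf ν) ν unitMeasure := by
  have hm : Measurable (cdf ν) := (monotone_cdf ν).measurable
  refine ⟨hm, ?_⟩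
  have := Measure.isProbabilityMeasure_map (μ := ν) hm.aemeasurable
  refine Measure.ext_of_Iic _ _ fun t => ?_
  rw [Measure.map_apply hm measurableSet_Iic, unitMeasure, Measure.restrict_apply measurableSet_Iic]
  rcases lt_or_ge t 0 with ht0 | ht0
  · have h1 : cdf ν ⁻¹' Iic t = ∅ := by
      ext x; simpa using ht0.trans_le (cdf_nonneg ν x)
    have h2 : Iic t ∩ Ioo 0 1 = ∅ := by
      ext x; simp only [mem_inter_iff, mem_Iic, mem_Ioo, mem_empty_iff_false, iff_false]
      intro h; linarith [h.1, h.2.1]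
    rw [h1, h2]; simp
  rcases le_or_gt 1 t with ht1 | ht1
  · have h1 : cdf ν ⁻¹' Iic t = univ := by
      ext x; simpa using (cdf_le_one ν x).trans ht1
    have h2 : Iic t ∩ Ioo 0 1 = Ioo 0 1 :=
      inter_eq_self_of_subset_right fun x hx => hx.2.le.trans ht1
    rw [h1, h2]; simp
  have h2 : Iic t ∩ Ioo 0 1 = Ioc 0 t := by
    ext x; simp only [mem_inter_iff, mem_Iic, mem_Ioo, mem_Ioc]
    exact ⟨fun h => ⟨h.2.1, h.1⟩, fun h => ⟨h.2, h.1, h.2.trans_lt ht1⟩⟩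
  rw [h2, Real.volume_Ioc, sub_zero]
  set S := cdf ν ⁻¹' Iic t
  have hSb : BddAbove S := by
    obtain ⟨M, hM⟩ := ((tendsto_cdf_atTop ν).eventually_const_lt ht1).exists
    exact ⟨M, fun x hx => le_of_lt ((monotone_cdf ν).reflect_lt (lt_of_le_of_lt hx hM))⟩
  rcases S.eq_empty_or_nonempty with hS | hS
  · have : t ≤ 0 := by
      refine ge_of_tendsto' (tendsto_cdf_atBot ν) fun x => ?_
      by_contra! hx
      exact (hS ▸ (hx.le : x ∈ S) : x ∈ (∅ : Set ℝ)).elim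
    rw [hS, measure_empty, ENNReal.ofReal_of_nonpos this]
  · have hSc : IsClosed S := isClosed_Iic.preimage (continuous_cdf ν)
    have hm := hSc.csSup_mem hS hSb
    set m := sSup S
    have hSI : S = Iic m := by
      ext x
      exact ⟨fun hx => le_csSup hSb hx, fun hx => (monotone_cdf ν hx).trans hm⟩
    -- If the value at `m` were below `t`, continuity would put points to the right of `m` into `S`.
    have hFm : cdf ν m = t := by
      refine le_antisymm hm (not_lt.1 fun hlt => ?_)
      have hev : ∀ᶠ x in 𝓝[>] m, cdf ν x < t :=
        ((continuous_cdf ν).continuousAt.eventually_lt continuousAt_const hlt).filter_mono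
          nhdsWithin_le_nhds
      obtain ⟨x, hx, hxm⟩ := (hev.and self_mem_nhdsWithin).exists
      exact absurd (le_csSup hSb (show x ∈ S from hx.le)) (not_le.2 hxm)
    rw [hSI, ← hFm, ofReal_cdf]

variable {n : ℕ}

/-- A measure preserving map onto the unit interval that is radial on a ball. -/
theorem exists_radial_measurePreserving (hn : 1 ≤ n) {Ω : Set (EuclideanSpace ℝ (Fin n))}
    (hΩ : volume Ω = 1) {x₀ : EuclideanSpace ℝ (Fin n)} {R : ℝ} (hR : Metric.ball x₀ R ⊆ Ω) :
    ∃ σ : EuclideanSpace ℝ (Fin n) → ℝ,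
      MeasurePreserving σ (volume.restrict Ω) unitMeasure ∧
      (∀ x ∈ Metric.ball x₀ R, σ x =
        (volume (Metric.ball (0 : EuclideanSpace ℝ (Fin n)) 1)).toReal * ‖x - x₀‖ ^ n) ∧
      ∀ x ∉ Metric.ball x₀ R, (volume (Metric.ball x₀ R)).toReal ≤ σ x := by
  have : IsProbabilityMeasure (volume.restrict Ω) := ⟨by simp [hΩ]⟩
  have : NeZero n := ⟨by omega⟩
  have hρ : Measurable fun x : EuclideanSpace ℝ (Fin n) => ‖x - x₀‖ := by fun_prop
  -- The law of the distance to `x₀` has no atoms since spheres are null, so its distribution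
  -- function sends it to Lebesgue measure. For radii less than `R` that function is the volume of
  -- the closed ball.
  set ν := (volume.restrict Ω).map fun x => ‖x - x₀‖
  have : IsProbabilityMeasure ν := Measure.isProbabilityMeasure_map hρ.aemeasurable
  have hνa : NullSingletonClass ν := ⟨fun r => by
    rw [Measure.map_apply hρ (measurableSet_singleton r)]
    have hs : (fun x => ‖x - x₀‖) ⁻¹' {r} = Metric.sphere x₀ r := by
      ext x; simp
    rw [hs]
    exact nonpos_iff_eq_zero.1 ((Measure.restrict_apply_le _ _).trans_eq
      (Measure.addHaar_sphere volume x₀ r))⟩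
  refine ⟨fun x => cdf ν ‖x - x₀‖, (measurePreserving_cdf ν).comp ⟨hρ, rfl⟩, fun x hx => ?_,
    fun x hx => ?_⟩
  rotate_left
  · change _ ≤ cdf ν ‖x - x₀‖
    rw [cdf_eq_real, Measure.real, Measure.map_apply hρ measurableSet_Iic]
    refine ENNReal.toReal_mono (measure_ne_top _ _) ?_
    rw [Measure.restrict_apply (hρ measurableSet_Iic)]
    refine measure_mono fun y hy => ⟨?_, hR hy⟩
    simp only [Metric.mem_ball, dist_eq_norm, not_lt, mem_preimage, mem_Iic] at hx hy ⊢
    exact hy.le.trans hx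
  change cdf ν ‖x - x₀‖ = _
  rw [cdf_eq_real, Measure.real, Measure.map_apply hρ measurableSet_Iic]
  have hs : (fun x => ‖x - x₀‖) ⁻¹' Iic ‖x - x₀‖ = Metric.closedBall x₀ ‖x - x₀‖ := by
    ext y; simp [dist_eq_norm]
  rw [hs, Measure.restrict_apply Metric.isClosed_closedBall.measurableSet,
    inter_eq_self_of_subset_left ((Metric.closedBall_subset_ball
      (by simpa [dist_eq_norm] using hx)).trans hR), Measure.addHaar_closedBall _ _ (norm_nonneg _),
    ENNReal.toReal_mul, ENNReal.toReal_ofReal (by positivity), mul_comm]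
  simp

end Transport

/-! ### Mollification and the chain rule for weak gradients. -/

section Mollification

open Filter Topology ContinuousLinearMap
open scoped Convolution

variable {E : Type*} [NormedAddCommGroup E] [InnerProductSpace ℝ E] [FiniteDimensional ℝ E]
  [MeasurableSpace E] [BorelSpace E]

/-- Mollifications of an integrable function converge in `L¹`. -/
theorem tendsto_integral_abs_convolution_sub {ρ : ℕ → ContDiffBump (0 : E)}
    (hρ : Tendsto (fun k => (ρ k).rOut) atTop (𝓝 0)) (hρ' : ∀ k, (ρ k).rOut ≤ 2 * (ρ k).rIn)
    {u : E → ℝ} (hu : Integrable u) :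
    Tendsto (fun k => ∫ x, |((ρ k).normed volume ⋆[lsmul ℝ ℝ, volume] u) x - u x|) atTop
      (𝓝 0) := by
  set U : ℕ → E → ℝ := fun k => (ρ k).normed volume ⋆[lsmul ℝ ℝ, volume] u
  set V : ℕ → E → ℝ := fun k => (ρ k).normed volume ⋆[lsmul ℝ ℝ, volume] fun x => |u x|
  have hUi : ∀ k, Integrable (U k) := fun k =>
    (ρ k).integrable_normed.integrable_convolution _ hu
  have hVi : ∀ k, Integrable (V k) := fun k =>
    (ρ k).integrable_normed.integrable_convolution _ hu.abs
  have hVint : ∀ k, ∫ x, V k x = ∫ x, |u x| := fun k => by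
    simp only [V]
    rw [integral_convolution _ (ρ k).integrable_normed hu.abs, (ρ k).integral_normed]
    simp
  have hUV : ∀ k x, |U k x| ≤ V k x := fun k x => by
    simp only [U, V, convolution, lsmul_apply, smul_eq_mul]
    refine (abs_integral_le_integral_abs).trans_eq (integral_congr_ae (Eventually.of_forall fun t => ?_))
    simp only [abs_mul, abs_of_nonneg ((ρ k).nonneg_normed t)]
  have hUt := ContDiffBump.ae_convolution_tendsto_right_of_locallyIntegrable (μ := volume) hρ
    (Eventually.of_forall hρ') hu.locallyIntegrable
  have hVt := ContDiffBump.ae_convolution_tendsto_right_of_locallyIntegrable (μ := volume) hρ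
    (Eventually.of_forall hρ') hu.abs.locallyIntegrable
  -- Since `|U k| ≤ V k`, the difference `|U k - u| - (V k - |u|)` is at most `2|u|`, so dominated
  -- convergence applies to its positive part. The subtracted term `V k - |u|` has integral zero.
  set W : ℕ → E → ℝ := fun k x => max (|U k x - u x| - (V k x - |u x|)) 0
  have hWi : ∀ k, Integrable (W k) := fun k =>
    ((((hUi k).sub hu).abs).sub ((hVi k).sub hu.abs)).pos_part
  have hW : Tendsto (fun k => ∫ x, W k x) atTop (𝓝 0) := by
    have h0 : (0 : ℝ) = ∫ x : E, (0 : ℝ) := by simp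
    rw [h0]
    refine tendsto_integral_of_dominated_convergence (fun x => 2 * |u x|)
      (fun k => (hWi k).aestronglyMeasurable) (hu.abs.const_mul 2)
      (fun k => Eventually.of_forall fun x => ?_) ?_
    · simp only [W, Real.norm_eq_abs]
      rw [abs_of_nonneg (le_max_right _ _)]
      refine max_le ?_ (by positivity)
      have h1 := hUV k x
      have h2 := abs_sub (U k x) (u x)
      linarith
    · filter_upwards [hUt, hVt] with x h1 h2
      have h3 : Tendsto (fun k => max (|U k x - u x| - (V k x - |u x|)) 0) atTop
          (𝓝 (max (|u x - u x| - (|u x| - |u x|)) 0)) :=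
        (((h1.sub_const _).abs).sub (h2.sub_const _)).max tendsto_const_nhds
      simpa using h3
  refine squeeze_zero (fun k => integral_nonneg fun x => abs_nonneg _) (fun k => ?_) hW
  calc ∫ x, |U k x - u x| ≤ ∫ x, (W k x + (V k x - |u x|)) := by
        refine integral_mono (((hUi k).sub hu).abs) ((hWi k).add ((hVi k).sub hu.abs)) fun x => ?_
        have := le_max_left (|U k x - u x| - (V k x - |u x|)) 0
        simp only [W]
        linarith
    _ = ∫ x, W k x := by
        have hs : Integrable fun x => V k x - |u x| := (hVi k).sub hu.abs
        rw [integral_add (hWi k) hs, integral_sub (hVi k) hu.abs, hVint,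
          sub_self, add_zero]

variable {n : ℕ} {Ω : Set (EuclideanSpace ℝ (Fin n))}
  {f : EuclideanSpace ℝ (Fin n) → ℝ} {g : EuclideanSpace ℝ (Fin n) → EuclideanSpace ℝ (Fin n)}

theorem integrable_coord_indicator (hΩ : MeasurableSet Ω) (hg : IntegrableOn g Ω) (i : Fin n) :
    Integrable (Ω.indicator fun x => g x i) := by
  rw [integrable_indicator_iff hΩ]
  exact (EuclideanSpace.proj (𝕜 := ℝ) i).integrable_comp hg

/-- Where the mollifier fits into `Ω`, the partial derivatives of a mollification are the
mollifications of the weak partial derivatives. -/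
theorem fderiv_convolution_of_hasWeakGradient (hΩ : MeasurableSet Ω)
    (h : HasWeakGradient Ω f g) (hf : IntegrableOn f Ω)
    (ρ : ContDiffBump (0 : EuclideanSpace ℝ (Fin n))) (i : Fin n)
    {x : EuclideanSpace ℝ (Fin n)} (hx : Metric.closedBall x ρ.rOut ⊆ Ω) :
    fderiv ℝ (ρ.normed volume ⋆[lsmul ℝ ℝ, volume] Ω.indicator f) x (EuclideanSpace.single i 1) =
      (ρ.normed volume ⋆[lsmul ℝ ℝ, volume] Ω.indicator fun x => g x i) x := by
  have hfi : Integrable (Ω.indicator f) := (integrable_indicator_iff hΩ).2 hf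
  have hρ1 : ContDiff ℝ 1 (ρ.normed volume) := ρ.contDiff_normed (n := 1)
  have hρd := hρ1.differentiable one_ne_zero
  rw [(ρ.hasCompactSupport_normed.hasFDerivAt_convolution_left (lsmul ℝ ℝ) hρ1
    hfi.locallyIntegrable x).fderiv]
  -- The reflected mollifier is an admissible test function because its support lies in the closed
  -- ball around `x`. The reflection produces the sign that cancels the one in the definition of the
  -- weak gradient.
  set ψ : EuclideanSpace ℝ (Fin n) → ℝ := fun y => ρ.normed volume (x - y)
  have hψd : ∀ y, fderiv ℝ ψ y (EuclideanSpace.single i 1) =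
      -fderiv ℝ (ρ.normed volume) (x - y) (EuclideanSpace.single i 1) := fun y => by
    have h1 : HasFDerivAt (fun y : EuclideanSpace ℝ (Fin n) => x - y)
        (-(ContinuousLinearMap.id ℝ (EuclideanSpace ℝ (Fin n)))) y := (hasFDerivAt_id y).const_sub x
    have h2 := (hρd (x - y)).hasFDerivAt.comp y h1
    have h3 : fderiv ℝ ψ y = _ := h2.fderiv
    rw [h3]; simp
  have hψs : tsupport ψ ⊆ Metric.closedBall x ρ.rOut := by
    refine closure_minimal (fun y hy => ?_) Metric.isClosed_closedBall
    have : x - y ∈ Function.support (ρ.normed volume) := hy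
    rw [ρ.support_normed_eq] at this
    simp only [Metric.mem_ball, dist_zero_right] at this
    rw [Metric.mem_closedBall', dist_eq_norm]
    exact this.le
  have hw := h.2.2 ψ (ρ.contDiff_normed.comp (contDiff_const.sub contDiff_id))
    ((isCompact_closedBall x ρ.rOut).of_isClosed_subset (isClosed_tsupport ψ) hψs)
    (hψs.trans hx) i
  simp only [hψd] at hw
  have hL : (fderiv ℝ (ρ.normed volume) ⋆[(lsmul ℝ ℝ).precompL (EuclideanSpace ℝ (Fin n)), volume]
      Ω.indicator f) x (EuclideanSpace.single i 1) =
      ∫ y in Ω, f y * fderiv ℝ (ρ.normed volume) (x - y) (EuclideanSpace.single i 1) := by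
    have hex : ConvolutionExists (fderiv ℝ (ρ.normed volume)) (Ω.indicator f)
        ((lsmul ℝ ℝ).precompL (EuclideanSpace ℝ (Fin n))) volume :=
      (ρ.hasCompactSupport_normed.fderiv ℝ).convolutionExists_left _
        (hρ1.continuous_fderiv one_ne_zero) hfi.locallyIntegrable
    rw [convolution_eq_swap, ContinuousLinearMap.integral_apply
      (by simpa using (hex x).integrable_swap), ← integral_indicator hΩ]
    refine integral_congr_ae (Eventually.of_forall fun y => ?_)
    by_cases hy : y ∈ Ω <;> simp [hy, mul_comm]
  have hR : (ρ.normed volume ⋆[lsmul ℝ ℝ, volume] Ω.indicator fun x => g x i) x =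
      ∫ y in Ω, g y i * ψ y := by
    rw [convolution_eq_swap, ← integral_indicator hΩ]
    refine integral_congr_ae (Eventually.of_forall fun y => ?_)
    by_cases hy : y ∈ Ω <;> simp [hy, mul_comm, ψ]
  rw [hL, hR]
  simp only [mul_neg, integral_neg, neg_inj] at hw
  exact hw

/-- The chain rule for weak gradients. -/
theorem HasWeakGradient.comp (hΩ : IsOpen Ω) (hΩfin : volume Ω ≠ ∞)
    (h : HasWeakGradient Ω f g) (hf : IntegrableOn f Ω) (hg : IntegrableOn g Ω)
    {G : ℝ → ℝ} (hG : ContDiff ℝ 1 G) {M K : ℝ} (hM : ∀ t, |G t| ≤ M) (hK : ∀ t, |deriv G t| ≤ K) :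
    IntegrableOn (fun x => G (f x)) Ω ∧ IntegrableOn (fun x => deriv G (f x) • g x) Ω ∧
      HasWeakGradient Ω (fun x => G (f x)) (fun x => deriv G (f x) • g x) := by
  have hGd := hG.differentiable one_ne_zero
  have hG'c : Continuous (deriv G) := hG.continuous_deriv le_rfl
  have : IsFiniteMeasure (volume.restrict Ω) := ⟨by simpa using hΩfin.lt_top⟩
  have hGf : IntegrableOn (fun x => G (f x)) Ω :=
    Integrable.of_bound (hG.continuous.comp_aestronglyMeasurable hf.aestronglyMeasurable) M
      (Eventually.of_forall fun x => hM _)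
  have hGg : IntegrableOn (fun x => deriv G (f x) • g x) Ω :=
    hg.bdd_smul K (hG'c.comp_aestronglyMeasurable hf.aestronglyMeasurable)
      (Eventually.of_forall fun x => hK _)
  refine ⟨hGf, hGg, hGf.locallyIntegrableOn, hGg.locallyIntegrableOn, fun φ hφ hφc hφΩ i => ?_⟩
  set v : EuclideanSpace ℝ (Fin n) := EuclideanSpace.single i 1
  have hΩm := hΩ.measurableSet
  have hfi : Integrable (Ω.indicator f) := (integrable_indicator_iff hΩm).2 hf
  have hgi := integrable_coord_indicator hΩm hg i
  set fΩ := Ω.indicator f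
  set γ := Ω.indicator fun x => g x i
  -- With all mollification radii at most `δ`, the derivative of `U k` in direction `v` equals `V k`
  -- on the support of `φ`, the only place where it is needed.
  obtain ⟨δ, hδ, hδΩ⟩ := IsCompact.exists_cthickening_subset_open hφc hΩ hφΩ
  set ρ : ℕ → ContDiffBump (0 : EuclideanSpace ℝ (Fin n)) := fun k =>
    ⟨δ / (k + 1) / 2, δ / (k + 1), by positivity, half_lt_self (by positivity)⟩
  have hρ : Tendsto (fun k => (ρ k).rOut) atTop (𝓝 0) := tendsto_const_div_atTop_nhds_zero_nat δ
    |>.comp (tendsto_add_atTop_nat 1) |>.congr fun k => by simp [ρ]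
  have hρ2 : ∀ k, (ρ k).rOut ≤ 2 * (ρ k).rIn := fun k => by simp only [ρ]; linarith
  have hρδ : ∀ k, (ρ k).rOut ≤ δ := fun k => by
    simp only [ρ]; exact div_le_self hδ.le (by linarith [Nat.cast_nonneg (α := ℝ) k])
  set U : ℕ → EuclideanSpace ℝ (Fin n) → ℝ := fun k =>
    (ρ k).normed volume ⋆[lsmul ℝ ℝ, volume] fΩ
  set V : ℕ → EuclideanSpace ℝ (Fin n) → ℝ := fun k =>
    (ρ k).normed volume ⋆[lsmul ℝ ℝ, volume] γ
  have hU1 : ∀ k, ContDiff ℝ 1 (U k) := fun k =>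
    (ρ k).hasCompactSupport_normed.contDiff_convolution_left _ ((ρ k).contDiff_normed (n := 1))
      hfi.locallyIntegrable
  have hVi : ∀ k, Integrable (V k) := fun k =>
    (ρ k).integrable_normed.integrable_convolution _ hgi
  have hUt : ∀ᵐ x, Tendsto (fun k => U k x) atTop (𝓝 (fΩ x)) :=
    ContDiffBump.ae_convolution_tendsto_right_of_locallyIntegrable (μ := volume) hρ
      (Eventually.of_forall hρ2) hfi.locallyIntegrable
  have hφ1 : ContDiff ℝ 1 φ := hφ.of_le (by exact_mod_cast le_top)
  have hφd := hφ1.differentiable one_ne_zero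
  have hφ'c : Continuous fun x => fderiv ℝ φ x v :=
    (hφ1.continuous_fderiv one_ne_zero).clm_apply continuous_const
  have hφ's : HasCompactSupport fun x => fderiv ℝ φ x v := hφc.fderiv_apply ℝ v
  have hφ'i : Integrable fun x => fderiv ℝ φ x v := hφ'c.integrable_of_hasCompactSupport hφ's
  obtain ⟨P, hP⟩ := hφ1.continuous.bounded_above_of_compact_support hφc
  have hparts : ∀ k, ∫ x, G (U k x) * fderiv ℝ φ x v = -∫ x, deriv G (U k x) * V k x * φ x := by
    intro k
    have hGU : ContDiff ℝ 1 fun x => G (U k x) := hG.comp (hU1 k)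
    have hGUd : ∀ x, fderiv ℝ (fun x => G (U k x)) x v = deriv G (U k x) * fderiv ℝ (U k) x v := by
      intro x
      have h1 := (hGd (U k x)).hasDerivAt.comp_hasFDerivAt x
        ((hU1 k).differentiable one_ne_zero x).hasFDerivAt
      have h2 : fderiv ℝ (fun x => G (U k x)) x = _ := h1.fderiv
      rw [h2]; simp
    have hGUc : Continuous fun x => fderiv ℝ (fun x => G (U k x)) x v :=
      (hGU.continuous_fderiv one_ne_zero).clm_apply continuous_const
    rw [integral_mul_fderiv_eq_neg_fderiv_mul_of_integrable
      ((hGUc.mul hφ1.continuous).integrable_of_hasCompactSupport hφc.mul_left)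
      ((hGU.continuous.mul hφ'c).integrable_of_hasCompactSupport hφ's.mul_left)
      ((hGU.continuous.mul hφ1.continuous).integrable_of_hasCompactSupport hφc.mul_left)
      (fun x _ => hGU.differentiable one_ne_zero x) (fun x _ => hφd x)]
    congr 1
    refine integral_congr_ae (Eventually.of_forall fun x => ?_)
    by_cases hx : x ∈ tsupport φ
    · simp only [hGUd]
      have := fderiv_convolution_of_hasWeakGradient hΩm h hf (ρ k) i (x := x)
        (((Metric.closedBall_subset_closedBall (hρδ k)).trans
          (Metric.closedBall_subset_cthickening hx δ)).trans hδΩ)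
      rw [this]
    · simp [image_eq_zero_of_notMem_tsupport hx]
  have hlim1 : Tendsto (fun k => ∫ x, G (U k x) * fderiv ℝ φ x v) atTop
      (𝓝 (∫ x, G (fΩ x) * fderiv ℝ φ x v)) := by
    refine tendsto_integral_of_dominated_convergence (fun x => M * ‖fderiv ℝ φ x v‖)
      (fun k => ((hG.continuous.comp (hU1 k).continuous).mul hφ'c).aestronglyMeasurable)
      (hφ'i.norm.const_mul M) (fun k => Eventually.of_forall fun x => ?_) ?_
    · rw [norm_mul]
      exact mul_le_mul_of_nonneg_right (hM _) (norm_nonneg _)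
    · filter_upwards [hUt] with x hx
      exact ((hG.continuous.tendsto _).comp hx).mul_const _
  have hK0 : 0 ≤ K := (abs_nonneg _).trans (hK 0)
  have hP0 : 0 ≤ P := (norm_nonneg _).trans (hP 0)
  have hm1 : ∀ k, AEStronglyMeasurable fun x => deriv G (U k x) := fun k =>
    (hG'c.comp (hU1 k).continuous).aestronglyMeasurable
  have hbd : ∀ (k : ℕ) (w : EuclideanSpace ℝ (Fin n) → ℝ) x,
      ‖deriv G (U k x) * w x * φ x‖ ≤ K * P * |w x| := fun k w x => by
    rw [norm_mul, norm_mul, Real.norm_eq_abs, Real.norm_eq_abs]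
    calc |deriv G (U k x)| * |w x| * ‖φ x‖ ≤ K * |w x| * P := by
          gcongr
          · exact hK _
          · exact hP x
      _ = _ := by ring
  have hint : ∀ (k : ℕ) {w : EuclideanSpace ℝ (Fin n) → ℝ}, Integrable w →
      Integrable fun x => deriv G (U k x) * w x * φ x := fun k w hw =>
    (hw.abs.const_mul (K * P)).mono'
      (((hm1 k).mul hw.aestronglyMeasurable).mul hφ1.continuous.aestronglyMeasurable)
      (Eventually.of_forall (hbd k w))
  have hlim2 : Tendsto (fun k => ∫ x, deriv G (U k x) * γ x * φ x) atTop
      (𝓝 (∫ x, deriv G (fΩ x) * γ x * φ x)) := by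
    refine tendsto_integral_of_dominated_convergence (fun x => K * P * |γ x|)
      (fun k => (hint k hgi).aestronglyMeasurable)
      (hgi.abs.const_mul _) (fun k => Eventually.of_forall (hbd k γ)) ?_
    filter_upwards [hUt] with x hx
    exact (((hG'c.tendsto _).comp hx).mul_const _).mul_const _
  -- `V k` tends to `γ` in `L¹`, whereas `deriv G (U k)` converges almost everywhere and boundedly.
  -- Hence the product is split: `hlim2` moves only the second sequence, and here the first is
  -- merely bounded by `K`.
  have hlim3 : Tendsto (fun k => ∫ x, deriv G (U k x) * (V k x - γ x) * φ x) atTop (𝓝 0) := by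
    have h0 := (tendsto_integral_abs_convolution_sub hρ hρ2 hgi).const_mul (K * P)
    rw [mul_zero] at h0
    refine squeeze_zero_norm (fun k => ?_) h0
    rw [← integral_const_mul]
    exact norm_integral_le_of_norm_le (((hVi k).sub hgi).abs.const_mul _)
      (Eventually.of_forall (hbd k fun x => V k x - γ x))
  have hlim4 : Tendsto (fun k => ∫ x, deriv G (U k x) * V k x * φ x) atTop
      (𝓝 (∫ x, deriv G (fΩ x) * γ x * φ x)) := by
    have := hlim2.add hlim3
    rw [add_zero] at this
    refine this.congr fun k => ?_
    have hs : Integrable fun x => deriv G (U k x) * (V k x - γ x) * φ x :=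
      hint k ((hVi k).sub hgi)
    rw [← integral_add (hint k hgi) hs]
    exact integral_congr_ae (Eventually.of_forall fun x => by ring)
  have hfinal := tendsto_nhds_unique hlim1 (hlim4.neg.congr fun k => (hparts k).symm)
  have hz : ∀ x ∉ Ω, φ x = 0 ∧ fderiv ℝ φ x v = 0 := fun x hx => by
    have hx' : x ∉ tsupport φ := fun h => hx (hφΩ h)
    refine ⟨image_eq_zero_of_notMem_tsupport hx', ?_⟩
    rw [fderiv_of_notMem_tsupport ℝ hx']; rfl
  rw [← integral_indicator hΩm, ← integral_indicator hΩm]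
  refine (integral_congr_ae (Eventually.of_forall fun x => ?_)).trans (hfinal.trans
    (congrArg Neg.neg (integral_congr_ae (Eventually.of_forall fun x => ?_))))
  · by_cases hx : x ∈ Ω
    · simp [fΩ, hx]
    · simp [hx, (hz x hx).2]
  · by_cases hx : x ∈ Ω
    · simp [fΩ, γ, hx]
    · simp [hx, (hz x hx).1]

theorem HasWeakGradient.neg (h : HasWeakGradient Ω f g) :
    HasWeakGradient Ω (fun x => -f x) (fun x => -g x) := by
  refine ⟨h.1.neg, h.2.1.neg, fun φ hφ hφc hφΩ i => ?_⟩
  have := h.2.2 φ hφ hφc hφΩ i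
  simp only [PiLp.neg_apply, neg_mul, integral_neg]
  rw [this]

end Mollification

/-! ### Truncation and the capacity estimate. -/

section Capacity

variable {n : ℕ} {Ω : Set (EuclideanSpace ℝ (Fin n))}

theorem deriv_smoothTransition_eq_zero {t : ℝ} (ht : t ∉ Ioo (0 : ℝ) 1) :
    deriv Real.smoothTransition t = 0 := by
  rcases le_or_gt t 0 with h | h
  · refine IsLocalMin.deriv_eq_zero (Filter.Eventually.of_forall fun x => ?_)
    rw [Real.smoothTransition.zero_of_nonpos h]
    exact Real.smoothTransition.nonneg x
  · refine IsLocalMax.deriv_eq_zero (Filter.Eventually.of_forall fun x => ?_)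
    rw [Real.smoothTransition.one_of_one_le (not_lt.1 fun h1 => ht ⟨h, h1⟩)]
    exact Real.smoothTransition.le_one x

theorem exists_abs_deriv_smoothTransition_le :
    ∃ K : ℝ≥0, ∀ t, |deriv Real.smoothTransition t| ≤ K := by
  have hc : Continuous (deriv Real.smoothTransition) :=
    (Real.smoothTransition.contDiff (n := 1)).continuous_deriv le_rfl
  obtain ⟨K, hK⟩ := isCompact_Icc.exists_bound_of_continuousOn (s := Icc (0 : ℝ) 1) hc.continuousOn
  refine ⟨K.toNNReal, fun t => ?_⟩
  by_cases ht : t ∈ Ioo (0 : ℝ) 1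
  · exact (hK t ⟨ht.1.le, ht.2.le⟩).trans (Real.le_coe_toNNReal K)
  · simp [deriv_smoothTransition_eq_zero ht]

theorem HasWeakGradient.congr_ae {f f' : EuclideanSpace ℝ (Fin n) → ℝ}
    {g : EuclideanSpace ℝ (Fin n) → EuclideanSpace ℝ (Fin n)} (h : HasWeakGradient Ω f g)
    (hf : IntegrableOn f Ω) (hff' : f =ᵐ[volume.restrict Ω] f') : HasWeakGradient Ω f' g := by
  refine ⟨IntegrableOn.locallyIntegrableOn (Integrable.congr hf hff'), h.2.1,
    fun φ hφ hφc hφΩ i => ?_⟩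
  rw [← h.2.2 φ hφ hφc hφΩ i]
  exact integral_congr_ae (hff'.mono fun x hx => by simp only [hx])

/-- A truncation takes the values `0` and `1` on two large sets; whatever its mean `c` is, it is far
from `c` on one of them. -/
theorem half_le_enorm_sub_or (c : ℝ) : (∀ w : ℝ, w = 0 → 2⁻¹ ≤ ‖w - c‖ₑ) ∨
    ∀ w : ℝ, w = 1 → 2⁻¹ ≤ ‖w - c‖ₑ := by
  have key : ∀ y : ℝ, 1 / 2 ≤ |y| → (2⁻¹ : ℝ≥0∞) ≤ ‖y‖ₑ := fun y hy => by
    rw [Real.enorm_eq_ofReal_abs]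
    refine le_trans (le_of_eq ?_) (ENNReal.ofReal_le_ofReal hy)
    rw [one_div, ENNReal.ofReal_inv_of_pos two_pos]; simp
  rcases le_total (1 / 2) c with h | h
  · left; rintro _ rfl; exact key _ (by rw [zero_sub, abs_neg]; exact h.trans (le_abs_self c))
  · right; rintro _ rfl; exact key _ ((by linarith : 1 / 2 ≤ 1 - c).trans (le_abs_self _))

/-- A capacity estimate for the level sets of Sobolev functions. -/
theorem SobolevPoincare.exists_capacity_le (hn : 2 ≤ n) (hΩo : IsOpen Ω) (hΩ : volume Ω = 1)
    (hP : SobolevPoincare Ω) :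
    ∃ C : ℝ≥0, ∀ f g, HasWeakGradient Ω f g → IntegrableOn f Ω → IntegrableOn g Ω → Measurable f →
      ∀ a b : ℝ, a < b → 2⁻¹ ≤ volume.restrict Ω {x | f x ≤ a} →
      ENNReal.ofReal (b - a) * (volume.restrict Ω {x | b ≤ f x}) ^ ((n - 1) / n : ℝ) ≤
        C * ∫⁻ x in {x | a < f x ∧ f x < b}, ‖g x‖ₑ ∂(volume.restrict Ω) := by
  obtain ⟨C₀, hC₀⟩ := hP
  obtain ⟨K, hK⟩ := exists_abs_deriv_smoothTransition_le
  -- One factor `2` comes from the deviation `1/2` from the mean, another from halving the measure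
  -- in `hT`, and `K` bounds the slope of the smooth step.
  refine ⟨4 * C₀ * K, fun f g h hf hg hfm a b hab hμ => ?_⟩
  set μ := volume.restrict Ω
  have : IsProbabilityMeasure μ := ⟨by simp [μ, hΩ]⟩
  have hba : 0 < b - a := sub_pos.2 hab
  have hn1 : (1 : ℝ) < n := by exact_mod_cast hn
  set G : ℝ → ℝ := fun t => Real.smoothTransition ((t - a) / (b - a))
  have hG : ContDiff ℝ 1 G := Real.smoothTransition.contDiff.comp (by fun_prop)
  have hG' : ∀ t, deriv G t = deriv Real.smoothTransition ((t - a) / (b - a)) / (b - a) := by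
    intro t
    have h1 : HasDerivAt (fun t : ℝ => (t - a) / (b - a)) (1 / (b - a)) t :=
      ((hasDerivAt_id t).sub_const a).div_const _
    have h2 := (((Real.smoothTransition.contDiff (n := 1)).differentiable one_ne_zero
      ((t - a) / (b - a))).hasDerivAt).comp t h1
    have h3 : deriv G t = _ := h2.deriv
    rw [h3]; ring
  have hGK : ∀ t, |deriv G t| ≤ K / (b - a) := fun t => by
    rw [hG', abs_div, abs_of_pos hba]; gcongr; exact hK _
  have hG0 : ∀ t, ¬ (a < t ∧ t < b) → deriv G t = 0 := fun t ht => by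
    rw [hG', deriv_smoothTransition_eq_zero, zero_div]
    rintro ⟨h1, h2⟩
    rw [div_pos_iff_of_pos_right hba] at h1
    rw [div_lt_one hba] at h2
    exact ht ⟨by linarith, by linarith⟩
  obtain ⟨hGf, hGg, hGw⟩ := h.comp hΩo (by simp [hΩ]) hf hg hG (M := 1) (fun t => by
    rw [abs_of_nonneg (Real.smoothTransition.nonneg _)]; exact Real.smoothTransition.le_one _) hGK
  have hpoin := hC₀ _ _ hGw hGf hGg
  set c := ⨍ y in Ω, G (f y)
  set p : ℝ := n / (n - 1)
  set q : ℝ := (n - 1) / n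
  have hp0 : 0 < p := div_pos (by linarith) (by linarith)
  have hq0 : 0 < q := div_pos (by linarith) (by linarith)
  have hpq : p * q = 1 := by
    have : (n : ℝ) - 1 ≠ 0 := by linarith
    simp only [p, q]; field_simp
  have hq1 : q ≤ 1 := (div_le_one (by linarith)).2 (by linarith)
  set T := {x | (2⁻¹ : ℝ≥0∞) ^ p ≤ ‖G (f x) - c‖ₑ ^ p}
  -- If the mean is far from `0`, then `T` contains `{f ≤ a}`, of measure at least `1/2`; if it is
  -- far from `1`, then `T` contains `{b ≤ f}`.
  have hT : μ {x | b ≤ f x} / 2 ≤ μ T := by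
    rcases half_le_enorm_sub_or c with h | h
    · calc μ {x | b ≤ f x} / 2 ≤ 1 / 2 := by gcongr; exact prob_le_one
        _ ≤ μ {x | f x ≤ a} := by simpa using hμ
        _ ≤ μ T := measure_mono fun x hx => ENNReal.rpow_le_rpow (h _
            (Real.smoothTransition.zero_of_nonpos (div_nonpos_of_nonpos_of_nonneg
              (sub_nonpos.2 hx) hba.le))) hp0.le
    · calc μ {x | b ≤ f x} / 2 ≤ μ {x | b ≤ f x} := ENNReal.half_le_self
        _ ≤ μ T := measure_mono fun x hx => ENNReal.rpow_le_rpow (h _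
            (Real.smoothTransition.one_of_one_le ((one_le_div hba).2
              (sub_le_sub_right hx a)))) hp0.le
  have hm : Measurable fun x => ‖G (f x) - c‖ₑ ^ p := by
    have := hG.continuous.measurable
    fun_prop
  have hlow : 4⁻¹ * μ {x | b ≤ f x} ^ q ≤ (∫⁻ x in Ω, ‖G (f x) - c‖ₑ ^ p) ^ q := by
    calc 4⁻¹ * μ {x | b ≤ f x} ^ q = 2⁻¹ * (2⁻¹ * μ {x | b ≤ f x} ^ q) := by
          rw [← mul_assoc, ← ENNReal.mul_inv (by simp) (by simp)]; norm_num
      _ ≤ 2⁻¹ * ((2⁻¹) ^ q * μ {x | b ≤ f x} ^ q) := by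
          gcongr
          calc (2⁻¹ : ℝ≥0∞) = 2⁻¹ ^ (1 : ℝ) := (ENNReal.rpow_one _).symm
            _ ≤ 2⁻¹ ^ q := ENNReal.rpow_le_rpow_of_exponent_ge (by simp) hq1
      _ = 2⁻¹ * (μ {x | b ≤ f x} / 2) ^ q := by
          rw [← ENNReal.mul_rpow_of_nonneg _ _ hq0.le, mul_comm (2⁻¹ : ℝ≥0∞) (μ _), div_eq_mul_inv]
      _ ≤ 2⁻¹ * μ T ^ q := by gcongr
      _ = ((2⁻¹) ^ p * μ T) ^ q := by
          rw [ENNReal.mul_rpow_of_nonneg _ _ hq0.le, ← ENNReal.rpow_mul, hpq, ENNReal.rpow_one]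
      _ ≤ _ := by
          gcongr
          exact mul_meas_ge_le_lintegral hm _
  have hSm : MeasurableSet {x | a < f x ∧ f x < b} :=
    (measurableSet_lt measurable_const hfm).inter (measurableSet_lt hfm measurable_const)
  have hup : ∫⁻ x in Ω, ‖deriv G (f x) • g x‖ₑ ≤
      ENNReal.ofReal (K / (b - a)) * ∫⁻ x in {x | a < f x ∧ f x < b}, ‖g x‖ₑ ∂μ := by
    rw [← lintegral_indicator hSm, ← lintegral_const_mul' _ _ ENNReal.ofReal_ne_top]
    refine lintegral_mono fun x => ?_
    by_cases hx : a < f x ∧ f x < b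
    · rw [indicator_of_mem (show x ∈ {x | a < f x ∧ f x < b} from hx), enorm_smul]
      gcongr
      rw [Real.enorm_eq_ofReal_abs]
      exact ENNReal.ofReal_le_ofReal (hGK _)
    · rw [hG0 _ hx]; simp
  have hbae : ENNReal.ofReal (b - a) * ENNReal.ofReal (K / (b - a)) = K := by
    rw [← ENNReal.ofReal_mul hba.le, mul_div_cancel₀ _ hba.ne']; simp
  calc ENNReal.ofReal (b - a) * μ {x | b ≤ f x} ^ q
      = 4 * (ENNReal.ofReal (b - a) * (4⁻¹ * μ {x | b ≤ f x} ^ q)) := by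
        rw [mul_left_comm, ← mul_assoc 4, ENNReal.mul_inv_cancel (by simp) (by simp), one_mul]
    _ ≤ 4 * (ENNReal.ofReal (b - a) * (C₀ * (ENNReal.ofReal (K / (b - a)) *
          ∫⁻ x in {x | a < f x ∧ f x < b}, ‖g x‖ₑ ∂μ))) := by
        refine mul_le_mul_right (mul_le_mul_right (hlow.trans (hpoin.trans ?_)) _) _
        gcongr
    _ = 4 * C₀ * (ENNReal.ofReal (b - a) * ENNReal.ofReal (K / (b - a))) *
          ∫⁻ x in {x | a < f x ∧ f x < b}, ‖g x‖ₑ ∂μ := by ring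
    _ = _ := by rw [hbae]; push_cast; ring

end Capacity

/-! ### The Hardy inequality implies the Sobolev inequality: the part above a median. -/

section Embedding

variable {n : ℕ} {Ω : Set (EuclideanSpace ℝ (Fin n))}

/-- The measure of the strip between two consecutive dyadic levels of the rearrangement. -/
theorem measure_dyadic_strip_le {α : Type*} [MeasurableSpace α] {μ : Measure α}
    [IsProbabilityMeasure μ] {F : α → ℝ≥0∞} (hF : Measurable F) (j : ℕ) :
    μ {x | rearr μ F (2⁻¹ ^ j) < F x ∧ F x < rearr μ F (2⁻¹ ^ (j + 1))} ≤
      ENNReal.ofReal (2⁻¹ ^ (j + 1)) := by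
  set r := rearr μ F (2⁻¹ ^ j)
  set r' := rearr μ F (2⁻¹ ^ (j + 1))
  rcases le_or_gt r' r with h | h
  · have : {x | r < F x ∧ F x < r'} = ∅ := by
      ext x
      simp only [mem_ofPred_eq, mem_empty_iff_false, iff_false, not_and, not_lt]
      exact fun hx => h.trans hx.le
    simp [this]
  have hdisj : Disjoint {x | r < F x ∧ F x < r'} {x | r' ≤ F x} :=
    disjoint_left.2 fun x hx hx' => absurd hx.2 (not_lt.2 hx')
  have hsub : {x | r < F x ∧ F x < r'} ∪ {x | r' ≤ F x} ⊆ {x | r < F x} := by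
    rintro x (hx | hx)
    · exact hx.1
    · exact h.trans_le hx
  have h1 : μ {x | r < F x ∧ F x < r'} + μ {x | r' ≤ F x} ≤ ENNReal.ofReal (2⁻¹ ^ j) := by
    rw [← measure_union hdisj (measurableSet_le measurable_const hF)]
    exact (measure_mono hsub).trans (measure_lt_rearr_le μ F _)
  have h2 : ENNReal.ofReal (2⁻¹ ^ (j + 1)) ≤ μ {x | r' ≤ F x} :=
    le_measure_rearr_le μ hF.aemeasurable (pow_le_one₀ (by norm_num) (by norm_num))
  have h3 : μ {x | r < F x ∧ F x < r'} + ENNReal.ofReal (2⁻¹ ^ (j + 1)) ≤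
      ENNReal.ofReal (2⁻¹ ^ (j + 1)) + ENNReal.ofReal (2⁻¹ ^ (j + 1)) := by
    rw [← ENNReal.ofReal_add (by positivity) (by positivity), half_pow_add_half_pow]
    exact (add_le_add le_rfl h2).trans h1
  exact (ENNReal.add_le_add_iff_right ENNReal.ofReal_ne_top).1 h3

/-- The increment of the Hardy operator of a dyadic step function over a dyadic interval. -/
theorem mul_le_hardyOp_dyadic (hn : 1 ≤ n) {J : ℕ → ℝ≥0∞} (hJ : ∀ k, J k ≠ ∞) (k : ℕ) :
    ENNReal.ofReal (((2⁻¹ : ℝ) ^ k) ^ (-((n - 1) / n : ℝ))) * J k ≤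
      ∫⁻ s in Ioo ((2⁻¹ : ℝ) ^ (k + 1)) (2⁻¹ ^ k), ENNReal.ofReal (s ^ (1 / n : ℝ) *
        (2 ^ (dyadicIndex s + 1) * J (dyadicIndex s)).toReal / s) := by
  have hn0 : (0 : ℝ) < n := by exact_mod_cast hn
  have hn1 : (1 : ℝ) ≤ n := by exact_mod_cast hn
  have hc : 2 ^ (k + 1) * J k ≠ ∞ := ENNReal.mul_ne_top (by simp) (hJ k)
  calc ENNReal.ofReal (((2⁻¹ : ℝ) ^ k) ^ (-((n - 1) / n : ℝ))) * J k
      = ∫⁻ s in Ioo ((2⁻¹ : ℝ) ^ (k + 1)) (2⁻¹ ^ k),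
        ENNReal.ofReal (((2⁻¹ : ℝ) ^ k) ^ (-((n - 1) / n : ℝ))) * (2 ^ (k + 1) * J k) := by
        simp only [lintegral_const, Measure.restrict_apply MeasurableSet.univ, univ_inter,
          Real.volume_Ioo]
        rw [← half_pow_add_half_pow k, add_sub_cancel_right,
          mul_assoc, mul_right_comm]
        have : (2 : ℝ≥0∞) ^ (k + 1) * ENNReal.ofReal (2⁻¹ ^ (k + 1)) = 1 := by
          rw [ENNReal.ofReal_pow (by norm_num), ENNReal.ofReal_inv_of_pos two_pos,
            ← mul_pow]
          simp [ENNReal.mul_inv_cancel]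
        rw [this, one_mul]
    _ ≤ _ := by
        refine lintegral_mono_ae ((ae_restrict_iff' measurableSet_Ioo).2
          (Filter.Eventually.of_forall fun s hs => ?_))
        have hs0 : 0 < s := lt_trans (by positivity) hs.1
        have hs1 : s ≤ 1 := hs.2.le.trans (pow_le_one₀ (by norm_num) (by norm_num))
        rw [(dyadicIndex_eq_iff ⟨hs0, hs1⟩ k).2 ⟨hs.1, hs.2.le⟩, mul_div_right_comm,
          ENNReal.ofReal_mul (by positivity), ENNReal.ofReal_toReal hc]
        gcongr
        have e : s ^ (1 / n : ℝ) / s = s ^ (-((n - 1) / n : ℝ)) := by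
          rw [div_eq_mul_inv, ← Real.rpow_neg_one, ← Real.rpow_add hs0]
          congr 1
          field_simp
          ring
        rw [e]
        refine Real.rpow_le_rpow_of_nonpos hs0 hs.2.le ?_
        rw [neg_nonpos]
        exact div_nonneg (by linarith) hn0.le

theorem rpow_neg_half_pow_add_two_le {q : ℝ} (hq : q ≤ 1) (k : ℕ) :
    ((2⁻¹ : ℝ) ^ (k + 2)) ^ (-q) ≤ 4 * ((2⁻¹ : ℝ) ^ k) ^ (-q) := by
  rw [pow_add, Real.mul_rpow (by positivity) (by positivity), mul_comm]
  gcongr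
  have : ((2⁻¹ : ℝ) ^ 2) = 4⁻¹ := by norm_num
  rw [this, Real.inv_rpow (by norm_num), ← Real.rpow_neg (by norm_num), neg_neg]
  calc (4 : ℝ) ^ q ≤ 4 ^ (1 : ℝ) := Real.rpow_le_rpow_of_exponent_le (by norm_num) hq
    _ = 4 := Real.rpow_one _

/-- The bound for the positive part of a Sobolev function above a median. -/
theorem exists_norm_posPart_le (hn : 2 ≤ n) (hΩo : IsOpen Ω) (hΩ : volume Ω = 1)
    (hP : SobolevPoincare Ω) (X Y : RINorm (volume.restrict Ω))
    {σ : EuclideanSpace ℝ (Fin n) → ℝ} (hσ : MeasurePreserving σ (volume.restrict Ω) unitMeasure)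
    (h : ∃ C : ℝ≥0, ∀ f : ℝ → ℝ, AEMeasurable f unitMeasure → (∀ s, 0 ≤ f s) →
        X.hat (fun s => ‖f s‖ₑ) < ∞ → Y.hat (hardyOp n f) ≤ C * X.hat (fun s => ‖f s‖ₑ)) :
    ∃ C : ℝ≥0, ∀ f g, HasWeakGradient Ω f g → IntegrableOn f Ω → IntegrableOn g Ω → Measurable f →
      X.norm (fun x => ‖g x‖ₑ) < ∞ → ∀ m : ℝ, 2⁻¹ ≤ volume.restrict Ω {x | f x ≤ m} →
      Y.norm (fun x => ENNReal.ofReal (f x - m)) ≤ C * X.norm (fun x => ‖g x‖ₑ) := by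
  obtain ⟨C, hC⟩ := h
  obtain ⟨C₁, hC₁⟩ := hP.exists_capacity_le hn hΩo hΩ
  refine ⟨4 * C₁ * C, fun f g hw hf hg hfm hXg m hm => ?_⟩
  have : IsProbabilityMeasure (volume.restrict Ω) := ⟨by simp [hΩ]⟩
  have hn0 : (0 : ℝ) < n := by exact_mod_cast (by omega : 0 < n)
  set q : ℝ := (n - 1) / n
  have hq0 : 0 < q := div_pos (by have : (2 : ℝ) ≤ n := by exact_mod_cast hn
                                  linarith) hn0
  have hq1 : q ≤ 1 := (div_le_one hn0).2 (by linarith)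
  set F : EuclideanSpace ℝ (Fin n) → ℝ≥0∞ := fun x => ENNReal.ofReal (f x - m)
  have hFm : Measurable F := by fun_prop
  set r : ℕ → ℝ≥0∞ := fun j => rearr (volume.restrict Ω) F (2⁻¹ ^ j)
  have hr : ∀ j, r j ≠ ∞ := fun j => (rearr_lt_top (volume.restrict Ω) hFm.aemeasurable
    (Filter.Eventually.of_forall fun x => ENNReal.ofReal_lt_top) (by positivity)).ne
  have hrmono : Monotone r := fun i j hij => rearr_antitone (volume.restrict Ω) F
    (pow_le_pow_of_le_one (by norm_num) (by norm_num) hij)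
  -- `F` vanishes on at least half of the space, so its rearrangement is zero at `1/2`. This starts
  -- the induction in `hrH`.
  have hr1 : r 1 = 0 := by
    rw [← nonpos_iff_eq_zero, rearr_le_iff]
    have hcompl : {x | 0 < F x} = {x | f x ≤ m}ᶜ := by ext x; simp [F]
    rw [hcompl, prob_compl_eq_one_sub (measurableSet_le hfm measurable_const)]
    refine (tsub_le_tsub_left hm 1).trans_eq ?_
    rw [ENNReal.one_sub_inv_two, pow_one, ENNReal.ofReal_inv_of_pos two_pos]; simp
  -- The index is shifted by one because the levels only start to rise after `r 1 = 0`. The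
  -- resulting measure bound `2^{-(i+2)}` is better than the `2^{-(i+1)}` required for averaging.
  set B : ℕ → Set (EuclideanSpace ℝ (Fin n)) := fun i => {x | r (i + 1) < F x ∧ F x < r (i + 2)}
  have hBm : ∀ i, MeasurableSet (B i) := fun i =>
    (measurableSet_lt measurable_const hFm).inter (measurableSet_lt hFm measurable_const)
  have hBd : Pairwise (Function.onFun Disjoint B) := by
    have key : ∀ i j, i < j → Disjoint (B i) (B j) := fun i j hij =>
      disjoint_left.2 fun x hx hx' => absurd (hx.2.trans_le (hrmono (by omega : i + 2 ≤ j + 1)))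
        (not_lt.2 hx'.1.le)
    intro i j hij
    rcases lt_or_gt_of_ne hij with h | h
    · exact key i j h
    · exact (key j i h).symm
  have hBμ : ∀ i, (volume.restrict Ω) (B i) ≤ ENNReal.ofReal (2⁻¹ ^ (i + 1)) := fun i =>
    (measure_dyadic_strip_le hFm (i + 1)).trans (ENNReal.ofReal_le_ofReal
      (pow_le_pow_of_le_one (by norm_num) (by norm_num) (by omega)))
  set J : ℕ → ℝ≥0∞ := fun i => ∫⁻ x in B i, ‖g x‖ₑ ∂(volume.restrict Ω)
  have hJ : ∀ i, J i ≠ ∞ := fun i => ((setLIntegral_le_lintegral _ _).trans_lt hg.2).ne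
  set c : ℝ → ℝ≥0∞ := fun t => 2 ^ (dyadicIndex t + 1) * J (dyadicIndex t)
  have hc : ∀ t, c t ≠ ∞ := fun t => ENNReal.mul_ne_top (by simp) (hJ _)
  have hcm : Measurable c := measurable_comp_dyadicIndex (G := fun k _ => 2 ^ (k + 1) * J k)
    fun k => measurable_const
  set h : ℝ → ℝ := fun t => (c t).toReal
  have hhc : (fun t => ‖h t‖ₑ) = c := funext fun t => by
    rw [Real.enorm_of_nonneg ENNReal.toReal_nonneg, ENNReal.ofReal_toReal (hc t)]
  have hXh : X.hat (fun t => ‖h t‖ₑ) ≤ X.norm fun x => ‖g x‖ₑ := by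
    rw [hhc, X.hat_eq_toUnit hσ hcm.aemeasurable,
      ← X.toUnit_norm_rearr hσ hg.aestronglyMeasurable.enorm]
    exact (X.toUnit hσ).norm_dyadicAverage_le hg.aestronglyMeasurable.enorm hBm hBd hBμ
  -- The capacity estimate between consecutive levels: `F ≥ r (k + 2)` on a set of measure at least
  -- `2^{-(k+2)}`. The `4` pays for replacing `2^{-(k+2)}` by `2^{-k}` in the power `-q`.
  have hstep : ∀ k, r (k + 2) ≤ r (k + 1) + 4 * C₁ *
      (ENNReal.ofReal (((2⁻¹ : ℝ) ^ k) ^ (-q)) * J k) := by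
    intro k
    rcases le_or_gt (r (k + 2)) (r (k + 1)) with hle | hlt
    · exact hle.trans le_self_add
    rw [← tsub_le_iff_left]
    have hlt' : (r (k + 1)).toReal < (r (k + 2)).toReal :=
      (ENNReal.toReal_lt_toReal (hr _) (hr _)).2 hlt
    have hcap := hC₁ f g hw hf hg hfm (m + (r (k + 1)).toReal) (m + (r (k + 2)).toReal)
      (by linarith) (hm.trans (measure_mono fun x hx => le_trans (show f x ≤ m from hx)
        (le_add_of_nonneg_right ENNReal.toReal_nonneg)))
    have e1 : ENNReal.ofReal (m + (r (k + 2)).toReal - (m + (r (k + 1)).toReal)) =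
        r (k + 2) - r (k + 1) := by
      rw [add_sub_add_left_eq_sub, ENNReal.ofReal_sub _ ENNReal.toReal_nonneg,
        ENNReal.ofReal_toReal (hr _), ENNReal.ofReal_toReal (hr _)]
    have e2 : ENNReal.ofReal (2⁻¹ ^ (k + 2)) ≤
        (volume.restrict Ω) {x | m + (r (k + 2)).toReal ≤ f x} := by
      refine (le_measure_rearr_le (volume.restrict Ω) hFm.aemeasurable
        (pow_le_one₀ (by norm_num) (by norm_num))).trans (measure_mono fun x hx => ?_)
      have hx' : r (k + 2) ≤ ENNReal.ofReal (f x - m) := hx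
      have hpos : 0 < f x - m := ENNReal.ofReal_pos.1 (lt_of_lt_of_le (pos_of_gt hlt) hx')
      have := (ENNReal.le_ofReal_iff_toReal_le (hr _) hpos.le).1 hx'
      simp only [mem_ofPred_eq]
      linarith
    have e3 : ∫⁻ x in {x | m + (r (k + 1)).toReal < f x ∧ f x < m + (r (k + 2)).toReal},
        ‖g x‖ₑ ∂(volume.restrict Ω) ≤ J k := by
      refine lintegral_mono_set fun x hx => ⟨?_, ?_⟩
      · refine (ENNReal.lt_ofReal_iff_toReal_lt (hr _)).2 ?_
        linarith [hx.1]
      · refine (ENNReal.ofReal_lt_iff_lt_toReal ?_ (hr _)).2 ?_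
        · linarith [hx.1, ENNReal.toReal_nonneg (a := r (k + 1))]
        · linarith [hx.2]
    rw [e1] at hcap
    have e4 : (r (k + 2) - r (k + 1)) * ENNReal.ofReal ((2⁻¹ ^ (k + 2)) ^ q) ≤ C₁ * J k := by
      rw [← ENNReal.ofReal_rpow_of_pos (by positivity)]
      refine le_trans ?_ (hcap.trans (mul_le_mul_right e3 _))
      gcongr
    calc r (k + 2) - r (k + 1)
        = ENNReal.ofReal (((2⁻¹ : ℝ) ^ (k + 2)) ^ (-q)) *
          ((r (k + 2) - r (k + 1)) * ENNReal.ofReal ((2⁻¹ ^ (k + 2)) ^ q)) := by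
          rw [mul_left_comm, ← ENNReal.ofReal_mul (by positivity), ← Real.rpow_add (by positivity)]
          simp
      _ ≤ ENNReal.ofReal (4 * ((2⁻¹ : ℝ) ^ k) ^ (-q)) * (C₁ * J k) := by
          gcongr
          exact rpow_neg_half_pow_add_two_le hq1 k
      _ = _ := by
          rw [ENNReal.ofReal_mul (by norm_num), ENNReal.ofReal_ofNat]; ring
  -- Telescoping: each increment of the levels is absorbed by the part of the Hardy integral over
  -- one dyadic interval.
  have hrH : ∀ k, r (k + 1) ≤ 4 * C₁ * hardyOp n h (2⁻¹ ^ k) := by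
    intro k
    induction k with
    | zero => rw [hr1]; exact zero_le
    | succ k ih =>
      refine (hstep k).trans ?_
      have hs : hardyOp n h (2⁻¹ ^ (k + 1)) = _ := setLIntegral_Ioo_split
        (fun s => ENNReal.ofReal (s ^ (1 / n : ℝ) * h s / s))
        (pow_le_pow_of_le_one (by norm_num) (by norm_num) (Nat.le_succ k))
        (pow_le_one₀ (n := k) (by norm_num) (by norm_num : (2⁻¹ : ℝ) ≤ 1))
      rw [hs, mul_add, add_comm]
      exact add_le_add (mul_le_mul_right (mul_le_hardyOp_dyadic (by omega) hJ k) _) ih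
  have hHm := (hardyOp_antitone n h).measurable.aemeasurable (μ := unitMeasure)
  calc Y.norm F = (Y.toUnit hσ).norm (rearr (volume.restrict Ω) F) :=
        (Y.toUnit_norm_rearr hσ hFm.aemeasurable).symm
    _ ≤ (Y.toUnit hσ).norm fun t => (4 * C₁ : ℝ≥0) * hardyOp n h t := by
        refine (Y.toUnit hσ).norm_mono _ _ (measurable_rearr _ _).aemeasurable
          (hHm.const_mul _) ((ae_restrict_iff' measurableSet_Ioo).2
            (Filter.Eventually.of_forall fun t ht => ?_))
        have htk := dyadic_mem_Ioc ⟨ht.1, ht.2.le⟩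
        refine (rearr_antitone (volume.restrict Ω) F htk.1.le).trans ((hrH (dyadicIndex t)).trans ?_)
        push_cast
        gcongr
        exact hardyOp_antitone n h htk.2
    _ = (4 * C₁ : ℝ≥0) * (Y.toUnit hσ).norm (hardyOp n h) := (Y.toUnit hσ).norm_smul _ _ hHm
    _ ≤ (4 * C₁ : ℝ≥0) * (C * X.norm fun x => ‖g x‖ₑ) := by
        gcongr
        rw [← Y.hat_eq_toUnit hσ hHm]
        exact (hC h hcm.ennreal_toReal.aemeasurable (fun t => ENNReal.toReal_nonneg)
          (hXh.trans_lt hXg)).trans (mul_le_mul_right hXh _)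
    _ = _ := by push_cast; ring

end Embedding

/-! ### From the median to the mean. -/

section EmbeddingConclusion

theorem exists_median {α : Type*} [MeasurableSpace α] (μ : Measure α) [IsProbabilityMeasure μ]
    {f : α → ℝ} (hf : Measurable f) :
    ∃ m : ℝ, 2⁻¹ ≤ μ {x | f x ≤ m} ∧ 2⁻¹ ≤ μ {x | m ≤ f x} := by
  -- The exponential makes `f` positive without changing the order, so a median of `f` is the
  -- logarithm of the rearrangement of `F` at `1/2`.
  set F : α → ℝ≥0∞ := fun x => ENNReal.ofReal (Real.exp (f x))
  have hFm : Measurable F := by fun_prop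
  have e2 : ENNReal.ofReal 2⁻¹ = 2⁻¹ := by rw [ENNReal.ofReal_inv_of_pos two_pos]; simp
  have h1 := measure_lt_rearr_le μ F 2⁻¹
  have h2 := le_measure_rearr_le μ hFm.aemeasurable (t := 2⁻¹) (by norm_num)
  have hfin : rearr μ F 2⁻¹ ≠ ∞ := (rearr_lt_top μ hFm.aemeasurable
    (Filter.Eventually.of_forall fun x => ENNReal.ofReal_lt_top) (by norm_num)).ne
  rw [e2] at h1 h2
  set r := rearr μ F 2⁻¹
  have hr0 : r ≠ 0 := by
    intro h0
    have : {x | r < F x} = univ := by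
      ext x; simp only [h0, mem_ofPred_eq, mem_univ, iff_true]
      exact ENNReal.ofReal_pos.2 (Real.exp_pos _)
    rw [this, measure_univ] at h1
    exact absurd h1 (not_le.2 ENNReal.one_half_lt_one)
  have hr : 0 < r.toReal := ENNReal.toReal_pos hr0 hfin
  refine ⟨Real.log r.toReal, ?_, ?_⟩
  · have hs : {x | f x ≤ Real.log r.toReal} = {x | r < F x}ᶜ := by
      ext x
      simp only [mem_ofPred_eq, mem_compl_iff, not_lt, F]
      rw [Real.le_log_iff_exp_le hr, ENNReal.ofReal_le_iff_le_toReal hfin]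
    rw [hs, prob_compl_eq_one_sub (measurableSet_lt measurable_const hFm)]
    exact (ENNReal.one_sub_inv_two.symm.le).trans (tsub_le_tsub_left h1 1)
  · refine h2.trans (measure_mono fun x hx => ?_)
    have hx' : r ≤ ENNReal.ofReal (Real.exp (f x)) := hx
    rw [ENNReal.le_ofReal_iff_toReal_le hfin (Real.exp_pos _).le] at hx'
    exact (Real.log_le_iff_le_exp hr).2 hx'

variable {n : ℕ} {Ω : Set (EuclideanSpace ℝ (Fin n))}

theorem RINorm.Mem.integrable {α : Type*} [MeasurableSpace α] {μ : Measure α} [IsFiniteMeasure μ]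
    {X : RINorm μ} {F : Type*} [NormedAddCommGroup F] {f : α → F} (hf : X.Mem f) :
    Integrable f μ := by
  obtain ⟨C, hC⟩ := X.exists_lintegral_le
  exact ⟨hf.1, (hC _ hf.1.enorm).trans_lt (ENNReal.mul_lt_top ENNReal.coe_lt_top hf.2)⟩

theorem enorm_sub_average_le {α : Type*} [MeasurableSpace α] {μ : Measure α}
    [IsProbabilityMeasure μ] {f : α → ℝ} (hf : Integrable f μ) (m : ℝ) :
    ‖m - ⨍ y, f y ∂μ‖ₑ ≤ ∫⁻ x, ‖f x - m‖ₑ ∂μ := by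
  have : m - ⨍ y, f y ∂μ = ∫ x, (m - f x) ∂μ := by
    rw [integral_sub (integrable_const m) hf, average_eq_integral]; simp
  rw [this]
  refine (enorm_integral_le_lintegral_enorm _).trans_eq (lintegral_congr fun x => ?_)
  rw [← enorm_neg, neg_sub]

/-- If `m` is a median of `f`, then `-m` is one of `-f`, so the one-sided bound applies to both. The
passage from median to mean costs the `L¹` norm of `f - m`, which the `Y` norm controls. -/
theorem sobolev_embedding_of_hardy_bound (hn : 2 ≤ n) (hΩo : IsOpen Ω) (hΩ : volume Ω = 1)
    (hP : SobolevPoincare Ω) (X Y : RINorm (volume.restrict Ω))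
    {σ : EuclideanSpace ℝ (Fin n) → ℝ} (hσ : MeasurePreserving σ (volume.restrict Ω) unitMeasure)
    (h : ∃ C : ℝ≥0, ∀ f : ℝ → ℝ, AEMeasurable f unitMeasure → (∀ s, 0 ≤ f s) →
        X.hat (fun s => ‖f s‖ₑ) < ∞ → Y.hat (hardyOp n f) ≤ C * X.hat (fun s => ‖f s‖ₑ)) :
    ∃ C : ℝ≥0, ∀ f g, HasWeakGradient Ω f g → X.Mem f → X.Mem g →
        Y.norm (fun x => ‖f x - ⨍ y in Ω, f y‖ₑ) ≤ C * X.norm (fun x => ‖g x‖ₑ) := by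
  obtain ⟨C, hC⟩ := exists_norm_posPart_le hn hΩo hΩ hP X Y hσ h
  have : IsProbabilityMeasure (volume.restrict Ω) := ⟨by simp [hΩ]⟩
  obtain ⟨K, hK⟩ := Y.exists_lintegral_le
  set L := (Y.norm 1).toNNReal
  have hL : (L : ℝ≥0∞) = Y.norm 1 := ENNReal.coe_toNNReal Y.norm_one_lt_top.ne
  refine ⟨(1 + K * L) * (2 * C), fun f₀ g hw₀ hf₀X hgX => ?_⟩
  have hf₀ : IntegrableOn f₀ Ω := hf₀X.integrable
  have hg : IntegrableOn g Ω := hgX.integrable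
  set f := hf₀.aemeasurable.mk f₀
  have hff : f₀ =ᵐ[volume.restrict Ω] f := hf₀.aemeasurable.ae_eq_mk
  have hfm : Measurable f := hf₀.aemeasurable.measurable_mk
  have hf : IntegrableOn f Ω := Integrable.congr hf₀ hff
  have hw := hw₀.congr_ae hf₀ hff
  have havg : ⨍ y in Ω, f₀ y = ⨍ y in Ω, f y := average_congr hff
  rw [havg]
  set c := ⨍ y in Ω, f y
  have hcongr : Y.norm (fun x => ‖f₀ x - c‖ₑ) = Y.norm fun x => ‖f x - c‖ₑ :=
    Y.norm_congr_ae (hf₀.aemeasurable.sub_const c).enorm (hff.mono fun x hx => by simp only [hx])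
  rw [hcongr]
  obtain ⟨m, hm1, hm2⟩ := exists_median (volume.restrict Ω) hfm
  have h1 := hC f g hw hf hg hfm hgX.2 m hm1
  have h2 := hC (fun x => -f x) (fun x => -g x) hw.neg hf.neg hg.neg hfm.neg
    (by simpa only [enorm_neg] using hgX.2) (-m) (by simpa only [neg_le_neg_iff] using hm2)
  simp only [enorm_neg] at h2
  have hdm : Measurable fun x => ‖f x - m‖ₑ := by fun_prop
  have hmed : Y.norm (fun x => ‖f x - m‖ₑ) ≤ 2 * C * X.norm fun x => ‖g x‖ₑ := by
    calc Y.norm (fun x => ‖f x - m‖ₑ)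
        ≤ Y.norm fun x => ENNReal.ofReal (f x - m) + ENNReal.ofReal (-f x - -m) := by
          refine Y.norm_mono _ _ hdm.aemeasurable (by fun_prop)
            (Filter.Eventually.of_forall fun x => ?_)
          simp only [Real.enorm_eq_ofReal_abs]
          rcases le_total 0 (f x - m) with hx | hx
          · rw [abs_of_nonneg hx]; exact le_self_add
          · rw [abs_of_nonpos hx, neg_sub, show m - f x = -f x - -m by ring]; exact le_add_self
      _ ≤ _ := Y.norm_add_le _ _ (by fun_prop) (by fun_prop)
      _ ≤ _ := add_le_add h1 h2
      _ = _ := by ring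
  calc Y.norm (fun x => ‖f x - c‖ₑ) ≤ Y.norm fun x => ‖f x - m‖ₑ + ‖m - c‖ₑ := by
        refine Y.norm_mono _ _ (by fun_prop) (by fun_prop) (Filter.Eventually.of_forall fun x => ?_)
        have := enorm_add_le (f x - m) (m - c)
        rwa [sub_add_sub_cancel] at this
    _ ≤ Y.norm (fun x => ‖f x - m‖ₑ) + Y.norm fun _ => ‖m - c‖ₑ :=
        Y.norm_add_le _ _ hdm.aemeasurable aemeasurable_const
    _ ≤ Y.norm (fun x => ‖f x - m‖ₑ) + K * Y.norm (fun x => ‖f x - m‖ₑ) * L := by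
        rw [Y.norm_const_eq enorm_ne_top, ← hL]
        gcongr
        exact (enorm_sub_average_le hf m).trans (hK _ hdm.aemeasurable)
    _ = (1 + K * L) * Y.norm (fun x => ‖f x - m‖ₑ) := by ring
    _ ≤ (1 + K * L) * (2 * C * X.norm fun x => ‖g x‖ₑ) := by gcongr
    _ = _ := by push_cast; ring

end EmbeddingConclusion

/-! ### Radial Lipschitz test functions. -/

section TestFunctions

open Filter Topology

variable {n : ℕ} {Ω : Set (EuclideanSpace ℝ (Fin n))}

theorem norm_gradient_eq (u : EuclideanSpace ℝ (Fin n) → ℝ) (x : EuclideanSpace ℝ (Fin n)) :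
    ‖gradient u x‖ = ‖fderiv ℝ u x‖ := by
  simp [gradient]

theorem gradient_apply_eq_fderiv (u : EuclideanSpace ℝ (Fin n) → ℝ)
    (x : EuclideanSpace ℝ (Fin n)) (i : Fin n) :
    gradient u x i = fderiv ℝ u x (EuclideanSpace.single i 1) := by
  have h : inner ℝ (gradient u x) (EuclideanSpace.single i 1) =
      fderiv ℝ u x (EuclideanSpace.single i 1) := by
    rw [gradient, InnerProductSpace.toDual_symm_apply]
  rw [← h, EuclideanSpace.inner_single_right]
  simp

theorem measurable_gradient (u : EuclideanSpace ℝ (Fin n) → ℝ) : Measurable (gradient u) := by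
  unfold gradient
  exact (InnerProductSpace.toDual ℝ (EuclideanSpace ℝ (Fin n))).symm.continuous.measurable.comp
    (measurable_fderiv ℝ u)

/-- The gradient of a Lipschitz function is its weak gradient. -/
theorem LipschitzWith.hasWeakGradient {u : EuclideanSpace ℝ (Fin n) → ℝ} {M : ℝ≥0}
    (hu : LipschitzWith M u) (hΩfin : volume Ω ≠ ∞) :
    HasWeakGradient Ω u (gradient u) := by
  have : IsFiniteMeasure (volume.restrict Ω) := ⟨by simpa using hΩfin.lt_top⟩
  have hgi : IntegrableOn (gradient u) Ω :=
    Integrable.of_bound (measurable_gradient u).aestronglyMeasurable M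
      (Eventually.of_forall fun x => by
        rw [norm_gradient_eq]; exact norm_fderiv_le_of_lipschitz ℝ hu)
  refine ⟨hu.continuous.locallyIntegrable.locallyIntegrableOn _, hgi.locallyIntegrableOn,
    fun φ hφ hφc hφΩ i => ?_⟩
  set v : EuclideanSpace ℝ (Fin n) := EuclideanSpace.single i 1
  obtain ⟨D, hD⟩ := hφ.lipschitzWith_of_hasCompactSupport hφc (by simp)
  have hφd : Differentiable ℝ φ := hφ.differentiable (by simp)
  have h := hu.integral_lineDeriv_mul_eq (μ := volume) hD hφc v
  have hz : ∀ x ∉ Ω, φ x = 0 ∧ fderiv ℝ φ x v = 0 := fun x hx => by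
    have hx' : x ∉ tsupport φ := fun h => hx (hφΩ h)
    refine ⟨image_eq_zero_of_notMem_tsupport hx', ?_⟩
    rw [fderiv_of_notMem_tsupport ℝ hx']; rfl
  have e1 : ∫ x in Ω, u x * fderiv ℝ φ x v = -∫ x, lineDeriv ℝ φ x (-v) * u x := by
    rw [setIntegral_eq_integral_of_forall_compl_eq_zero fun x hx => by simp [(hz x hx).2],
      ← integral_neg]
    refine integral_congr_ae (Eventually.of_forall fun x => ?_)
    simp only
    rw [(hφd x).lineDeriv_eq_fderiv, map_neg]
    ring
  have e2 : ∫ x in Ω, gradient u x i * φ x = ∫ x, lineDeriv ℝ u x v * φ x := by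
    rw [setIntegral_eq_integral_of_forall_compl_eq_zero fun x hx => by simp [(hz x hx).1]]
    refine integral_congr_ae ?_
    filter_upwards [hu.ae_differentiableAt] with x hx
    rw [gradient_apply_eq_fderiv, hx.lineDeriv_eq_fderiv]
  rw [e1, e2, h]

theorem lipschitzWith_intervalIntegral {ψ : ℝ → ℝ} {M : ℝ≥0} (hψm : Measurable ψ)
    (hψM : ∀ τ, |ψ τ| ≤ M) (R : ℝ) : LipschitzWith M fun ρ => ∫ τ in R..ρ, ψ τ := by
  have hint : ∀ a b, IntervalIntegrable ψ volume a b := fun a b =>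
    (intervalIntegrable_const (c := (M : ℝ))).mono_fun hψm.aestronglyMeasurable
      (Eventually.of_forall fun τ => by simpa using hψM τ)
  refine LipschitzWith.of_dist_le_mul fun a b => ?_
  rw [Real.dist_eq, Real.dist_eq, intervalIntegral.integral_interval_sub_left (hint _ _) (hint _ _)]
  exact intervalIntegral.norm_integral_le_of_norm_le_const (f := ψ) fun τ _ => hψM τ

theorem lipschitzWith_norm_sub_const (x₀ : EuclideanSpace ℝ (Fin n)) :
    LipschitzWith 1 fun y : EuclideanSpace ℝ (Fin n) => ‖y - x₀‖ := by
  simpa only [dist_eq_norm] using LipschitzWith.dist_left x₀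

/-- Under `s = ω τ^n` the measure `s^{1/n} ds/s` becomes `n ω^{1/n} dτ`, which is why the Hardy
operator is a radial primitive in disguise. -/
theorem lintegral_hardy_weight_eq (hn : 1 ≤ n) {ω : ℝ} (hω : 0 < ω) (f : ℝ → ℝ) {ρ R : ℝ}
    (hρ : 0 ≤ ρ) (hρR : ρ ≤ R) :
    ∫⁻ s in Ioo (ω * ρ ^ n) (ω * R ^ n), ENNReal.ofReal (s ^ (1 / n : ℝ) * f s / s) =
      ENNReal.ofReal (n * ω ^ (1 / n : ℝ)) *
        ∫⁻ τ in Ioo ρ R, ENNReal.ofReal (f (ω * τ ^ n)) := by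
  have hn0 : n ≠ 0 := by omega
  have hmono : ∀ a b : ℝ, 0 ≤ a → a < b → ω * a ^ n < ω * b ^ n := fun a b ha hab => by
    have := pow_lt_pow_left₀ hab ha hn0
    gcongr
  have himg : (fun τ : ℝ => ω * τ ^ n) '' Ioo ρ R = Ioo (ω * ρ ^ n) (ω * R ^ n) := by
    refine Subset.antisymm ?_ (intermediate_value_Ioo hρR
      (f := fun τ : ℝ => ω * τ ^ n) (by fun_prop))
    rintro _ ⟨τ, hτ, rfl⟩
    exact ⟨hmono _ _ hρ hτ.1, hmono _ _ (hρ.trans hτ.1.le) hτ.2⟩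
  have hinj : InjOn (fun τ : ℝ => ω * τ ^ n) (Ioo ρ R) := by
    refine StrictMonoOn.injOn fun a ha b _ hab => hmono a b (hρ.trans ha.1.le) hab
  rw [← himg, lintegral_image_eq_lintegral_abs_deriv_mul measurableSet_Ioo
    (f' := fun τ => ω * (n * τ ^ (n - 1)))
    (fun τ _ => ((hasDerivAt_pow n τ).const_mul ω).hasDerivWithinAt) hinj,
    ← lintegral_const_mul' _ _ ENNReal.ofReal_ne_top]
  refine setLIntegral_congr_fun measurableSet_Ioo fun τ hτ => ?_
  have hτ0 : 0 < τ := hρ.trans_lt hτ.1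
  rw [← ENNReal.ofReal_mul (abs_nonneg _), ← ENNReal.ofReal_mul (by positivity),
    abs_of_pos (by have : (0 : ℝ) < n := by exact_mod_cast hn
                   positivity)]
  congr 1
  have e1 : (ω * τ ^ n) ^ (1 / n : ℝ) = ω ^ (1 / n : ℝ) * τ := by
    rw [Real.mul_rpow hω.le (by positivity), one_div, Real.pow_rpow_inv_natCast hτ0.le hn0]
  have e2 : τ ^ n = τ ^ (n - 1) * τ := by rw [← pow_succ, Nat.sub_add_cancel hn]
  rw [e1]
  nth_rewrite 2 [e2]
  field_simp

variable {x₀ : EuclideanSpace ℝ (Fin n)} {σ : EuclideanSpace ℝ (Fin n) → ℝ} {ω R : ℝ} {f : ℝ → ℝ}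
  {M : ℝ≥0}

/-- The radial Lipschitz function with slope `f (ω * ‖x - x₀‖ ^ n)` that vanishes outside the ball
of radius `R`. -/
noncomputable def radialPrimitive (f : ℝ → ℝ) (ω R : ℝ) (x₀ x : EuclideanSpace ℝ (Fin n)) : ℝ :=
  ∫ τ in R..‖x - x₀‖, (Ioo 0 R).indicator (fun τ => f (ω * τ ^ n)) τ

theorem abs_indicator_profile_le (hfM : ∀ s, |f s| ≤ M) (τ : ℝ) :
    |(Ioo 0 R).indicator (fun τ => f (ω * τ ^ n)) τ| ≤ M := by
  by_cases h : τ ∈ Ioo 0 R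
  · simp [h, hfM]
  · simp [h]

theorem measurable_indicator_profile (hf : Measurable f) :
    Measurable ((Ioo 0 R).indicator fun τ => f (ω * τ ^ n)) :=
  Measurable.indicator (by fun_prop) measurableSet_Ioo

theorem lipschitzWith_radialPrimitive (hf : Measurable f) (hfM : ∀ s, |f s| ≤ M) :
    LipschitzWith M (radialPrimitive f ω R x₀) := by
  have h := (lipschitzWith_intervalIntegral (measurable_indicator_profile (n := n) (ω := ω) (R := R)
    hf) (abs_indicator_profile_le hfM) R).comp
    (lipschitzWith_norm_sub_const x₀)
  rw [mul_one] at h; exact h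

theorem radialPrimitive_of_le {x : EuclideanSpace ℝ (Fin n)} (hx : R ≤ ‖x - x₀‖) :
    radialPrimitive f ω R x₀ x = 0 := by
  refine intervalIntegral.integral_zero_ae (Eventually.of_forall fun τ hτ => ?_)
  rw [uIoc_of_le hx] at hτ
  exact indicator_of_notMem (fun h => absurd h.2 (not_lt.2 hτ.1.le)) _

/-- Inside the ball the integral runs backwards from `R`, so the primitive is nonpositive there;
only its absolute value matters. -/
theorem enorm_radialPrimitive (hf : Measurable f) (hfM : ∀ s, |f s| ≤ M) (hf0 : ∀ s, 0 ≤ f s)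
    {x : EuclideanSpace ℝ (Fin n)} (hx : ‖x - x₀‖ ≤ R) :
    ‖radialPrimitive f ω R x₀ x‖ₑ =
      ∫⁻ τ in Ioo ‖x - x₀‖ R, ENNReal.ofReal (f (ω * τ ^ n)) := by
  rw [radialPrimitive, intervalIntegral.integral_symm, enorm_neg,
    intervalIntegral.integral_of_le hx, ← restrict_Ioo_eq_restrict_Ioc,
    Real.enorm_of_nonneg (integral_nonneg fun τ => indicator_nonneg (fun _ _ => hf0 _) _),
    ofReal_integral_eq_lintegral_ofReal]
  · refine setLIntegral_congr_fun measurableSet_Ioo fun τ hτ => ?_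
    rw [indicator_of_mem (show τ ∈ Ioo 0 R from ⟨(norm_nonneg _).trans_lt hτ.1, hτ.2⟩)]
  · exact Integrable.of_bound (measurable_indicator_profile hf).aestronglyMeasurable M
      (Eventually.of_forall (abs_indicator_profile_le hfM))
  · exact Eventually.of_forall fun τ => indicator_nonneg (fun _ _ => hf0 _) _

theorem enorm_gradient_radialPrimitive_le (hn : 1 ≤ n) (hf : Measurable f)
    (hfM : ∀ s, |f s| ≤ M) (hf0 : ∀ s, 0 ≤ f s)
    (hσ : MeasurePreserving σ (volume.restrict Ω) unitMeasure)
    (hσ1 : ∀ x ∈ Metric.ball x₀ R, σ x = ω * ‖x - x₀‖ ^ n) :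
    ∀ᵐ x ∂(volume.restrict Ω),
      ‖gradient (radialPrimitive f ω R x₀) x‖ₑ ≤ ENNReal.ofReal (f (σ x)) := by
  have : NeZero n := ⟨by omega⟩
  set ψ := (Ioo 0 R).indicator fun τ => f (ω * τ ^ n)
  have hloc : LocallyIntegrable ψ volume :=
    (memLp_top_of_bound (measurable_indicator_profile hf).aestronglyMeasurable M
      (Eventually.of_forall (abs_indicator_profile_le hfM))).locallyIntegrable le_top
  set N : Set ℝ := {ρ | ¬ ∀ c, HasDerivAt (fun ρ => ∫ τ in c..ρ, ψ τ) (ψ ρ) ρ}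
  have hN : volume N = 0 := _root_.LocallyIntegrable.ae_hasDerivAt_integral hloc
  -- The radii at which the primitive fails to have derivative `ψ` form a null set. Its image under
  -- a differentiable map is null, and its preimage under the measure preserving `σ` is then null in
  -- `Ω`.
  have hpN : volume ((fun τ : ℝ => ω * τ ^ n) '' N) = 0 :=
    addHaar_image_eq_zero_of_differentiableOn_of_addHaar_eq_zero volume
      (Differentiable.differentiableOn (by fun_prop)) hN
  have h1 : ∀ᵐ x ∂(volume.restrict Ω), σ x ∉ (fun τ : ℝ => ω * τ ^ n) '' N := by
    have hu : ∀ᵐ s ∂unitMeasure, s ∉ (fun τ : ℝ => ω * τ ^ n) '' N :=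
      ae_restrict_of_ae (measure_eq_zero_iff_ae_notMem.1 hpN)
    exact hσ.quasiMeasurePreserving.ae hu
  have h2 : ∀ᵐ x ∂(volume.restrict Ω), x ∉ Metric.sphere x₀ R :=
    ae_restrict_of_ae (measure_eq_zero_iff_ae_notMem.1 (Measure.addHaar_sphere volume x₀ R))
  have h3 : ∀ᵐ x ∂(volume.restrict Ω), x ∉ ({x₀} : Set (EuclideanSpace ℝ (Fin n))) :=
    ae_restrict_of_ae (measure_eq_zero_iff_ae_notMem.1 (measure_singleton x₀))
  filter_upwards [h1, h2, h3] with x hx1 hx2 hx3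
  rw [← ofReal_norm, norm_gradient_eq]
  refine ENNReal.ofReal_le_ofReal ?_
  rcases lt_or_ge ‖x - x₀‖ R with hlt | hge
  · have hxb : x ∈ Metric.ball x₀ R := by simpa [dist_eq_norm] using hlt
    have hxN : ‖x - x₀‖ ∉ N := fun h => hx1 ⟨_, h, (hσ1 x hxb).symm⟩
    have hd := not_not.1 hxN R
    have hx0 : x - x₀ ≠ 0 := sub_ne_zero.2 hx3
    have hnd : DifferentiableAt ℝ (fun y : EuclideanSpace ℝ (Fin n) => ‖y - x₀‖) x :=
      (differentiableAt_id.sub_const x₀).norm ℝ hx0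
    have hcomp := hd.comp_hasFDerivAt x hnd.hasFDerivAt
    have hfd : fderiv ℝ (radialPrimitive f ω R x₀) x = _ := hcomp.fderiv
    have hψ : ψ ‖x - x₀‖ = f (σ x) := by
      rw [hσ1 x hxb]
      exact indicator_of_mem (show ‖x - x₀‖ ∈ Ioo 0 R from ⟨norm_pos_iff.2 hx0, hlt⟩) _
    rw [hfd, norm_smul, hψ, Real.norm_of_nonneg (hf0 _)]
    exact mul_le_of_le_one_right (hf0 _) (norm_fderiv_le_of_lipschitz ℝ (lipschitzWith_norm_sub_const x₀))
  · have hgt : R < ‖x - x₀‖ := lt_of_le_of_ne hge fun h => hx2 (by simp [h])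
    have hev : radialPrimitive f ω R x₀ =ᶠ[𝓝 x] fun _ => 0 := by
      have hc : ContinuousAt (fun y : EuclideanSpace ℝ (Fin n) => ‖y - x₀‖) x := by fun_prop
      filter_upwards [hc.eventually_const_lt hgt] with y hy
      exact radialPrimitive_of_le hy.le
    rw [hev.fderiv_eq]
    simpa using hf0 _

end TestFunctions

/-! ### The Sobolev inequality implies the Hardy inequality for bounded functions. -/

section Necessity

open Filter Topology

variable {n : ℕ} {Ω : Set (EuclideanSpace ℝ (Fin n))}
  {x₀ : EuclideanSpace ℝ (Fin n)} {σ : EuclideanSpace ℝ (Fin n) → ℝ} {ω R : ℝ} {f : ℝ → ℝ}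
  {M : ℝ≥0}

theorem hardyOp_comp_eq_radialPrimitive (hn : 1 ≤ n) (hω : 0 < ω) (hωR : ω * R ^ n ≤ 1)
    (hf : Measurable f) (hfM : ∀ s, |f s| ≤ M) (hf0 : ∀ s, 0 ≤ f s)
    (hσ1 : ∀ x ∈ Metric.ball x₀ R, σ x = ω * ‖x - x₀‖ ^ n) {x : EuclideanSpace ℝ (Fin n)}
    (hx : x ∈ Metric.ball x₀ R) :
    hardyOp n f (σ x) = ENNReal.ofReal (n * ω ^ (1 / n : ℝ)) * ‖radialPrimitive f ω R x₀ x‖ₑ +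
      hardyOp n f (ω * R ^ n) := by
  have hx' : ‖x - x₀‖ ≤ R := by
    rw [Metric.mem_ball, dist_eq_norm] at hx; exact hx.le
  rw [enorm_radialPrimitive hf hfM hf0 hx', ← lintegral_hardy_weight_eq hn hω f (norm_nonneg _) hx',
    hσ1 x hx]
  exact setLIntegral_Ioo_split _ (by gcongr) hωR

/-- The three terms of the constant account for the deviation of the radial function from its mean,
for the mean itself, and for the tail of the Hardy integral beyond the volume of the ball. -/
theorem hardy_bound_of_sobolev_embedding_of_bounded (hn : 1 ≤ n)
    (hΩ : volume Ω = 1) (X Y : RINorm (volume.restrict Ω)) {C K : ℝ≥0}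
    (hC : ∀ f g, HasWeakGradient Ω f g → X.Mem f → X.Mem g →
        Y.norm (fun x => ‖f x - ⨍ y in Ω, f y‖ₑ) ≤ C * X.norm (fun x => ‖g x‖ₑ))
    (hσ : MeasurePreserving σ (volume.restrict Ω) unitMeasure)
    (hK : ∀ h, AEMeasurable h unitMeasure → ∫⁻ s, h s ∂unitMeasure ≤ K * (X.toUnit hσ).norm h)
    (hω : 0 < ω) (hR : 0 < R) (hωR : ω * R ^ n ≤ 1)
    (hσ1 : ∀ x ∈ Metric.ball x₀ R, σ x = ω * ‖x - x₀‖ ^ n)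
    (hσ2 : ∀ x ∉ Metric.ball x₀ R, ω * R ^ n ≤ σ x)
    (hf : Measurable f) (hfM : ∀ s, |f s| ≤ M) (hf0 : ∀ s, 0 ≤ f s) :
    (Y.toUnit hσ).norm (hardyOp n f) ≤
      (ENNReal.ofReal (n * ω ^ (1 / n : ℝ)) * C + K * Y.norm 1 +
        ENNReal.ofReal (ω * R ^ n)⁻¹ * K * Y.norm 1) * (X.toUnit hσ).norm fun s => ‖f s‖ₑ := by
  have : IsProbabilityMeasure (volume.restrict Ω) := ⟨by simp [hΩ]⟩
  set u := radialPrimitive f ω R x₀ with hu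
  have hn0 : (0 : ℝ) < n := by exact_mod_cast hn
  have hκ0 : 0 < n * ω ^ (1 / n : ℝ) := by positivity
  set κ := ENNReal.ofReal (n * ω ^ (1 / n : ℝ)) with hκ
  have hκ' : κ ≠ ∞ := ENNReal.ofReal_ne_top
  set b := ω * R ^ n
  have hb : 0 < b := by positivity
  set A := (X.toUnit hσ).norm fun s => ‖f s‖ₑ with hA
  have hlip : LipschitzWith M u := lipschitzWith_radialPrimitive hf hfM
  have hum : Measurable u := hlip.continuous.measurable
  have hint : ∫⁻ s, ‖f s‖ₑ ∂unitMeasure ≤ K * A := hK _ hf.enorm.aemeasurable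
  have hAfin : A < ∞ := by
    refine ((X.toUnit hσ).norm_mono _ (fun _ => (M : ℝ≥0∞)) hf.enorm.aemeasurable aemeasurable_const
      (Eventually.of_forall fun s => ?_)).trans_lt ?_
    · beta_reduce
      rw [Real.enorm_eq_ofReal_abs]
      exact (ENNReal.ofReal_le_ofReal (hfM s)).trans_eq (by simp)
    · rw [RINorm.norm_const_eq _ ENNReal.coe_ne_top]
      exact ENNReal.mul_lt_top ENNReal.coe_lt_top (RINorm.norm_one_lt_top _)
  have hgA : X.norm (fun x => ‖gradient u x‖ₑ) ≤ A := by
    rw [hA, RINorm.toUnit_norm_comp]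
    refine X.norm_mono _ _ (measurable_gradient u).enorm.aemeasurable
      (hf.comp hσ.measurable).enorm.aemeasurable ?_
    filter_upwards [enorm_gradient_radialPrimitive_le hn hf hfM hf0 hσ hσ1] with x hx
    rwa [Real.enorm_of_nonneg (hf0 _)]
  -- On the ball the first inequality is an equality. Outside it `u` vanishes, and `σ x ≥ b` bounds
  -- the Hardy transform by its value at `b`.
  have hcase : ∀ x, hardyOp n f (σ x) ≤ κ * ‖u x‖ₑ + hardyOp n f b ∧
      κ * ‖u x‖ₑ ≤ hardyOp n f (σ x) := by
    intro x
    by_cases hx : x ∈ Metric.ball x₀ R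
    · rw [hardyOp_comp_eq_radialPrimitive hn hω hωR hf hfM hf0 hσ1 hx]
      exact ⟨le_rfl, le_self_add⟩
    · have hu0 : u x = 0 := radialPrimitive_of_le (by
        simpa [Metric.mem_ball, dist_eq_norm] using hx)
      rw [hu0]
      simpa using hardyOp_antitone n f (hσ2 x hx)
  have huint : κ * ∫⁻ x in Ω, ‖u x‖ₑ ≤ K * A := by
    rw [← lintegral_const_mul _ hum.enorm]
    refine (lintegral_mono fun x => (hcase x).2).trans ?_
    rw [hσ.lintegral_comp (hardyOp_antitone n f).measurable]
    exact (lintegral_hardyOp_le hf.aemeasurable hf0).trans hint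
  have huX : X.Mem u := by
    have hbd : ∀ x, ‖u x‖ ≤ M * R := fun x => by
      rcases le_or_gt R ‖x - x₀‖ with h | h
      · rw [hu, radialPrimitive_of_le h]; simp; positivity
      · rw [hu, radialPrimitive]
        refine (intervalIntegral.norm_integral_le_of_norm_le_const fun τ _ =>
          abs_indicator_profile_le hfM τ).trans ?_
        gcongr
        rw [abs_of_nonpos (by linarith)]
        linarith [norm_nonneg (x - x₀)]
    refine ⟨hum.aestronglyMeasurable, ?_⟩
    refine (X.norm_mono _ (fun _ => ENNReal.ofReal (M * R)) hum.enorm.aemeasurable aemeasurable_const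
      (Eventually.of_forall fun x => ?_)).trans_lt ?_
    · beta_reduce
      rw [← ofReal_norm]
      exact ENNReal.ofReal_le_ofReal (hbd x)
    · rw [X.norm_const_eq ENNReal.ofReal_ne_top]
      exact ENNReal.mul_lt_top ENNReal.ofReal_lt_top X.norm_one_lt_top
  have hpoin := hC u (gradient u) (hlip.hasWeakGradient (by simp [hΩ])) huX
    ⟨(measurable_gradient u).aestronglyMeasurable, hgA.trans_lt hAfin⟩
  set c := ⨍ y in Ω, u y
  have hc : κ * ‖c‖ₑ ≤ K * A := by
    refine le_trans ?_ huint
    gcongr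
    have := enorm_sub_average_le huX.integrable 0
    simpa using this
  have hHb : hardyOp n f b ≤ ENNReal.ofReal b⁻¹ * (K * A) :=
    (hardyOp_le_lintegral n f hb).trans (by gcongr)
  have hHbfin : hardyOp n f b ≠ ∞ :=
    (hHb.trans_lt (ENNReal.mul_lt_top ENNReal.ofReal_lt_top
      (ENNReal.mul_lt_top ENNReal.coe_lt_top hAfin))).ne
  have hκc : κ * ‖c‖ₑ ≠ ∞ := ENNReal.mul_ne_top hκ' enorm_ne_top
  have hdm : Measurable fun x => κ * ‖u x - c‖ₑ := by fun_prop
  calc (Y.toUnit hσ).norm (hardyOp n f)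
      ≤ Y.norm fun x => κ * ‖u x - c‖ₑ + (κ * ‖c‖ₑ + hardyOp n f b) := by
        rw [RINorm.toUnit_norm_comp]
        refine Y.norm_mono _ _ ((hardyOp_antitone n f).measurable.comp hσ.measurable).aemeasurable
          (by fun_prop) (Eventually.of_forall fun x => (hcase x).1.trans ?_)
        beta_reduce
        rw [← add_assoc, ← mul_add]
        gcongr
        have := enorm_add_le (u x - c) c
        rwa [sub_add_cancel] at this
    _ ≤ Y.norm (fun x => κ * ‖u x - c‖ₑ) + Y.norm fun _ => κ * ‖c‖ₑ + hardyOp n f b :=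
        Y.norm_add_le _ _ hdm.aemeasurable aemeasurable_const
    _ = κ * Y.norm (fun x => ‖u x - c‖ₑ) + (κ * ‖c‖ₑ + hardyOp n f b) * Y.norm 1 := by
        rw [Y.norm_const_eq (ENNReal.add_ne_top.2 ⟨hκc, hHbfin⟩)]
        congr 1
        exact Y.norm_smul _ _ (by fun_prop)
    _ ≤ κ * (C * A) + (K * A + ENNReal.ofReal b⁻¹ * (K * A)) * Y.norm 1 := by
        gcongr
        exact hpoin.trans (by gcongr)
    _ = _ := by ring

theorem hardyOp_congr_ae {f₁ f₂ : ℝ → ℝ} (h : f₁ =ᵐ[unitMeasure] f₂) {t : ℝ} (ht : 0 ≤ t) :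
    hardyOp n f₁ t = hardyOp n f₂ t := by
  have h' : f₁ =ᵐ[volume.restrict (Ioo t 1)] f₂ :=
    ae_mono (Measure.restrict_mono (Ioo_subset_Ioo_left ht) le_rfl) h
  exact lintegral_congr_ae (h'.mono fun s hs => by simp only [hs])

theorem hardyOp_eq_iSup_min (hf : Measurable f) {t : ℝ} (ht : 0 ≤ t) :
    hardyOp n f t = ⨆ k : ℕ, hardyOp n (fun s => min (f s) k) t := by
  unfold hardyOp
  rw [← lintegral_iSup' (fun k => by fun_prop)]
  · refine setLIntegral_congr_fun measurableSet_Ioo fun s hs => ?_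
    have hs0 : 0 < s := ht.trans_lt hs.1
    refine le_antisymm ?_ (iSup_le fun k => ENNReal.ofReal_le_ofReal ?_)
    · obtain ⟨k, hk⟩ := exists_nat_ge (f s)
      refine le_iSup_of_le k ?_
      beta_reduce
      rw [min_eq_left hk]
    · gcongr
      exact min_le_left _ _
  · refine ae_restrict_of_forall_mem measurableSet_Ioo fun s hs i j hij => ?_
    have hs0 : 0 < s := ht.trans_lt hs.1
    have hij' : (i : ℝ) ≤ j := by exact_mod_cast hij
    refine ENNReal.ofReal_le_ofReal ?_
    beta_reduce
    gcongr

end Necessity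

/-! ### Removal of boundedness, and the equivalence. -/

section Equivalence

open Filter Topology

variable {n : ℕ} {Ω : Set (EuclideanSpace ℝ (Fin n))}
  {x₀ : EuclideanSpace ℝ (Fin n)} {σ : EuclideanSpace ℝ (Fin n) → ℝ} {R : ℝ}

/-- The bounded case has a constant independent of the bound `M`. It is applied to the truncations
`min (g s) k` of a nonnegative measurable representative `g`, and the Fatou property of `Y` lets `k`
grow. -/
theorem hardy_bound_of_sobolev_embedding (hn : 1 ≤ n) (hΩ : volume Ω = 1)
    (X Y : RINorm (volume.restrict Ω)) (hσ : MeasurePreserving σ (volume.restrict Ω) unitMeasure)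
    (hR0 : 0 < R) (hR : Metric.ball x₀ R ⊆ Ω)
    (hσ1 : ∀ x ∈ Metric.ball x₀ R, σ x =
      (volume (Metric.ball (0 : EuclideanSpace ℝ (Fin n)) 1)).toReal * ‖x - x₀‖ ^ n)
    (hσ2 : ∀ x ∉ Metric.ball x₀ R, (volume (Metric.ball x₀ R)).toReal ≤ σ x)
    (h : ∃ C : ℝ≥0, ∀ f g, HasWeakGradient Ω f g → X.Mem f → X.Mem g →
        Y.norm (fun x => ‖f x - ⨍ y in Ω, f y‖ₑ) ≤ C * X.norm (fun x => ‖g x‖ₑ)) :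
    ∃ C : ℝ≥0, ∀ f : ℝ → ℝ, AEMeasurable f unitMeasure → (∀ s, 0 ≤ f s) →
        X.hat (fun s => ‖f s‖ₑ) < ∞ →
        Y.hat (hardyOp n f) ≤ C * X.hat (fun s => ‖f s‖ₑ) := by
  have : IsProbabilityMeasure (volume.restrict Ω) := ⟨by simp [hΩ]⟩
  obtain ⟨C, hC⟩ := h
  obtain ⟨K, hK⟩ := (X.toUnit hσ).exists_lintegral_le
  have hω : 0 < (volume (Metric.ball (0 : EuclideanSpace ℝ (Fin n)) 1)).toReal :=
    ENNReal.toReal_pos (Metric.measure_ball_pos _ _ one_pos).ne' measure_ball_lt_top.ne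
  generalize hωdef : (volume (Metric.ball (0 : EuclideanSpace ℝ (Fin n)) 1)).toReal = ω at *
  have hball : (volume (Metric.ball x₀ R)).toReal = ω * R ^ n := by
    rw [Measure.addHaar_ball_of_pos _ _ hR0, ENNReal.toReal_mul, hωdef,
      ENNReal.toReal_ofReal (by positivity), finrank_euclideanSpace_fin, mul_comm]
  have hωR : ω * R ^ n ≤ 1 := by
    rw [← hball]
    exact ENNReal.toReal_le_of_le_ofReal zero_le_one
      ((measure_mono hR).trans (by simp [hΩ]))
  rw [hball] at hσ2
  set D := ENNReal.ofReal (n * ω ^ (1 / n : ℝ)) * C + K * Y.norm 1 +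
    ENNReal.ofReal (ω * R ^ n)⁻¹ * K * Y.norm 1 with hD
  have hY1 := Y.norm_one_lt_top
  have hDfin : D ≠ ∞ := by
    rw [hD]
    finiteness
  refine ⟨D.toNNReal, fun f hf hf0 _ => ?_⟩
  rw [ENNReal.coe_toNNReal hDfin]
  obtain ⟨g, hg, hg0, hfg⟩ : ∃ g : ℝ → ℝ, Measurable g ∧ (∀ s, 0 ≤ g s) ∧ f =ᵐ[unitMeasure] g :=
    ⟨fun s => max (hf.mk f s) 0, hf.measurable_mk.max measurable_const,
      fun s => le_max_right _ _, hf.ae_eq_mk.mono fun s hs => by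
        beta_reduce
        rw [← hs, max_eq_left (hf0 s)]⟩
  have hpos : ∀ᵐ t ∂unitMeasure, 0 ≤ t :=
    ae_restrict_of_forall_mem measurableSet_Ioo fun t ht => ht.1.le
  rw [X.hat_eq_toUnit hσ hf.enorm, Y.hat_eq_toUnit hσ (hardyOp_antitone n f).measurable.aemeasurable]
  have hsup : hardyOp n f =ᵐ[unitMeasure] fun t => ⨆ k : ℕ, hardyOp n (fun s => min (g s) k) t :=
    hpos.mono fun t ht => by rw [hardyOp_congr_ae hfg ht, hardyOp_eq_iSup_min hg ht]
  have hmeas : ∀ k : ℕ, Measurable (hardyOp n fun s => min (g s) k) :=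
    fun k => (hardyOp_antitone n _).measurable
  have hmono : ∀ᵐ t ∂unitMeasure, Monotone fun k : ℕ => hardyOp n (fun s => min (g s) k) t :=
    hpos.mono fun t ht i j hij => by
      refine setLIntegral_mono' measurableSet_Ioo fun s hs => ENNReal.ofReal_le_ofReal ?_
      have hs0 : 0 < s := ht.trans_lt hs.1
      have hij' : (i : ℝ) ≤ j := by exact_mod_cast hij
      beta_reduce
      gcongr
  rw [(Y.toUnit hσ).norm_congr_ae (hardyOp_antitone n f).measurable.aemeasurable hsup,
    (Y.toUnit hσ).norm_iSup _ (fun k => (hmeas k).aemeasurable) hmono]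
  refine iSup_le fun k => ?_
  have hmin0 : ∀ s, 0 ≤ min (g s) (k : ℝ) := fun s => le_min (hg0 s) k.cast_nonneg
  refine (hardy_bound_of_sobolev_embedding_of_bounded (M := (k : ℝ≥0)) hn hΩ X Y hC hσ hK hω hR0 hωR
    hσ1 hσ2 (hg.min measurable_const) (fun s => ?_) hmin0).trans ?_
  · rw [abs_of_nonneg (hmin0 s)]
    exact (min_le_right _ _).trans (by simp)
  · gcongr
    refine (X.toUnit hσ).norm_mono _ _ (hg.min measurable_const).enorm.aemeasurable hf.enorm
      (hfg.mono fun s hs => ?_)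
    beta_reduce
    rw [hs, Real.enorm_of_nonneg (hmin0 s), Real.enorm_of_nonneg (hg0 s)]
    exact ENNReal.ofReal_le_ofReal (min_le_left _ _)

end Equivalence

theorem theorem2 {n : ℕ} (hn : 2 ≤ n) (Ω : Set (EuclideanSpace ℝ (Fin n)))
    (hΩo : IsOpen Ω) (hΩc : IsConnected Ω) (hΩ : volume Ω = 1)
    (X Y : RINorm (volume.restrict Ω)) (hP : SobolevPoincare Ω) :
    List.TFAE [
      ∃ C : ℝ≥0, ∀ f : ℝ → ℝ, AEMeasurable f unitMeasure →
        Y.hat (fun s => ‖f s‖ₑ) ≤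
          C * (X.hat (weightedOscillation n f) + ∫⁻ s, ‖f s‖ₑ ∂unitMeasure),
      ∃ C : ℝ≥0, ∀ f : ℝ → ℝ, AEMeasurable f unitMeasure → (∀ s, 0 ≤ f s) →
        X.hat (fun s => ‖f s‖ₑ) < ∞ →
        Y.hat (hardyOp n f) ≤ C * X.hat (fun s => ‖f s‖ₑ),
      ∃ C : ℝ≥0, ∀ f g, HasWeakGradient Ω f g → X.Mem f → X.Mem g →
        Y.norm (fun x => ‖f x - ⨍ y in Ω, f y‖ₑ) ≤ C * X.norm (fun x => ‖g x‖ₑ)] := by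
  have hn1 : 1 ≤ n := by omega
  obtain ⟨x₀, hx₀⟩ := hΩc.nonempty
  obtain ⟨R, hR0, hR⟩ := Metric.isOpen_iff.1 hΩo x₀ hx₀
  obtain ⟨σ, hσ, hσ1, hσ2⟩ := exists_radial_measurePreserving hn1 hΩ hR
  tfae_have 1 → 2 := hardy_bound_of_oscillation_bound hn1 X Y hσ
  tfae_have 2 → 1 := oscillation_bound_of_hardy_bound X Y hσ
  tfae_have 2 → 3 := sobolev_embedding_of_hardy_bound hn hΩo hΩ hP X Y hσ
  tfae_have 3 → 2 := hardy_bound_of_sobolev_embedding hn1 hΩ X Y hσ hR0 hR hσ1 hσ2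
  tfae_finish
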